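/- Let $\mathfrak g$ be a finite-dimensional simple complex Lie algebra with $\operatorname{rank}(\mathfrak g)\ge 2$, let $\theta\neq\mathrm{id}$ be an involution of $\mathfrak g$, and let $\mathfrak g=\mathfrak h\oplus\mathfrak m$ be its decomposition into the $(+1)$- and $(-1)$-eigenspaces of $\theta$. Let $\mathfrak g[u]=\mathfrak g\otimes\mathbb C[u]$, write $x^{(k)}=x\otimes u^k$, extend $\theta$ to $\mathfrak g[u]$ by $\theta(x^{(k)})=(-1)^k\theta(x)^{(k)}$, and let $\mathfrak g[u]^\theta$ be the Lie subalgebra of fixed points (the twisted half-loop algebra). Let $\{X_\alpha\}\cup\{Y_p\}$ be a basis of $\mathfrak g$ with $X_\alpha\in\mathfrak h$ and $Y_p\in\mathfrak m$, such that each $X_\alpha$ lies in a simple ideal or in the centre of $\mathfrak h$. Repeated indices are summed. Define structure constants by $$[X_\alpha,X_\beta]=f_{\alpha\beta}{}^{\gamma}X_\gamma,\quad [X_\alpha,Y_p]=g_{\alpha p}{}^{q}Y_q,\quad [Y_p,X_\alpha]=g_{p\alpha}{}^{q}Y_q,\quad [Y_p,Y_q]=\sum_\alpha w_{pq}{}^{\alpha}X_\alpha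 .$$ Let $\kappa^{\alpha\beta}$ and $\kappa_{\mathfrak m}^{pq}$ be the inverses of the Gram matrices of the Killing form of $\mathfrak g$ on $\{X_\alpha\}$ and on $\{Y_p\}$, and put $w_\alpha{}^{pq}=\kappa_{\mathfrak m}^{pr}\,g_{\alpha r}{}^{q}$. Let $\mathfrak c_{\mathfrak g}$ be the eigenvalue in the adjoint representation of the quadratic Casimir element of $\mathfrak g$ attached to the Killing form. Let $\mathfrak c_{(\alpha)}$ be the eigenvalue of $\sum_{\mu,\nu}\kappa^{\mu\nu}\,\mathrm{ad}X_\mu\,\mathrm{ad}X_\nu$ on the simple ideal or centre of $\mathfrak h$ containing $X_\alpha$ (so $\mathfrak c_{(\alpha)}=0$ if $X_\alpha$ is central in $\mathfrak h$), and put $\bar{\mathfrak c}_{(\alpha)}=\mathfrak c_{\mathfrak g}-\mathfrak c_{(\alpha)}$. Then $\mathfrak g[u]^\theta$ is isomorphic to the complex Lie algebra presented by generators $X_\alpha$ and $B(y)$, $y\in\mathfrak m$, with the relations $$[X_\alpha,X_\beta]=f_{\alpha\beta}{}^{\gamma}X_\gamma,\qquad [X_\alpha,B(Y_p)]=g_{\alpha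 p}{}^{q}B(Y_q),\qquad B(ay+a'y')=aB(y)+a'B(y')$$ for all indices, all $a,a'\in\mathbb C$ and all $y,y'\in\mathfrak m$ (so that the $X_\alpha$ and $B(Y_p)$ generate), together with $$[B(Y_p),B(Y_q)]+\sum_\alpha\frac1{\bar{\mathfrak c}_{(\alpha)}}\,w_{pq}{}^{\alpha}\,w_\alpha{}^{rs}\,[B(Y_r),B(Y_s)]=0,\tag{LH2}$$ $$[[B(Y_p),B(Y_q)],B(Y_r)]+\frac2{\mathfrak c_{\mathfrak g}}\sum_\alpha\kappa_{\mathfrak m}^{tu}\,w_{pq}{}^{\alpha}\,g_{r\alpha}{}^{s}\,[[B(Y_s),B(Y_t)],B(Y_u)]=0\tag{LH3}$$ for all $p,q,r$. An isomorphism is given by $X_\alpha\mapsto X_\alpha^{(0)}$, $B(Y_p)\mapsto Y_p^{(1)}$. -/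

import Mathlib

open scoped TensorProduct Polynomial Matrix

noncomputable section

namespace TwistedHalfLoop

universe u v w

variable {g : Type u} [LieRing g] [LieAlgebra ℂ g]

/-- The half-loop Lie algebra `g[u] = ℂ[u] ⊗ g`, with `[P ⊗ x, Q ⊗ y] = P Q ⊗ [x, y]`. -/
abbrev HalfLoop (g : Type u) [LieRing g] [LieAlgebra ℂ g] : Type u := ℂ[X] ⊗[ℂ] g

/-- The element `x^{(k)} = x ⊗ u^k` of the half-loop Lie algebra. -/
def level (k : ℕ) (x : g) : HalfLoop g := (Polynomial.X ^ k : ℂ[X]) ⊗ₜ[ℂ] x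

/-- The extension of `θ` to the half-loop Lie algebra, `θ(x^{(k)}) = (-1)^k θ(x)^{(k)}`; that is,
`u ↦ -u` on polynomials and `θ` on `g`. -/
def extend (θ : g →ₗ⁅ℂ⁆ g) : HalfLoop g →ₗ⁅ℂ⁆ HalfLoop g :=
  LieAlgebra.ExtendScalars.map (Polynomial.aeval (-Polynomial.X : ℂ[X])) θ

theorem extend_level (θ : g →ₗ⁅ℂ⁆ g) (k : ℕ) (x : g) :
    extend θ (level k x) = (-1 : ℂ) ^ k • level k (θ x) := by
  change (Polynomial.aeval (-Polynomial.X : ℂ[X]) (Polynomial.X ^ k)) ⊗ₜ[ℂ] θ x = _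
  rw [map_pow, Polynomial.aeval_X, neg_pow, level, TensorProduct.smul_tmul']
  congr 1
  simp [Algebra.smul_def]

/-- The Lie subalgebra of fixed points of a Lie algebra endomorphism. -/
def fixedPoints {L : Type u} [LieRing L] [LieAlgebra ℂ L] (φ : L →ₗ⁅ℂ⁆ L) : LieSubalgebra ℂ L where
  carrier := {x | φ x = x}
  add_mem' {x y} hx hy := by
    change φ x = x at hx
    change φ y = y at hy
    change φ (x + y) = x + y
    rw [map_add, hx, hy]
  zero_mem' := map_zero φ
  smul_mem' c x hx := by
    change φ x = x at hx
    change φ (c • x) = c • x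
    rw [map_smul, hx]
  lie_mem' {x y} hx hy := by
    change φ x = x at hx
    change φ y = y at hy
    change φ ⁅x, y⁆ = ⁅x, y⁆
    rw [LieHom.map_lie, hx, hy]

/-- The twisted half-loop Lie algebra `g[u]^θ`. -/
abbrev Twisted (θ : g →ₗ⁅ℂ⁆ g) : LieSubalgebra ℂ (HalfLoop g) := fixedPoints (extend θ)

/-- The `(-1)`-eigenspace `m` of `θ`. -/
def antiFixed (θ : g →ₗ⁅ℂ⁆ g) : Submodule ℂ g where
  carrier := {x | θ x = -x}
  add_mem' {x y} hx hy := by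
    change θ x = -x at hx
    change θ y = -y at hy
    change θ (x + y) = -(x + y)
    rw [map_add, hx, hy, neg_add]
  zero_mem' := by simp
  smul_mem' c x hx := by
    change θ x = -x at hx
    change θ (c • x) = -(c • x)
    rw [map_smul, hx, smul_neg]

/-- A symmetric space basis of `(g, θ)`: a basis `{X_α, Y_p}` of `g` with `θ(X_α) = X_α` and
`θ(Y_p) = -Y_p`, such that the `X_α` are adapted to the decomposition of `h = g^θ` into simple
ideals and centre, i.e. each `X_α` lies in a simple ideal or in the centre of `h`. -/
structure SymmetricSpaceBasis (θ : g →ₗ⁅ℂ⁆ g) (ι : Type v) (κ : Type w) where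
  basis : Module.Basis (ι ⊕ κ) ℂ g
  map_X : ∀ α, θ (basis (Sum.inl α)) = basis (Sum.inl α)
  map_Y : ∀ p, θ (basis (Sum.inr p)) = -basis (Sum.inr p)
  adapted : ∀ α, ∃ I : LieIdeal ℂ (fixedPoints θ),
    (LieAlgebra.IsSimple ℂ I ∨ I = LieAlgebra.center ℂ (fixedPoints θ)) ∧
      ∃ x ∈ I, (x : g) = basis (Sum.inl α)

namespace SymmetricSpaceBasis

variable {θ : g →ₗ⁅ℂ⁆ g} {ι : Type v} {κ : Type w} (b : SymmetricSpaceBasis θ ι κ)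

/-- `X_α ∈ h`. -/
def X (α : ι) : g := b.basis (Sum.inl α)

/-- `Y_p ∈ m`. -/
def Y (p : κ) : antiFixed θ := ⟨b.basis (Sum.inr p), b.map_Y p⟩

/-! Structure constants: `[X_α, X_β] = f_{αβ}^γ X_γ`, `[X_α, Y_p] = g_{αp}^q Y_q`,
`[Y_p, X_α] = g_{pα}^q Y_q`, `[Y_p, Y_q] = w_{pq}^α X_α`. -/

/-- `f_{αβ}^γ` -/
def f (α β γ : ι) : ℂ := b.basis.repr ⁅b.X α, b.X β⁆ (Sum.inl γ)

/-- `g_{αp}^q` -/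
def gXY (α : ι) (p q : κ) : ℂ := b.basis.repr ⁅b.X α, (b.Y p : g)⁆ (Sum.inr q)

/-- `g_{pα}^q` -/
def gYX (p : κ) (α : ι) (q : κ) : ℂ := b.basis.repr ⁅(b.Y p : g), b.X α⁆ (Sum.inr q)

/-- `w_{pq}^α` -/
def w (p q : κ) (α : ι) : ℂ := b.basis.repr ⁅(b.Y p : g), (b.Y q : g)⁆ (Sum.inl α)

variable [Fintype ι] [Fintype κ] [DecidableEq ι] [DecidableEq κ]

/-- The Gram matrix `(x_a, x_b)` of the Killing form of `g` in the whole basis. -/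
def eta : Matrix (ι ⊕ κ) (ι ⊕ κ) ℂ :=
  Matrix.of fun i j => killingForm ℂ g (b.basis i) (b.basis j)

/-- The Gram matrix of the Killing form of `g` in the basis `X_α` of `h`. -/
def kappaH : Matrix ι ι ℂ := Matrix.of fun α β => killingForm ℂ g (b.X α) (b.X β)

/-- The Gram matrix `κ_m` of the Killing form of `g` in the basis `Y_p` of `m`. -/
def kappaM : Matrix κ κ ℂ := Matrix.of fun p q => killingForm ℂ g (b.Y p : g) (b.Y q : g)

/-- The quadratic Casimir operator `η^{ab} ad x_a ad x_b` in the adjoint representation of `g`. -/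
def casimir : Module.End ℂ g :=
  ∑ i, ∑ j, b.eta⁻¹ i j • (LieAlgebra.ad ℂ g (b.basis i) ∘ₗ LieAlgebra.ad ℂ g (b.basis j))

/-- The eigenvalue `c_g` of the Casimir operator in the adjoint representation. It acts as a scalar
when `g` is simple, so the scalar is its trace divided by `dim g`. -/
def cG : ℂ := LinearMap.trace ℂ g b.casimir / (Module.finrank ℂ g : ℂ)

/-- `f_α^{βγ} = κ^{βμ} f_{αμ}^γ` -/
def fUp (α β γ : ι) : ℂ := ∑ μ, b.kappaH⁻¹ β μ * b.f α μ γ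

/-- `w_α^{pq} = κ_m^{pr} g_{αr}^q` -/
def wUp (α : ι) (p q : κ) : ℂ := ∑ r, b.kappaM⁻¹ p r * b.gXY α r q

/-- The eigenvalue `c_(α) = f_α^{μν} f_{νμ}^α` (no sum over `α`) of the operator
`C_X = κ^{μν} ad X_μ ad X_ν` on the simple ideal or centre of `h` that contains `X_α`, i.e. the
coefficient of `X_α` in `C_X X_α = c_(α) X_α`. It is zero if `X_α` is central in `h`. -/
def c (α : ι) : ℂ := ∑ μ, ∑ ν, b.fUp α μ ν * b.f ν μ α

/-- `c̄_(α) = c_g - c_(α)` -/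
def cBar (α : ι) : ℂ := b.cG - b.c α

end SymmetricSpaceBasis

/-- The generating symbols: `X_α` for `α : ι`, and `B(y)` for `y ∈ m`. -/
inductive Generator (θ : g →ₗ⁅ℂ⁆ g) (ι : Type v) : Type (max u v)
  | X : ι → Generator θ ι
  | B : antiFixed θ → Generator θ ι

namespace Relation

variable {θ : g →ₗ⁅ℂ⁆ g} {ι : Type v} {κ : Type w}

/-- The free Lie algebra on the generating symbols. -/
abbrev Free (θ : g →ₗ⁅ℂ⁆ g) (ι : Type v) : Type (max u v) := FreeLieAlgebra ℂ (Generator θ ι)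

/-- The symbol `X_α` in the free Lie algebra. -/
def X (θ : g →ₗ⁅ℂ⁆ g) {ι : Type v} (α : ι) : Free θ ι := FreeLieAlgebra.of ℂ (Generator.X α)

/-- The symbol `B(y)` in the free Lie algebra. -/
def B (ι : Type v) (y : antiFixed θ) : Free θ ι := FreeLieAlgebra.of ℂ (Generator.B y)

variable [Fintype ι] [Fintype κ] (b : SymmetricSpaceBasis θ ι κ)

/-! The five families of relators; each one is the left side minus the right side of a defining
relation. -/

/-- `[X_α, X_β] = f_{αβ}^γ X_γ` -/
def relXX (α β : ι) : Free θ ι := ⁅X θ α, X θ β⁆ - ∑ γ, b.f α β γ • X θ γ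

/-- `[X_α, B(Y_p)] = g_{αp}^q B(Y_q)` -/
def relXB (α : ι) (p : κ) : Free θ ι :=
  ⁅X θ α, B ι (b.Y p)⁆ - ∑ q, b.gXY α p q • B ι (b.Y q)

/-- `B(s y + t y') = s B(y) + t B(y')` -/
def relLin (ι : Type v) (s t : ℂ) (y y' : antiFixed θ) : Free θ ι :=
  B ι (s • y + t • y') - (s • B ι y + t • B ι y')

variable [DecidableEq ι] [DecidableEq κ]

/-- `[B(Y_p), B(Y_q)] + ∑_α c̄_(α)⁻¹ w_{pq}^α w_α^{rs} [B(Y_r), B(Y_s)] = 0` -/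
def relLevelTwo (p q : κ) : Free θ ι :=
  ⁅B ι (b.Y p), B ι (b.Y q)⁆ +
    ∑ α, ∑ r, ∑ s, (1 / b.cBar α * b.w p q α * b.wUp α r s) • ⁅B ι (b.Y r), B ι (b.Y s)⁆

/-- `[[B(Y_p), B(Y_q)], B(Y_r)]
  + (2 / c_g) ∑_α κ_m^{tu} w_{pq}^α g_{rα}^s [[B(Y_s), B(Y_t)], B(Y_u)] = 0` -/
def relLevelThree (p q r : κ) : Free θ ι :=
  ⁅⁅B ι (b.Y p), B ι (b.Y q)⁆, B ι (b.Y r)⁆ +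
    (2 / b.cG) • ∑ α, ∑ s, ∑ t, ∑ u, (b.kappaM⁻¹ t u * b.w p q α * b.gYX r α s) •
      ⁅⁅B ι (b.Y s), B ι (b.Y t)⁆, B ι (b.Y u)⁆

/-- All relators. -/
def all : Set (Free θ ι) :=
  {z | ∃ α β, z = relXX b α β} ∪ {z | ∃ α p, z = relXB b α p} ∪
    {z | ∃ s t y y', z = relLin ι s t y y'} ∪
    {z | ∃ p q, z = relLevelTwo b p q} ∪ {z | ∃ p q r, z = relLevelThree b p q r}

end Relation

section Presented

variable {θ : g →ₗ⁅ℂ⁆ g} {ι : Type v} {κ : Type w} [Fintype ι] [Fintype κ] [DecidableEq ι]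
  [DecidableEq κ] (b : SymmetricSpaceBasis θ ι κ)

/-- The ideal of the free Lie algebra generated by the relators. -/
def relationIdeal : LieIdeal ℂ (Relation.Free θ ι) :=
  LieSubmodule.lieSpan ℂ (Relation.Free θ ι) (Relation.all b)

/-- The Lie algebra presented by the generators `X_α`, `B(y)` and the relations. -/
abbrev Presented : Type (max u v) := Relation.Free θ ι ⧸ relationIdeal b

/-- The generator `X_α` of the presented Lie algebra. -/
def genX (α : ι) : Presented b := LieSubmodule.Quotient.mk (Relation.X θ α)

/-- The generator `B(y)`, `y ∈ m`, of the presented Lie algebra. -/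
def genB (y : antiFixed θ) : Presented b := LieSubmodule.Quotient.mk (Relation.B ι y)

end Presented

end TwistedHalfLoop

end

/-! Write g_k for h or m according to the parity of k, and A for the presented algebra. An inverse
of the evident map to the loop algebra amounts to linear maps ψ_k : g → A with ψ_0(X_α) = X_α,
ψ_1(y) = B(y) and [ψ_i x, ψ_j y] = ψ_{i+j}[x, y] for x in g_i, y in g_j. Since h = [m, m] and m =
[m, h], such a family is forced degree by degree: ψ_{n+2} exists as soon as the map m ⊗ g_{n+1} → A,
y ⊗ z ↦ [ψ_1 y, ψ_{n+1} z], vanishes on the kernel of the bracket (`lie_extendGraded`). Relation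
(LH2) provides this for n = 0 and (LH3) for n = 1. The content of the theorem is that n ≥ 2 needs no
further relation.

For n ≥ 2 a Laplacian argument applies. Let C be the Casimir operator of h on m ⊗ g_{n+1}, formed
with the Killing form of g. A telescoping sum that uses multiplicativity only in total degree below
n + 2 shows that the image in A of ((n+2)/2 - C) w depends only on the bracket of w
(`lift_lieCross_laplacian`). If (n+2)/2 is not an eigenvalue of C, then (n+2)/2 - C is bijective on
the kernel of the bracket, which is therefore sent to zero (`lift_lieCross_eq_zero`).

The eigenvalue is excluded by its size (`eq_zero_of_tensorCasimir`). Eigenvalues of C have the form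
(Λ, Λ + 2ρ), with Λ = s + t the sum of a weight of m and a weight of g_{n+1}, and ρ taken for a
positive system in which Λ is dominant; this expression is `casimirBound`. It is at most the sum of
its values at s and t plus 2(s, t). Its value is at most 1/2 on weights of m, where the Casimir of h
is the scalar 1/2, and at most 1 on weights of h. In rank at least two every weight has (s, s) <
1/2, so 2(s, t) < 1. Hence the eigenvalues are below 2 for n even and below 5/2 for n odd, so never
(n+2)/2. Traces along weight strings and weights of maximal norm take the place of highest weight
theory.

Conversely, the relations hold in the loop algebra because the Casimir of g is the identity, its
h-part and m-part are both 1/2 on m, and its m-part has the eigenvalue c̄_(α) on X_α, which is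
nonzero (`cBar_ne_zero`). -/

open scoped TensorProduct Polynomial Matrix

noncomputable section

namespace TwistedHalfLoop

universe u v w

set_option linter.unusedSectionVars false

/-! ### The grading of g by parity. -/

section Grading

variable {g : Type u} [LieRing g] [LieAlgebra ℂ g] (θ : g →ₗ⁅ℂ⁆ g)

/-- The homogeneous components of the grading of `g` by the powers of `-1`: the fixed points of `θ`
in even degrees, and the `(-1)`-eigenspace in odd degrees. -/
def grade (k : ℕ) : Submodule ℂ g where
  carrier := {x | θ x = (-1 : ℂ) ^ k • x}
  add_mem' {x y} hx hy := by
    change θ (x + y) = _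
    rw [map_add, hx, hy, smul_add]
  zero_mem' := by simp
  smul_mem' c x hx := by
    change θ (c • x) = _
    rw [map_smul, hx, smul_comm]

variable {θ}

theorem mem_grade {k : ℕ} {x : g} : x ∈ grade θ k ↔ θ x = (-1 : ℂ) ^ k • x := Iff.rfl

theorem mem_grade_zero {x : g} : x ∈ grade θ 0 ↔ x ∈ fixedPoints θ := by
  simp [mem_grade, fixedPoints]

theorem mem_grade_one {x : g} : x ∈ grade θ 1 ↔ x ∈ antiFixed θ := by
  rw [mem_grade, pow_one, neg_one_smul]
  rfl

theorem lie_mem_grade {i j : ℕ} {x y : g} (hx : x ∈ grade θ i) (hy : y ∈ grade θ j) :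
    ⁅x, y⁆ ∈ grade θ (i + j) := by
  rw [mem_grade] at *
  rw [LieHom.map_lie, hx, hy, smul_lie, lie_smul, smul_smul, pow_add]

theorem grade_congr {i j : ℕ} (h : Even (i + j)) : grade θ i = grade θ j := by
  ext x
  have : (-1 : ℂ) ^ i = (-1) ^ j := by
    have h1 : (-1 : ℂ) ^ (i + j) = 1 := h.neg_one_pow
    have h2 : (-1 : ℂ) ^ (j + j) = 1 := (Even.add_self j).neg_one_pow
    rw [pow_add] at h1 h2
    exact mul_right_cancel₀ (pow_ne_zero j (by norm_num)) (h1.trans h2.symm)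
  rw [mem_grade, mem_grade, this]

theorem grade_add_two (k : ℕ) : grade θ (k + 2) = grade θ k :=
  grade_congr ⟨k + 1, by ring⟩

theorem eq_zero_of_mem_grade {i j : ℕ} (h : ¬ Even (i + j)) {x : g} (hi : x ∈ grade θ i)
    (hj : x ∈ grade θ j) : x = 0 := by
  rw [mem_grade] at hi hj
  have h1 : (-1 : ℂ) ^ (i + j) = -1 := (Nat.not_even_iff_odd.mp h).neg_one_pow
  have h2 : (-1 : ℂ) ^ (j + j) = 1 := (Even.add_self j).neg_one_pow
  have h3 : x = -x := by
    calc x = (-1 : ℂ) ^ (j + j) • x := by rw [h2, one_smul]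
      _ = (-1 : ℂ) ^ j • (-1 : ℂ) ^ j • x := by rw [pow_add, mul_smul]
      _ = (-1 : ℂ) ^ j • (-1 : ℂ) ^ i • x := by rw [← hj, hi]
      _ = -x := by rw [smul_smul, mul_comm, ← pow_add, h1, neg_one_smul]
  have h4 : (2 : ℂ) • x = 0 := by rw [two_smul]; nth_rewrite 1 [h3]; simp
  simpa using h4

variable (hinv : ∀ x, θ (θ x) = x)
include hinv

theorem killingForm_map (x y : g) : killingForm ℂ g (θ x) (θ y) = killingForm ℂ g x y :=
  LieAlgebra.killingForm_of_equiv_apply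
    ({ θ with invFun := θ, left_inv := hinv, right_inv := hinv } : g ≃ₗ⁅ℂ⁆ g) x y

theorem killingForm_eq_zero_of_mem_grade {i j : ℕ} (h : ¬ Even (i + j)) {x y : g}
    (hx : x ∈ grade θ i) (hy : y ∈ grade θ j) : killingForm ℂ g x y = 0 := by
  have h1 := killingForm_map hinv x y
  rw [mem_grade.mp hx, mem_grade.mp hy, map_smul, map_smul, LinearMap.smul_apply, smul_smul,
    ← pow_add, add_comm, (Nat.not_even_iff_odd.mp h).neg_one_pow, neg_one_smul] at h1
  exact self_eq_neg.mp h1.symm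

end Grading

/-! ### Dual bases and the partial Casimir operators of h and m. -/

/-- A basis of `g` that consists of eigenvectors of `θ`. -/
structure HomogeneousBasis {g : Type u} [LieRing g] [LieAlgebra ℂ g] (θ : g →ₗ⁅ℂ⁆ g)
    (I : Type v) where
  basis : Module.Basis I ℂ g
  deg : I → ℕ
  mem : ∀ i, basis i ∈ grade θ (deg i)

namespace HomogeneousBasis

variable {g : Type u} [LieRing g] [LieAlgebra ℂ g] {θ : g →ₗ⁅ℂ⁆ g} {I : Type v} [Fintype I]
  [DecidableEq I] [FiniteDimensional ℂ g] [LieAlgebra.IsKilling ℂ g] (B : HomogeneousBasis θ I)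

/-- The basis dual to a homogeneous basis for the Killing form. -/
def dual : Module.Basis I ℂ g :=
  (killingForm ℂ g).dualBasis (LieAlgebra.IsKilling.killingForm_nondegenerate ℂ g) B.basis

theorem killingForm_dual_basis (i j : I) :
    killingForm ℂ g (B.dual i) (B.basis j) = if j = i then 1 else 0 :=
  LinearMap.BilinForm.apply_dualBasis_left _ _ i j

theorem killingForm_basis_dual (i j : I) :
    killingForm ℂ g (B.basis i) (B.dual j) = if i = j then 1 else 0 := by
  rw [LieModule.traceForm_comm, killingForm_dual_basis]

theorem killingForm_dual (i : I) (z : g) : killingForm ℂ g (B.dual i) z = B.basis.repr z i := by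
  conv_lhs => rw [← B.basis.sum_repr z]
  simp only [map_sum, map_smul, killingForm_dual_basis]
  simp

theorem killingForm_basis (i : I) (z : g) : killingForm ℂ g (B.basis i) z = B.dual.repr z i := by
  conv_lhs => rw [← B.dual.sum_repr z]
  simp only [map_sum, map_smul, killingForm_basis_dual]
  simp

theorem sum_dual_smul_basis (z : g) : ∑ i, killingForm ℂ g (B.dual i) z • B.basis i = z := by
  simp_rw [killingForm_dual, B.basis.sum_repr]

theorem sum_basis_smul_dual (z : g) : ∑ i, killingForm ℂ g (B.basis i) z • B.dual i = z := by
  simp_rw [killingForm_basis, B.dual.sum_repr]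

theorem ext_dual {x y : g}
    (h : ∀ i, killingForm ℂ g (B.basis i) x = killingForm ℂ g (B.basis i) y) : x = y := by
  rw [← B.sum_basis_smul_dual x, ← B.sum_basis_smul_dual y]
  simp_rw [h]

theorem trace_eq_sum (f : g →ₗ[ℂ] g) :
    LinearMap.trace ℂ g f = ∑ i, killingForm ℂ g (B.dual i) (f (B.basis i)) := by
  rw [LinearMap.trace_eq_matrix_trace ℂ B.basis, Matrix.trace]
  refine Finset.sum_congr rfl fun i _ ↦ ?_
  rw [Matrix.diag_apply, LinearMap.toMatrix_apply, killingForm_dual]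

/-- The members of the basis in the homogeneous component of degree `k`, padded by zeros. -/
def e (k : ℕ) (i : I) : g := if Even (B.deg i + k) then B.basis i else 0

/-- The members of the dual basis in the homogeneous component of degree `k`, padded by zeros. -/
def d (k : ℕ) (i : I) : g := if Even (B.deg i + k) then B.dual i else 0

theorem e_mem (k : ℕ) (i : I) : B.e k i ∈ grade θ k := by
  unfold e
  split_ifs with h
  · exact grade_congr (θ := θ) h ▸ B.mem i
  · exact zero_mem _

theorem e_congr {k l : ℕ} (h : Even (k + l)) : B.e k = B.e l := by
  ext i
  simp only [e]
  congr 1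
  rw [eq_iff_iff]
  grind

theorem d_congr {k l : ℕ} (h : Even (k + l)) : B.d k = B.d l := by
  ext i
  simp only [d]
  congr 1
  rw [eq_iff_iff]
  grind

variable (hinv : ∀ x, θ (θ x) = x)
include hinv

theorem dual_mem (i : I) : B.dual i ∈ grade θ (B.deg i) := by
  rw [mem_grade]
  refine B.ext_dual fun j ↦ ?_
  rw [← hinv (B.basis j), killingForm_map hinv, hinv, mem_grade.mp (B.mem j), map_smul, map_smul,
    LinearMap.smul_apply, killingForm_basis_dual]
  split_ifs with h
  · rw [h]
  · simp

theorem d_mem (k : ℕ) (i : I) : B.d k i ∈ grade θ k := by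
  unfold d
  split_ifs with h
  · exact grade_congr (θ := θ) h ▸ B.dual_mem hinv i
  · exact zero_mem _

theorem sum_d_smul_e {k : ℕ} {z : g} (hz : z ∈ grade θ k) :
    ∑ i, killingForm ℂ g (B.d k i) z • B.e k i = z := by
  conv_rhs => rw [← B.sum_dual_smul_basis z]
  refine Finset.sum_congr rfl fun i _ ↦ ?_
  unfold e d
  split_ifs with h
  · rfl
  · rw [killingForm_eq_zero_of_mem_grade hinv h (B.dual_mem hinv i) hz]
    simp

theorem sum_e_smul_d {k : ℕ} {z : g} (hz : z ∈ grade θ k) :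
    ∑ i, killingForm ℂ g (B.e k i) z • B.d k i = z := by
  conv_rhs => rw [← B.sum_basis_smul_dual z]
  refine Finset.sum_congr rfl fun i _ ↦ ?_
  unfold e d
  split_ifs with h
  · rfl
  · rw [killingForm_eq_zero_of_mem_grade hinv h (B.mem i) hz]
    simp

/-- The Casimir tensor of a homogeneous component is symmetric: expanded in the e_i, both sides have
the coefficients κ(d_i, d_j). -/
theorem sum_swap {A : Type*} [AddCommGroup A] [Module ℂ A] (F : g →ₗ[ℂ] g →ₗ[ℂ] A) (k : ℕ) :
    ∑ i, F (B.d k i) (B.e k i) = ∑ i, F (B.e k i) (B.d k i) := by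
  conv_lhs => enter [2, i]; rw [← B.sum_d_smul_e hinv (B.d_mem hinv k i)]
  conv_rhs => enter [2, j]; rw [← B.sum_d_smul_e hinv (B.d_mem hinv k j)]
  simp only [map_sum, map_smul, LinearMap.sum_apply, LinearMap.smul_apply]
  rw [Finset.sum_comm]
  refine Finset.sum_congr rfl fun i _ ↦ Finset.sum_congr rfl fun j _ ↦ ?_
  rw [LieModule.traceForm_comm]

/-- Invariance of the Casimir tensor of a homogeneous component. -/
theorem sum_lie_shift {A : Type*} [AddCommGroup A] [Module ℂ A] (F : g →ₗ[ℂ] g →ₗ[ℂ] A) (k l : ℕ)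
    {y : g} (hy : y ∈ grade θ l) :
    ∑ i, F (B.e (k + l) i) ⁅B.d (k + l) i, y⁆ = ∑ i, F ⁅y, B.e k i⁆ (B.d k i) := by
  have h1 (i : I) : ⁅B.d (k + l) i, y⁆
      = ∑ j, killingForm ℂ g (B.d (k + l) i) ⁅y, B.e k j⁆ • B.d k j := by
    have h2 : ⁅B.d (k + l) i, y⁆ ∈ grade θ k := by
      have := lie_mem_grade (B.d_mem hinv (k + l) i) hy
      rwa [grade_congr (j := k) ⟨k + l, by ring⟩] at this
    conv_lhs => rw [← B.sum_e_smul_d hinv h2]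
    refine Finset.sum_congr rfl fun j _ ↦ ?_
    rw [LieModule.traceForm_comm, LieModule.traceForm_apply_lie_apply]
  have h2 (j : I) : ⁅y, B.e k j⁆
      = ∑ i, killingForm ℂ g (B.d (k + l) i) ⁅y, B.e k j⁆ • B.e (k + l) i := by
    have h2 : ⁅y, B.e k j⁆ ∈ grade θ (k + l) := by
      rw [add_comm]
      exact lie_mem_grade hy (B.e_mem k j)
    exact (B.sum_d_smul_e hinv h2).symm
  conv_lhs => enter [2, i]; rw [h1]
  conv_rhs => enter [2, j]; rw [h2]
  simp only [map_sum, map_smul, LinearMap.sum_apply, LinearMap.smul_apply]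
  exact Finset.sum_comm

omit hinv in
/-- The part of the Casimir operator that comes from the homogeneous component of degree `k`. -/
def partialCasimir (k : ℕ) : g →ₗ[ℂ] g :=
  ∑ i, LieAlgebra.ad ℂ g (B.e k i) ∘ₗ LieAlgebra.ad ℂ g (B.d k i)

omit hinv in
theorem partialCasimir_apply (k : ℕ) (z : g) :
    B.partialCasimir k z = ∑ i, ⁅B.e k i, ⁅B.d k i, z⁆⁆ := by
  simp [partialCasimir]

omit hinv in
theorem partialCasimir_congr {k l : ℕ} (h : Even (k + l)) :
    B.partialCasimir k = B.partialCasimir l := by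
  unfold partialCasimir
  rw [B.e_congr h, B.d_congr h]

theorem partialCasimir_mem {k l : ℕ} {z : g} (hz : z ∈ grade θ l) :
    B.partialCasimir k z ∈ grade θ l := by
  rw [partialCasimir_apply]
  refine Submodule.sum_mem _ fun i _ ↦ ?_
  have := lie_mem_grade (B.e_mem k i) (lie_mem_grade (B.d_mem hinv k i) hz)
  rwa [grade_congr (j := l) ⟨k + l, by ring⟩] at this

-- The right side is the trace of ad x ad y over one homogeneous component, so the partial Casimir
-- operators split the Killing form into its contributions from h and m.
omit hinv in
theorem killingForm_partialCasimir (k : ℕ) (x y : g) :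
    killingForm ℂ g (B.partialCasimir k x) y
      = ∑ i, killingForm ℂ g (B.d k i) ⁅x, ⁅y, B.e k i⁆⁆ := by
  rw [partialCasimir_apply, map_sum, LinearMap.sum_apply]
  refine Finset.sum_congr rfl fun i _ ↦ ?_
  rw [← lie_skew, map_neg, LinearMap.neg_apply, LieModule.traceForm_apply_lie_apply,
    LieModule.traceForm_apply_lie_apply, ← lie_skew y, lie_neg, map_neg]

-- The traces over h and m add up to the trace over g, which is the Killing form itself;
-- nondegeneracy does the rest.
omit hinv in
theorem partialCasimir_zero_add_one (z : g) :
    B.partialCasimir 0 z + B.partialCasimir 1 z = z := by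
  refine B.ext_dual fun j ↦ ?_
  rw [LieModule.traceForm_comm, map_add, LinearMap.add_apply, killingForm_partialCasimir,
    killingForm_partialCasimir, LieModule.traceForm_comm ℂ g g _ z, killingForm_apply_apply,
    B.trace_eq_sum, ← Finset.sum_add_distrib]
  refine Finset.sum_congr rfl fun i _ ↦ ?_
  unfold e d
  by_cases h : Even (B.deg i)
  · have h1 : ¬ Even (B.deg i + 1) := by grind
    simp [h, h1]
  · have h1 : Even (B.deg i + 1) := by grind
    simp [h, h1]

/-- Each partial Casimir operator is half the identity in odd degree. -/
theorem partialCasimir_of_mem_one (k : ℕ) {y : g} (hy : y ∈ grade θ 1) :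
    B.partialCasimir k y = (1 / 2 : ℂ) • y := by
  -- For x and y in m, ad x and ad y exchange h and m. So the trace of ad y ad x over m equals that
  -- of ad x ad y over h, which gives κ(C_1 y, x) = κ(C_0 x, y), and C_0 is self-adjoint for the
  -- Killing form.
  have key : B.partialCasimir 0 y = B.partialCasimir 1 y := by
    refine B.ext_dual fun j ↦ ?_
    rw [LieModule.traceForm_comm, LieModule.traceForm_comm ℂ g g (B.basis j)]
    by_cases hj : Even (B.deg j + 1)
    · have hx : B.basis j ∈ grade θ 1 := grade_congr (θ := θ) hj ▸ B.mem j
      set x := B.basis j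
      have h1 := B.sum_lie_shift hinv
        (LinearMap.mk₂ ℂ (fun a b ↦ killingForm ℂ g b ⁅x, a⁆) (by simp) (by simp) (by simp)
          (by simp)) 0 1 hy
      have h2 := B.sum_swap hinv
        (LinearMap.mk₂ ℂ (fun a b ↦ killingForm ℂ g x ⁅a, ⁅b, y⁆⁆) (by simp) (by simp) (by simp)
          (by simp)) 0
      simp only [LinearMap.mk₂_apply] at h1 h2
      have h3 : killingForm ℂ g (B.partialCasimir 1 y) x
          = killingForm ℂ g (B.partialCasimir 0 x) y := by
        rw [killingForm_partialCasimir, killingForm_partialCasimir, ← h1]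
        refine Finset.sum_congr rfl fun i _ ↦ ?_
        rw [LieModule.traceForm_apply_lie_apply]
      rw [h3, LieModule.traceForm_comm, partialCasimir_apply, partialCasimir_apply, map_sum,
        map_sum, LinearMap.sum_apply, ← h2]
      refine Finset.sum_congr rfl fun i _ ↦ ?_
      rw [← lie_skew (B.e 0 i) ⁅_, x⁆, map_neg, LinearMap.neg_apply,
        LieModule.traceForm_apply_lie_apply,
        ← lie_skew (B.d 0 i) x, map_neg, LinearMap.neg_apply, LieModule.traceForm_apply_lie_apply,
        neg_neg]
    · rw [killingForm_eq_zero_of_mem_grade hinv (by rwa [add_comm] at hj)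
          (B.partialCasimir_mem hinv hy) (B.mem j),
        killingForm_eq_zero_of_mem_grade hinv (by rwa [add_comm] at hj)
          (B.partialCasimir_mem hinv hy) (B.mem j)]
  have h2 : B.partialCasimir 0 y = (1 / 2 : ℂ) • y := by
    have := B.partialCasimir_zero_add_one y
    rw [← key, ← two_smul ℂ] at this
    conv_rhs => rw [← this]
    simp
  obtain hk | hk := Nat.even_or_odd k
  · rw [B.partialCasimir_congr (l := 0) (by simpa using hk), h2]
  · rw [B.partialCasimir_congr (l := 1) (by grind), ← key, h2]

end HomogeneousBasis

/-! ### Bilinear maps on homogeneous components. -/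

section Tensor

variable {g : Type u} [LieRing g] [LieAlgebra ℂ g] {θ : g →ₗ⁅ℂ⁆ g}
  {A : Type w} [LieRing A] [LieAlgebra ℂ A]

/-- The bilinear map `(a, b) ↦ [ψ_i a, ψ_j b]`. -/
def lieCross (φ χ : g →ₗ[ℂ] A) : g →ₗ[ℂ] g →ₗ[ℂ] A :=
  ((LieModule.toEnd ℂ A A : A →ₗ[ℂ] A →ₗ[ℂ] A)).compl₁₂ φ χ

@[simp]
theorem lieCross_apply (φ χ : g →ₗ[ℂ] A) (a b : g) :
    lieCross φ χ a b = ⁅φ a, χ b⁆ := rfl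

/-- The bracket, as a linear map on the tensor square. -/
abbrev bracket (g : Type u) [LieRing g] [LieAlgebra ℂ g] :
    g ⊗[ℂ] g →ₗ[ℂ] g :=
  (LieModule.toModuleHom ℂ g g : g ⊗[ℂ] g →ₗ[ℂ] g)

theorem bracket_tmul (y z : g) : bracket g (y ⊗ₜ z) = ⁅y, z⁆ :=
  LieModule.toModuleHom_apply ..

/-- The tensor product of two homogeneous components. -/
def gradeTensor (θ : g →ₗ⁅ℂ⁆ g) (i j : ℕ) : Submodule ℂ (g ⊗[ℂ] g) :=
  Submodule.map₂ (TensorProduct.mk ℂ g g) (grade θ i) (grade θ j)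

theorem tmul_mem_gradeTensor {i j : ℕ} {y z : g} (hy : y ∈ grade θ i)
    (hz : z ∈ grade θ j) : y ⊗ₜ[ℂ] z ∈ gradeTensor θ i j :=
  Submodule.apply_mem_map₂ _ hy hz

theorem gradeTensor_le {i j : ℕ} {S : Submodule ℂ (g ⊗[ℂ] g)}
    (h : ∀ y ∈ grade θ i, ∀ z ∈ grade θ j, y ⊗ₜ[ℂ] z ∈ S) : gradeTensor θ i j ≤ S :=
  Submodule.map₂_le.mpr h

end Tensor

/-! ### The Laplacian identity in degree n + 2. -/

namespace HomogeneousBasis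

variable {g : Type u} [LieRing g] [LieAlgebra ℂ g] {θ : g →ₗ⁅ℂ⁆ g} {I : Type v} [Fintype I]
  [DecidableEq I] [FiniteDimensional ℂ g] [LieAlgebra.IsKilling ℂ g] (B : HomogeneousBasis θ I)
  (hinv : ∀ x, θ (θ x) = x)
include hinv

/-- Consecutive operators add up to the identity. For odd n one is left over, and it acts on m by
1/2. -/
theorem sum_partialCasimir (n : ℕ) {z : g} (hz : z ∈ grade θ n) :
    ∑ k ∈ Finset.range n, B.partialCasimir k z = (n / 2 : ℂ) • z := by
  induction n using Nat.twoStepInduction with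
  | zero => simp
  | one =>
    rw [Finset.sum_range_one, B.partialCasimir_of_mem_one hinv 0 hz, Nat.cast_one]
  | more n ih _ =>
    rw [Finset.sum_range_succ, Finset.sum_range_succ, ih (grade_add_two (θ := θ) n ▸ hz), add_assoc]
    have h : B.partialCasimir n z + B.partialCasimir (n + 1) z = z := by
      obtain h | h := Nat.even_or_odd n
      · rw [B.partialCasimir_congr (k := n) (l := 0) (by simpa using h),
          B.partialCasimir_congr (k := n + 1) (l := 1) (by grind), B.partialCasimir_zero_add_one]
      · rw [B.partialCasimir_congr (k := n) (l := 1) (by grind),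
          B.partialCasimir_congr (k := n + 1) (l := 0) (by grind), add_comm,
          B.partialCasimir_zero_add_one]
    rw [h]
    push_cast
    module

section Laplacian

variable {A : Type w} [LieRing A] [LieAlgebra ℂ A] (ψ : ℕ → g →ₗ[ℂ] A)

/-- The map `w ↦ ∑_k ∑_i [e_{k,i}, [d_{k,i}, w]]` of total degree `n`. -/
def divergence (n : ℕ) : g →ₗ[ℂ] A :=
  ∑ j ∈ Finset.range (n + 1), ∑ i,
    (lieCross (ψ (j + 1)) (ψ (n + 1 - j)) (B.e (j + 1) i)) ∘ₗ LieAlgebra.ad ℂ g (B.d (j + 1) i)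

/-- Apply Leibniz to [d, [y, z]]. With D_j the sum of [ψ_{j+1}[e_{j,i}, y], ψ_{n+1-j}[d_{j,i}, z]],
the summand of index j < n contributes D_{j+1} - D_j and a Casimir term, and the summand n
contributes -D_n - D_0. The telescope leaves -2 D_0. -/
theorem divergence_lie (n : ℕ) (hψ : ∀ i j, i + j < n + 2 → ∀ a ∈ grade θ i, ∀ b ∈ grade θ j,
      ⁅ψ i a, ψ j b⁆ = ψ (i + j) ⁅a, b⁆) {y z : g} (hy : y ∈ grade θ 1) (hz : z ∈ grade θ (n + 1)) :
    B.divergence ψ n ⁅y, z⁆ = (-2 : ℂ) • ∑ i, ⁅ψ 1 ⁅B.e 0 i, y⁆, ψ (n + 1) ⁅B.d 0 i, z⁆⁆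
      + ⁅ψ 1 y, ψ (n + 1) (∑ j ∈ Finset.range n, B.partialCasimir (j + 1) z)⁆ := by
  set D : ℕ → A := fun j ↦ ∑ i, ⁅ψ (j + 1) ⁅B.e j i, y⁆, ψ (n + 1 - j) ⁅B.d j i, z⁆⁆ with hD
  -- Invariance of the Casimir tensor moves y from d to e and lowers the degree of the tensor by
  -- one.
  have first (j : ℕ) (hj : j ≤ n) :
      ∑ i, ⁅ψ (j + 1) (B.e (j + 1) i), ψ (n + 1 - j) ⁅⁅B.d (j + 1) i, y⁆, z⁆⁆ = - D j := by
    have h := B.sum_lie_shift hinv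
      ((lieCross (ψ (j + 1)) (ψ (n + 1 - j))).compl₂ (LieAlgebra.ad ℂ g z)) j 1 hy
    simp only [LinearMap.compl₂_apply, lieCross_apply, LieAlgebra.ad_apply] at h
    rw [hD, ← neg_inj, neg_neg, ← Finset.sum_neg_distrib]
    convert h using 2 with i _ i _
    · rw [← lie_skew z, map_neg, lie_neg]
    · rw [← lie_skew z, ← lie_skew y, map_neg, map_neg, lie_neg, neg_lie, neg_neg]
  -- Multiplicativity pulls ψ_1 y out of the inner argument, and Leibniz in A then distributes it.
  -- All total degrees that occur are below n + 2.
  have second (j : ℕ) (hj : j < n) :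
      ∑ i, ⁅ψ (j + 1) (B.e (j + 1) i), ψ (n + 1 - j) ⁅y, ⁅B.d (j + 1) i, z⁆⁆⁆
        = D (j + 1) + ⁅ψ 1 y, ψ (n + 1) (B.partialCasimir (j + 1) z)⁆ := by
    rw [partialCasimir_apply, map_sum, lie_sum, hD, ← Finset.sum_add_distrib]
    refine Finset.sum_congr rfl fun i _ ↦ ?_
    have hd : ⁅B.d (j + 1) i, z⁆ ∈ grade θ (n - j) := by
      rw [grade_congr (j := j + 1 + (n + 1)) (by grind)]
      exact lie_mem_grade (B.d_mem hinv _ _) hz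
    have he := B.e_mem (j + 1) i
    have h1 : n + 1 - j = 1 + (n - j) := by lia
    have h2 : j + 1 + (n - j) = n + 1 := by lia
    have h3 : n + 1 - (j + 1) = n - j := by lia
    rw [h1, ← hψ _ _ (by lia) _ hy _ hd, leibniz_lie, hψ _ _ (by lia) _ he _ hy,
      hψ _ _ (by lia) _ he _ hd, h2, h3]
  -- The argument of `second` would need [ψ_{n+1} e, ψ_1 y], of the unknown total degree n + 2. Here
  -- invariance is applied to z instead of y, followed by the symmetry of the tensor.
  have last : ∑ i, ⁅ψ (n + 1) (B.e (n + 1) i), ψ 1 ⁅y, ⁅B.d (n + 1) i, z⁆⁆⁆ = - D 0 := by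
    have h := B.sum_lie_shift hinv
      ((lieCross (ψ (n + 1)) (ψ 1)).compl₂ (LieAlgebra.ad ℂ g y)) 0 (n + 1) hz
    have h' := B.sum_swap hinv
      ((lieCross (ψ 1) (ψ (n + 1))).compl₁₂ (LieAlgebra.ad ℂ g y) (LieAlgebra.ad ℂ g z)) 0
    simp only [LinearMap.compl₂_apply, lieCross_apply, LieAlgebra.ad_apply,
      LinearMap.compl₁₂_apply, zero_add] at h h'
    rw [h, hD, ← neg_inj, neg_neg, ← Finset.sum_neg_distrib]
    simp only [lie_skew]
    rw [h']
    refine Finset.sum_congr rfl fun i _ ↦ ?_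
    rw [← lie_skew y, ← lie_skew z, map_neg, map_neg, lie_neg, neg_lie, neg_neg]
    rfl
  have main (j : ℕ) (hj : j < n) :
      ∑ i, ⁅ψ (j + 1) (B.e (j + 1) i), ψ (n + 1 - j) ⁅B.d (j + 1) i, ⁅y, z⁆⁆⁆
        = D (j + 1) - D j + ⁅ψ 1 y, ψ (n + 1) (B.partialCasimir (j + 1) z)⁆ := by
    have h1 := first j hj.le
    have h2 := second j hj
    simp only [leibniz_lie (B.d _ _), map_add, lie_add, Finset.sum_add_distrib]
    rw [h1, h2]
    abel
  have main' : ∑ i, ⁅ψ (n + 1) (B.e (n + 1) i), ψ (n + 1 - n) ⁅B.d (n + 1) i, ⁅y, z⁆⁆⁆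
        = - D n - D 0 := by
    have h1 := first n le_rfl
    have hn : n + 1 - n = 1 := by lia
    rw [hn] at h1 ⊢
    simp only [leibniz_lie (B.d _ _), map_add, lie_add, Finset.sum_add_distrib]
    rw [h1, last]
    abel
  have expand : B.divergence ψ n ⁅y, z⁆ = ∑ j ∈ Finset.range (n + 1),
      ∑ i, ⁅ψ (j + 1) (B.e (j + 1) i), ψ (n + 1 - j) ⁅B.d (j + 1) i, ⁅y, z⁆⁆⁆ := by
    simp [divergence]
  rw [expand, Finset.sum_range_succ, main',
    Finset.sum_congr rfl fun j hj ↦ main j (Finset.mem_range.mp hj), Finset.sum_add_distrib,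
    Finset.sum_range_sub, map_sum, lie_sum]
  have : D 0 = ∑ i, ⁅ψ 1 ⁅B.e 0 i, y⁆, ψ (n + 1) ⁅B.d 0 i, z⁆⁆ := by simp [hD]
  rw [← this]
  module

end Laplacian

/-- The Casimir operator of the fixed point subalgebra on `g ⊗ g`. -/
def tensorCasimir : g ⊗[ℂ] g →ₗ[ℂ] g ⊗[ℂ] g :=
  ∑ i, LieModule.toEnd ℂ g (g ⊗[ℂ] g) (B.e 0 i) ∘ₗ LieModule.toEnd ℂ g (g ⊗[ℂ] g) (B.d 0 i)

omit hinv in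
theorem tensorCasimir_apply (w : g ⊗[ℂ] g) :
    B.tensorCasimir w = ∑ i, ⁅B.e 0 i, ⁅B.d 0 i, w⁆⁆ := by
  simp [tensorCasimir]

theorem tensorCasimir_tmul (y z : g) :
    B.tensorCasimir (y ⊗ₜ z) = B.partialCasimir 0 y ⊗ₜ z + y ⊗ₜ B.partialCasimir 0 z
      + (2 : ℂ) • ∑ i, ⁅B.e 0 i, y⁆ ⊗ₜ[ℂ] ⁅B.d 0 i, z⁆ := by
  have h := B.sum_swap hinv ((TensorProduct.mk ℂ g g).compl₁₂
    ((LieModule.toEnd ℂ g g : g →ₗ[ℂ] g →ₗ[ℂ] g).flip y)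
    ((LieModule.toEnd ℂ g g : g →ₗ[ℂ] g →ₗ[ℂ] g).flip z)) 0
  simp only [LinearMap.compl₁₂_apply, LinearMap.flip_apply, TensorProduct.mk_apply,
    LieHom.coe_toLinearMap, LieModule.toEnd_apply_apply] at h
  simp only [tensorCasimir_apply, TensorProduct.LieModule.lie_tmul_right, lie_add,
    Finset.sum_add_distrib, h, partialCasimir_apply, TensorProduct.sum_tmul,
    TensorProduct.tmul_sum, two_smul]
  abel

omit hinv in
theorem bracket_tensorCasimir (w : g ⊗[ℂ] g) :
    bracket g (B.tensorCasimir w) = B.partialCasimir 0 (bracket g w) := by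
  rw [tensorCasimir_apply, partialCasimir_apply, map_sum]
  refine Finset.sum_congr rfl fun i _ ↦ ?_
  simp only [bracket, LieModuleHom.coe_toLinearMap, LieModuleHom.map_lie]

theorem tensorCasimir_mem {i j : ℕ} {w : g ⊗[ℂ] g} (hw : w ∈ gradeTensor θ i j) :
    B.tensorCasimir w ∈ gradeTensor θ i j := by
  suffices gradeTensor θ i j ≤ (gradeTensor θ i j).comap B.tensorCasimir from this hw
  refine gradeTensor_le fun y hy z hz ↦ ?_
  rw [Submodule.mem_comap, tensorCasimir_tmul _ hinv]
  refine add_mem (add_mem (tmul_mem_gradeTensor (B.partialCasimir_mem hinv hy) hz)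
    (tmul_mem_gradeTensor hy (B.partialCasimir_mem hinv hz)))
    (Submodule.smul_mem _ _ (Submodule.sum_mem _ fun k _ ↦ tmul_mem_gradeTensor ?_ ?_))
  · simpa using lie_mem_grade (B.e_mem 0 k) hy
  · simpa using lie_mem_grade (B.d_mem hinv 0 k) hz

section Vanishing

variable {A : Type w} [LieRing A] [LieAlgebra ℂ A] (ψ : ℕ → g →ₗ[ℂ] A)

/-- On y ⊗ z, the Casimir is C_0 y ⊗ z + y ⊗ C_0 z plus twice the mixed term. With C_0 y = y/2 and
C_1 z + ... + C_n z = (n+1)/2 z - C_0 z, the left side becomes the formula of `divergence_lie`. -/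
theorem lift_lieCross_laplacian (n : ℕ)
    (hψ : ∀ i j, i + j < n + 2 → ∀ a ∈ grade θ i, ∀ b ∈ grade θ j,
      ⁅ψ i a, ψ j b⁆ = ψ (i + j) ⁅a, b⁆) {w : g ⊗[ℂ] g} (hw : w ∈ gradeTensor θ 1 (n + 1)) :
    TensorProduct.lift (lieCross (ψ 1) (ψ (n + 1)))
      (((n + 2 : ℕ) / 2 : ℂ) • w - B.tensorCasimir w) = B.divergence ψ n (bracket g w) := by
  suffices gradeTensor θ 1 (n + 1) ≤ LinearMap.eqLocus
      (TensorProduct.lift (lieCross (ψ 1) (ψ (n + 1))) ∘ₗ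
        (((n + 2 : ℕ) / 2 : ℂ) • LinearMap.id - B.tensorCasimir))
      (B.divergence ψ n ∘ₗ bracket g) from this hw
  refine gradeTensor_le fun y hy z hz ↦ ?_
  rw [LinearMap.mem_eqLocus]
  have h1 := B.sum_partialCasimir hinv (n + 1) hz
  rw [Finset.sum_range_succ'] at h1
  rw [LinearMap.comp_apply, LinearMap.comp_apply, bracket_tmul, B.divergence_lie hinv ψ n hψ hy hz,
    eq_sub_of_add_eq h1, LinearMap.sub_apply, LinearMap.smul_apply, LinearMap.id_apply,
    B.tensorCasimir_tmul hinv, B.partialCasimir_of_mem_one hinv 0 hy,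
    ← TensorProduct.smul_tmul']
  simp only [map_sub, map_add, map_smul, map_sum, TensorProduct.lift.tmul, lieCross_apply,
    lie_sub, lie_smul]
  push_cast
  module

/-- If the Casimir operator of the fixed point subalgebra does not have the eigenvalue
`(n + 2) / 2` in `g_1 ⊗ g_{n+1}`, the product of `ψ_1` and `ψ_{n+1}` factors through the bracket. -/
theorem lift_lieCross_eq_zero (n : ℕ)
    (hψ : ∀ i j, i + j < n + 2 → ∀ a ∈ grade θ i, ∀ b ∈ grade θ j,
      ⁅ψ i a, ψ j b⁆ = ψ (i + j) ⁅a, b⁆)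
    (heig : ∀ w ∈ gradeTensor θ 1 (n + 1), B.tensorCasimir w = ((n + 2 : ℕ) / 2 : ℂ) • w → w = 0)
    {w : g ⊗[ℂ] g} (hw : w ∈ gradeTensor θ 1 (n + 1)) (hbr : bracket g w = 0) :
    TensorProduct.lift (lieCross (ψ 1) (ψ (n + 1))) w = 0 := by
  set S : Submodule ℂ (g ⊗[ℂ] g) := gradeTensor θ 1 (n + 1) ⊓ LinearMap.ker (bracket g)
  set f : g ⊗[ℂ] g →ₗ[ℂ] g ⊗[ℂ] g := ((n + 2 : ℕ) / 2 : ℂ) • LinearMap.id - B.tensorCasimir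
    with hf
  have hfS : ∀ x ∈ S, f x ∈ S := by
    rintro x ⟨h1, h2⟩
    refine ⟨sub_mem (Submodule.smul_mem _ _ h1) (B.tensorCasimir_mem hinv h1), ?_⟩
    replace h2 : bracket g x = 0 := h2
    change bracket g (f x) = 0
    rw [hf, LinearMap.sub_apply, map_sub, bracket_tensorCasimir, LinearMap.smul_apply, map_smul,
      LinearMap.id_apply, h2]
    simp
  have hinj : Function.Injective (f.restrict hfS) := by
    rw [← LinearMap.ker_eq_bot, LinearMap.ker_eq_bot']
    rintro ⟨x, hx⟩ h
    have h' : f x = 0 := congrArg Subtype.val h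
    rw [hf, LinearMap.sub_apply, sub_eq_zero] at h'
    exact Subtype.ext (heig x hx.1 h'.symm)
  -- In finite dimension injectivity on the kernel of the bracket gives surjectivity, so w is the
  -- Laplacian of some x with zero bracket.
  obtain ⟨⟨x, hx⟩, hxw⟩ := LinearMap.surjective_of_injective hinj ⟨w, hw, hbr⟩
  have hxw' : f x = w := congrArg Subtype.val hxw
  rw [← hxw', hf]
  have := B.lift_lieCross_laplacian hinv ψ n hψ hx.1
  rw [show bracket g x = 0 from hx.2, map_zero] at this
  exact this

end Vanishing

end HomogeneousBasis

/-! ### Generation in degree one: h = [m, m] and m = [m, h]. -/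

section Generation

variable {g : Type u} [LieRing g] [LieAlgebra ℂ g] {θ : g →ₗ⁅ℂ⁆ g}

theorem exists_grade_decomposition (hinv : ∀ x, θ (θ x) = x) (x : g) :
    ∃ a ∈ grade θ 0, ∃ b ∈ grade θ 1, x = a + b := by
  refine ⟨(1 / 2 : ℂ) • (x + θ x), ?_, (1 / 2 : ℂ) • (x - θ x), ?_, ?_⟩
  · rw [mem_grade, map_smul, map_add, hinv]
    module
  · rw [mem_grade, map_smul, map_sub, hinv]
    module
  · module

variable (θ) in
/-- The span of the brackets of elements of degree one with elements of degree `n`. -/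
def bracketSpan (n : ℕ) : Submodule ℂ g :=
  Submodule.map₂ (LieModule.toEnd ℂ g g : g →ₗ[ℂ] g →ₗ[ℂ] g) (grade θ 1) (grade θ n)

theorem lie_mem_bracketSpan {n : ℕ} {y z : g} (hy : y ∈ grade θ 1) (hz : z ∈ grade θ n) :
    ⁅y, z⁆ ∈ bracketSpan θ n :=
  Submodule.apply_mem_map₂ (LieModule.toEnd ℂ g g : g →ₗ[ℂ] g →ₗ[ℂ] g) hy hz

theorem bracketSpan_le {n : ℕ} {S : Submodule ℂ g}
    (h : ∀ y ∈ grade θ 1, ∀ z ∈ grade θ n, ⁅y, z⁆ ∈ S) : bracketSpan θ n ≤ S :=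
  Submodule.map₂_le.mpr h

theorem bracketSpan_congr {m n : ℕ} (h : Even (m + n)) : bracketSpan θ m = bracketSpan θ n := by
  rw [bracketSpan, grade_congr (θ := θ) h, bracketSpan]

/-- The sum m + [m, m] is an ideal, nonzero because θ is not the identity, hence all of g by
simplicity. Its part in h is [m, m]. -/
theorem grade_zero_le_bracketSpan [LieAlgebra.IsSimple ℂ g] (hinv : ∀ x, θ (θ x) = x)
    (hid : ∃ x, θ x ≠ x) : grade θ 0 ≤ bracketSpan θ 1 := by
  have hle : bracketSpan θ 1 ≤ grade θ 0 := bracketSpan_le fun y hy z hz ↦ by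
    rw [← grade_add_two 0]
    change ⁅y, z⁆ ∈ grade θ (1 + 1)
    exact lie_mem_grade hy hz
  have h0 : ∀ a ∈ grade θ 0, bracketSpan θ 1 ≤ (bracketSpan θ 1).comap (LieAlgebra.ad ℂ g a) := by
    intro a ha
    refine bracketSpan_le fun y hy z hz ↦ ?_
    rw [Submodule.mem_comap, LieAlgebra.ad_apply, leibniz_lie]
    exact add_mem (lie_mem_bracketSpan (by simpa using lie_mem_grade ha hy) hz)
      (lie_mem_bracketSpan hy (by simpa using lie_mem_grade ha hz))
  let S : LieIdeal ℂ g :=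
    { (grade θ 1 ⊔ bracketSpan θ 1 : Submodule ℂ g) with
      lie_mem := by
        intro x s hs
        obtain ⟨a, ha, b, hb, rfl⟩ := exists_grade_decomposition hinv x
        obtain ⟨p, hp, q, hq, rfl⟩ := Submodule.mem_sup.mp hs
        change _ ∈ (grade θ 1 ⊔ bracketSpan θ 1 : Submodule ℂ g)
        rw [add_lie, lie_add, lie_add]
        refine add_mem (add_mem ?_ ?_) (add_mem ?_ ?_)
        · exact Submodule.mem_sup_left (by simpa using lie_mem_grade ha hp)
        · exact Submodule.mem_sup_right (h0 a ha hq)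
        · exact Submodule.mem_sup_right (lie_mem_bracketSpan hb hp)
        · exact Submodule.mem_sup_left (lie_mem_grade hb (hle hq)) }
  have hS : S = ⊤ := by
    refine (LieAlgebra.IsSimple.eq_bot_or_eq_top S).resolve_left fun hbot ↦ ?_
    obtain ⟨x, hx⟩ := hid
    obtain ⟨a, ha, b, hb, rfl⟩ := exists_grade_decomposition hinv x
    have hbS : b ∈ S := Submodule.mem_sup_left hb
    rw [hbot, LieSubmodule.mem_bot] at hbS
    apply hx
    rw [hbS, add_zero, mem_grade.mp ha]
    simp
  intro x hx
  have hxS : x ∈ S := hS ▸ LieSubmodule.mem_top x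
  obtain ⟨p, hp, q, hq, hpq⟩ := Submodule.mem_sup.mp hxS
  have hp0 : p = 0 := by
    refine eq_zero_of_mem_grade (i := 0) (j := 1) (by simp) ?_ hp
    rw [← eq_sub_iff_add_eq] at hpq
    exact hpq ▸ sub_mem hx (hle hq)
  rw [hp0, zero_add] at hpq
  exact hpq ▸ hq

/-- On m one has y = 2 C_0 y, a sum of brackets of h with m. -/
theorem HomogeneousBasis.grade_one_le_bracketSpan {I : Type v} [Fintype I]
    [DecidableEq I] [FiniteDimensional ℂ g] [LieAlgebra.IsKilling ℂ g] (B : HomogeneousBasis θ I)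
    (hinv : ∀ x, θ (θ x) = x) : grade θ 1 ≤ bracketSpan θ 0 := by
  intro y hy
  have h : y = (2 : ℂ) • B.partialCasimir 0 y := by
    rw [B.partialCasimir_of_mem_one hinv 0 hy, smul_smul]
    norm_num
  rw [h, B.partialCasimir_apply]
  refine Submodule.smul_mem _ _ (Submodule.sum_mem _ fun i _ ↦ ?_)
  rw [← lie_skew]
  refine neg_mem (lie_mem_bracketSpan ?_ (B.e_mem 0 i))
  simpa using lie_mem_grade (B.d_mem hinv 0 i) hy

theorem HomogeneousBasis.grade_succ_le_bracketSpan {I : Type v} [Fintype I]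
    [DecidableEq I] [FiniteDimensional ℂ g] [LieAlgebra.IsKilling ℂ g] [LieAlgebra.IsSimple ℂ g]
    (B : HomogeneousBasis θ I) (hinv : ∀ x, θ (θ x) = x) (hid : ∃ x, θ x ≠ x) (n : ℕ) :
    grade θ (n + 1) ≤ bracketSpan θ n := by
  obtain h | h := Nat.even_or_odd n
  · rw [grade_congr (θ := θ) (i := n + 1) (j := 1) (by grind),
      bracketSpan_congr (θ := θ) (m := n) (n := 0) (by grind)]
    exact B.grade_one_le_bracketSpan hinv
  · rw [grade_congr (θ := θ) (i := n + 1) (j := 0) (by grind),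
      bracketSpan_congr (θ := θ) (m := n) (n := 1) (by grind)]
    exact grade_zero_le_bracketSpan hinv hid

/-- A linear choice of preimages under the bracket; it makes the recursive definition of ψ_{n+2}
possible. -/
theorem exists_bracket_section (n : ℕ) (h : grade θ (n + 1) ≤ bracketSpan θ n) :
    ∃ σ : g →ₗ[ℂ] g ⊗[ℂ] g,
      ∀ z ∈ grade θ (n + 1), σ z ∈ gradeTensor θ 1 n ∧ bracket g (σ z) = z := by
  have hmap : bracketSpan θ n ≤ (gradeTensor θ 1 n).map (bracket g) :=
    bracketSpan_le fun y hy z hz ↦ ⟨y ⊗ₜ z, tmul_mem_gradeTensor hy hz, bracket_tmul y z⟩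
  let f : gradeTensor θ 1 n →ₗ[ℂ] (gradeTensor θ 1 n).map (bracket g) :=
    (bracket g).submoduleMap _
  obtain ⟨s, hs⟩ := f.exists_rightInverse_of_surjective
    (LinearMap.range_eq_top.mpr (LinearMap.submoduleMap_surjective _ _))
  obtain ⟨σ, hσ⟩ := LinearMap.exists_extend (Submodule.subtype _ ∘ₗ s)
  refine ⟨σ, fun z hz ↦ ?_⟩
  have h1 : σ z = s ⟨z, hmap (h hz)⟩ := LinearMap.congr_fun hσ ⟨z, hmap (h hz)⟩
  rw [h1]
  refine ⟨(s _).2, ?_⟩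
  exact congrArg Subtype.val (LinearMap.congr_fun hs ⟨z, hmap (h hz)⟩)

end Generation

/-! ### Recursive construction of a graded family of maps. -/

section Extension

variable {g : Type u} [LieRing g] [LieAlgebra ℂ g] {θ : g →ₗ⁅ℂ⁆ g}
  {A : Type w} [LieRing A] [LieAlgebra ℂ A]

/-- If a graded family of maps is multiplicative in total degree less than `n`, and its products
with elements of degree one are multiplicative in total degree `n`, then it is multiplicative in
total degree `n`. -/
theorem lie_eq_of_lie_one (ψ : ℕ → g →ₗ[ℂ] A) (n : ℕ)
    (hgen : ∀ n, grade θ (n + 1) ≤ bracketSpan θ n)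
    (hψ : ∀ i j, i + j < n + 2 → ∀ a ∈ grade θ i, ∀ b ∈ grade θ j,
      ⁅ψ i a, ψ j b⁆ = ψ (i + j) ⁅a, b⁆)
    (hone : ∀ y ∈ grade θ 1, ∀ z ∈ grade θ (n + 1), ⁅ψ 1 y, ψ (n + 1) z⁆ = ψ (n + 2) ⁅y, z⁆)
    (i j : ℕ) (hij : i + j = n + 2) {a b : g} (ha : a ∈ grade θ i) (hb : b ∈ grade θ j) :
    ⁅ψ i a, ψ j b⁆ = ψ (i + j) ⁅a, b⁆ := by
  have hone' : ∀ k ≤ n + 1, ∀ y ∈ grade θ 1, ∀ z ∈ grade θ k, ⁅ψ 1 y, ψ k z⁆ = ψ (k + 1) ⁅y, z⁆ :=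
      by
    intro k hk y hy z hz
    obtain rfl | hk := hk.eq_or_lt
    · exact hone y hy z hz
    · rw [hψ _ _ (by lia) _ hy _ hz, add_comm]
  induction i generalizing j a b with
  | zero =>
    obtain rfl : j = n + 2 := by lia
    rw [zero_add]
    suffices bracketSpan θ (n + 1) ≤ LinearMap.eqLocus
        ((LieAlgebra.ad ℂ A (ψ 0 a) : A →ₗ[ℂ] A) ∘ₗ ψ (n + 2))
        (ψ (n + 2) ∘ₗ (LieAlgebra.ad ℂ g a : g →ₗ[ℂ] g)) from this (hgen _ hb)
    refine bracketSpan_le fun y hy z hz ↦ ?_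
    have hay : ⁅a, y⁆ ∈ grade θ 1 := by simpa using lie_mem_grade ha hy
    have haz : ⁅a, z⁆ ∈ grade θ (n + 1) := by simpa using lie_mem_grade ha hz
    rw [LinearMap.mem_eqLocus, LinearMap.comp_apply, LinearMap.comp_apply, LieAlgebra.ad_apply,
      LieAlgebra.ad_apply, ← hone y hy z hz, leibniz_lie, hψ _ _ (by lia) _ ha _ hy,
      hψ _ _ (by lia) _ ha _ hz, zero_add, zero_add, hone _ hay _ hz, hone _ hy _ haz, ← map_add,
      ← leibniz_lie]
  -- Here a is a sum of brackets [y, a'] with y in m. The Jacobi identity transfers y to b, which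
  -- lowers the left degree at constant total degree; for i = 0 the left factor already has degree
  -- one.
  | succ i ih =>
    suffices bracketSpan θ i ≤ LinearMap.eqLocus
        ((lieCross (ψ (i + 1)) (ψ j)).flip b)
        (ψ (i + 1 + j) ∘ₗ (LieModule.toEnd ℂ g g : g →ₗ[ℂ] g →ₗ[ℂ] g).flip b) from
      this (hgen _ ha)
    refine bracketSpan_le fun y hy a' ha' ↦ ?_
    rw [LinearMap.mem_eqLocus, LinearMap.flip_apply, lieCross_apply, LinearMap.comp_apply,
      LinearMap.flip_apply]
    change _ = ψ (i + 1 + j) ⁅⁅y, a'⁆, b⁆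
    obtain rfl | hi := Nat.eq_zero_or_pos i
    · obtain rfl : j = n + 1 := by lia
      have hya : ⁅y, a'⁆ ∈ grade θ 1 := lie_mem_grade hy ha'
      rw [zero_add, hone _ hya _ hb, show 1 + (n + 1) = n + 2 by lia]
    · have h1 : ⁅a', b⁆ ∈ grade θ (n + 1) := by
        rw [show n + 1 = i + j by lia]
        exact lie_mem_grade ha' hb
      have h2 : ⁅y, b⁆ ∈ grade θ (j + 1) := by
        rw [add_comm]
        exact lie_mem_grade hy hb
      rw [← hone' i (by lia) y hy a' ha', lie_lie, hψ i j (by lia) _ ha' _ hb,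
        show i + j = n + 1 by lia, hone _ hy _ h1, hone' j (by lia) y hy b hb,
        ih (j + 1) (by lia) ha' h2, show i + (j + 1) = n + 2 by lia,
        show i + 1 + j = n + 2 by lia, ← map_sub, ← lie_lie]

/-- The extension of two maps in degrees zero and one to all degrees, along sections `σ` of the
bracket. -/
def extendGraded (σ : ℕ → g →ₗ[ℂ] g ⊗[ℂ] g) (ψ₀ ψ₁ : g →ₗ[ℂ] A) : ℕ → g →ₗ[ℂ] A
  | 0 => ψ₀
  | 1 => ψ₁
  | n + 2 => TensorProduct.lift (lieCross ψ₁ (extendGraded σ ψ₀ ψ₁ (n + 1))) ∘ₗ σ (n + 1)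

/-- The vanishing hypothesis `hvan` makes the product of ψ_1 and ψ_{n+1} independent of the chosen
preimage under the bracket. This settles degree-one factors, and `lie_eq_of_lie_one` the others. -/
theorem lie_extendGraded (σ : ℕ → g →ₗ[ℂ] g ⊗[ℂ] g)
    (hσ : ∀ n, ∀ z ∈ grade θ (n + 1), σ n z ∈ gradeTensor θ 1 n ∧ bracket g (σ n z) = z)
    (hgen : ∀ n, grade θ (n + 1) ≤ bracketSpan θ n) (ψ₀ ψ₁ : g →ₗ[ℂ] A)
    (h00 : ∀ a ∈ grade θ 0, ∀ b ∈ grade θ 0, ⁅ψ₀ a, ψ₀ b⁆ = ψ₀ ⁅a, b⁆)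
    (h01 : ∀ a ∈ grade θ 0, ∀ b ∈ grade θ 1, ⁅ψ₀ a, ψ₁ b⁆ = ψ₁ ⁅a, b⁆)
    (hvan : ∀ n, (∀ i j, i + j < n + 2 → ∀ a ∈ grade θ i, ∀ b ∈ grade θ j,
        ⁅extendGraded σ ψ₀ ψ₁ i a, extendGraded σ ψ₀ ψ₁ j b⁆
          = extendGraded σ ψ₀ ψ₁ (i + j) ⁅a, b⁆) →
      ∀ w ∈ gradeTensor θ 1 (n + 1), bracket g w = 0 →
        TensorProduct.lift (lieCross ψ₁ (extendGraded σ ψ₀ ψ₁ (n + 1))) w = 0)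
    (i j : ℕ) {a b : g} (ha : a ∈ grade θ i) (hb : b ∈ grade θ j) :
    ⁅extendGraded σ ψ₀ ψ₁ i a, extendGraded σ ψ₀ ψ₁ j b⁆ = extendGraded σ ψ₀ ψ₁ (i + j) ⁅a, b⁆ := by
  suffices h : ∀ n i j, i + j < n + 2 → ∀ a ∈ grade θ i, ∀ b ∈ grade θ j,
      ⁅extendGraded σ ψ₀ ψ₁ i a, extendGraded σ ψ₀ ψ₁ j b⁆
        = extendGraded σ ψ₀ ψ₁ (i + j) ⁅a, b⁆ from h (i + j) i j (by lia) a ha b hb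
  intro n
  induction n with
  | zero =>
    intro i j hij a ha b hb
    obtain ⟨rfl, rfl⟩ | ⟨rfl, rfl⟩ | ⟨rfl, rfl⟩ :
        (i = 0 ∧ j = 0) ∨ (i = 0 ∧ j = 1) ∨ (i = 1 ∧ j = 0) := by lia
    · exact h00 a ha b hb
    · exact h01 a ha b hb
    · rw [← lie_skew, ← lie_skew a, map_neg]
      exact congrArg Neg.neg (h01 b hb a ha)
  | succ n ih =>
    intro i j hij a ha b hb
    obtain hij' | hij' : i + j < n + 2 ∨ i + j = n + 2 := by lia
    · exact ih i j hij' a ha b hb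
    refine lie_eq_of_lie_one _ n hgen ih (fun y hy z hz ↦ ?_) i j hij' ha hb
    have hyz : ⁅y, z⁆ ∈ grade θ (n + 1 + 1) := by
      rw [add_comm]
      exact lie_mem_grade hy hz
    obtain ⟨h1, h2⟩ := hσ (n + 1) _ hyz
    -- The difference of y ⊗ z and the chosen preimage of [y, z] has zero bracket.
    have h3 := hvan n ih (y ⊗ₜ z - σ (n + 1) ⁅y, z⁆) (sub_mem (tmul_mem_gradeTensor hy hz) h1)
      (by rw [map_sub, h2, bracket_tmul, sub_self])
    rw [map_sub, sub_eq_zero] at h3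
    exact h3

end Extension

/-! ### A maximal torus of h and its weight vectors in g. -/

section Torus

variable {g : Type u} [LieRing g] [LieAlgebra ℂ g] {θ : g →ₗ⁅ℂ⁆ g}
  [FiniteDimensional ℂ g] [LieAlgebra.IsKilling ℂ g]

theorem killingForm_eq_zero_iff {x : g} : (∀ z, killingForm ℂ g x z = 0) ↔ x = 0 := by
  refine ⟨fun h ↦ ?_, by rintro rfl; simp⟩
  have h1 : x ∈ LinearMap.ker (killingForm ℂ g) := LinearMap.ext h
  rwa [LieAlgebra.IsKilling.ker_killingForm_eq_bot, Submodule.mem_bot] at h1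

theorem ad_injective {x y : g} (h : ∀ z : g, ⁅x, z⁆ = ⁅y, z⁆) : x = y := by
  rw [← sub_eq_zero, ← killingForm_eq_zero_iff]
  intro z
  have : LieAlgebra.ad ℂ g (x - y) = 0 := by
    ext w
    simp [h]
  rw [killingForm_apply_apply, this]
  simp

/-- The Killing form of `g` is nondegenerate on the fixed points of an involution. -/
theorem eq_zero_of_killingForm_fixed (hinv : ∀ x, θ (θ x) = x) {x : g} (hx : x ∈ grade θ 0)
    (h : ∀ z ∈ grade θ 0, killingForm ℂ g x z = 0) : x = 0 := by
  rw [← killingForm_eq_zero_iff]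
  intro z
  obtain ⟨a, ha, b, hb, rfl⟩ := exists_grade_decomposition hinv z
  rw [map_add, h a ha, killingForm_eq_zero_of_mem_grade hinv (by simp) hx hb, add_zero]

/-- The commuting product ad x ad y is nilpotent, hence of trace zero. -/
theorem killingForm_eq_zero_of_isNilpotent {x y : g} (hx : IsNilpotent (LieAlgebra.ad ℂ g x))
    (hxy : ⁅x, y⁆ = 0) : killingForm ℂ g x y = 0 := by
  have comm : Commute (LieAlgebra.ad ℂ g x) (LieAlgebra.ad ℂ g y) := by
    ext z
    simp [leibniz_lie x, hxy]
  rw [killingForm_apply_apply]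
  exact (LinearMap.isNilpotent_trace_of_isNilpotent (comm.isNilpotent_mul_right hx)).eq_zero

open Module.End in
/-- The semisimple part of the adjoint action of a fixed point is the adjoint action of a fixed
point. -/
theorem exists_fixed_semisimple_part (hinv : ∀ x, θ (θ x) = x) {x : g} (hx : x ∈ grade θ 0) :
    ∃ y ∈ grade θ 0, (LieAlgebra.ad ℂ g y).IsSemisimple ∧
      IsNilpotent (LieAlgebra.ad ℂ g (x - y)) ∧ ∀ z : g, ⁅x, z⁆ = 0 → ⁅y, z⁆ = 0 := by
  obtain ⟨N, -, S, hS₀', hN, hS, hSN⟩ := (LieAlgebra.ad ℂ g x).exists_isNilpotent_isSemisimple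
  have hS₀ : Commute (LieAlgebra.ad ℂ g x) S := Algebra.commute_of_mem_adjoin_self hS₀'
  have hθx : θ x = x := by simpa [mem_grade] using hx
  -- S is a polynomial in ad x, and θ commutes with ad x because x is fixed.
  have hθ : Commute (θ : g →ₗ[ℂ] g) S := by
    refine Algebra.commute_of_mem_adjoin_singleton_of_commute hS₀' ?_
    ext z
    simp [hθx]
  have hN' := hN
  rw [eq_sub_of_add_eq hSN.symm] at hN'
  have aux {μ : ℂ} {y : g} (hy : y ∈ (LieAlgebra.ad ℂ g x).maxGenEigenspace μ) : S y = μ • y := by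
    rw [maxGenEigenspace_eq] at hy
    exact apply_eq_of_mem_of_comm_of_isFinitelySemisimple_of_isNil hy hS₀ hS.isFinitelySemisimple
      hN'
  -- S acts on each generalized eigenspace of ad x by its eigenvalue, and eigenvalues add under the
  -- bracket. So S is a derivation, hence inner.
  have h_der (y z : g) (μ ν : ℂ) (hy : y ∈ (LieAlgebra.ad ℂ g x).maxGenEigenspace μ)
      (hz : z ∈ (LieAlgebra.ad ℂ g x).maxGenEigenspace ν) : S ⁅y, z⁆ = ⁅S y, z⁆ + ⁅y, S z⁆ := by
    have hyz : ⁅y, z⁆ ∈ (LieAlgebra.ad ℂ g x).maxGenEigenspace (μ + ν) :=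
      LieModule.lie_mem_maxGenEigenspace_toEnd hy hz
    rw [aux hy, aux hz, aux hyz, smul_lie, lie_smul, ← add_smul]
  replace h_der (y z : g) : S ⁅y, z⁆ = ⁅S y, z⁆ + ⁅y, S z⁆ := by
    have hy : y ∈ ⨆ μ, (LieAlgebra.ad ℂ g x).maxGenEigenspace μ := by
      simp [iSup_maxGenEigenspace_eq_top]
    have hz : z ∈ ⨆ μ, (LieAlgebra.ad ℂ g x).maxGenEigenspace μ := by
      simp [iSup_maxGenEigenspace_eq_top]
    induction hy using Submodule.iSup_induction' with
    | mem α y hy =>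
      induction hz using Submodule.iSup_induction' with
      | mem β z hz => exact h_der y z α β hy hz
      | zero => simp
      | add _ _ _ _ h h' => simp only [lie_add, map_add, h, h']; abel
    | zero => simp
    | add _ _ _ _ h h' => simp only [add_lie, map_add, h, h']; abel
  replace h_der : ∀ y z : g, S ⁅y, z⁆ = ⁅y, S z⁆ - ⁅z, S y⁆ := by
    simp_rw [← lie_skew (S _) _, add_comm, ← sub_eq_add_neg] at h_der; assumption
  obtain ⟨y, hy⟩ := LieDerivation.IsKilling.exists_eq_ad (⟨S, h_der⟩ : LieDerivation ℂ g g)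
  have hSy : S = LieAlgebra.ad ℂ g y := by
    rw [← LieDerivation.coe_ad_apply_eq_ad_apply y, hy]
  refine ⟨y, ?_, hSy ▸ hS, ?_, fun z hz ↦ ?_⟩
  · rw [mem_grade, pow_zero, one_smul]
    refine ad_injective fun z ↦ ?_
    have h1 := LinearMap.congr_fun hθ.eq (θ z)
    rw [hSy] at h1
    simpa [hinv] using h1
  · rwa [map_sub, ← hSy]
  · rw [← LieAlgebra.ad_apply (R := ℂ), ← hSy]
    have h0 : z ∈ (LieAlgebra.ad ℂ g x).maxGenEigenspace 0 := by
      rw [mem_maxGenEigenspace]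
      exact ⟨1, by simpa using hz⟩
    rw [aux h0, zero_smul]

variable (θ) in
/-- A homogeneous basis of weight vectors for an abelian subspace of the fixed points that is its
own centralizer in the fixed points. Weights are represented by elements of the torus. -/
structure WeightBasis (I : Type v) extends HomogeneousBasis θ I where
  torus : Submodule ℂ g
  torus_le : torus ≤ grade θ 0
  lie_torus : ∀ x ∈ torus, ∀ y ∈ torus, ⁅x, y⁆ = 0
  mem_torus : ∀ z ∈ grade θ 0, (∀ x ∈ torus, ⁅x, z⁆ = 0) → z ∈ torus
  wt : I → g
  wt_mem : ∀ i, wt i ∈ torus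
  lie_basis : ∀ x ∈ torus, ∀ i, ⁅x, basis i⁆ = killingForm ℂ g (wt i) x • basis i

/-- The torus is a Cartan subalgebra t of h. Nondegeneracy of the Killing form of g on t makes t
abelian and forces its elements to act semisimply on g. -/
theorem exists_weightBasis (hinv : ∀ x, θ (θ x) = x) :
    ∃ (I : Type u) (_ : Fintype I), Nonempty (WeightBasis θ I) := by
  let h : LieSubalgebra ℂ g := fixedPoints θ
  obtain ⟨a, ha⟩ := LieAlgebra.exists_isCartanSubalgebra_engel ℂ h
  set t := LieSubalgebra.engel ℂ a
  have hmem (z : h) : (z : g) ∈ grade θ 0 := mem_grade_zero.mpr z.2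
  -- By Fitting, h is the sum of t and a complement orthogonal to t, and the Killing form of g is
  -- nondegenerate on h.
  have nondeg (x : t) (hx : ∀ y : t, killingForm ℂ g ((x : h) : g) ((y : h) : g) = 0) : x = 0 := by
    suffices ((x : h) : g) = 0 from Subtype.ext (Subtype.ext this)
    refine eq_zero_of_killingForm_fixed hinv (hmem _) fun z hz ↦ ?_
    obtain ⟨z, rfl⟩ : ∃ z' : h, (z' : g) = z := ⟨⟨z, mem_grade_zero.mp hz⟩, rfl⟩
    have hz : z ∈ (⊤ : LieSubmodule ℂ t h) := LieSubmodule.mem_top z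
    rw [← (LieModule.isCompl_genWeightSpace_zero_posFittingComp ℂ t h).sup_eq_top,
      LieSubmodule.mem_sup] at hz
    obtain ⟨p, hp, q, hq, rfl⟩ := hz
    have hp' : p ∈ t := by
      exact (SetLike.ext_iff.mp (LieAlgebra.rootSpace_zero_eq ℂ h t) p).mp hp
    have hx0 : (x : h) ∈ LieModule.genWeightSpace h (0 : t → ℂ) := by
      exact (SetLike.ext_iff.mp (LieAlgebra.rootSpace_zero_eq ℂ h t) (x : h)).mpr x.2
    have hq' := LieModule.eq_zero_of_mem_genWeightSpace_mem_posFitting ℂ t h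
      (B := (killingForm ℂ g).compl₁₂ (h.subtype : h →ₗ[ℂ] g) (h.subtype : h →ₗ[ℂ] g))
      (fun y m n ↦ by
        change killingForm ℂ g ⁅((y : h) : g), (m : g)⁆ n = - killingForm ℂ g m ⁅((y : h) : g), (n
            : g)⁆
        rw [← LieModule.traceForm_apply_lie_apply, ← lie_skew, map_neg, LinearMap.neg_apply])
      hx0 hq
    have hq'' : killingForm ℂ g ((x : h) : g) (q : g) = 0 := hq'
    change killingForm ℂ g ((x : h) : g) ((p : g) + (q : g)) = 0
    rw [map_add, hq'', hx ⟨p, hp'⟩, add_zero]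
  have hker : LinearMap.ker (LieModule.traceForm ℂ t g) = ⊥ := by
    rw [LinearMap.ker_eq_bot']
    intro x hx
    exact nondeg x fun y ↦ LinearMap.congr_fun hx y
  have habel : IsLieAbelian t := LieModule.isLieAbelian_of_ker_traceForm_eq_bot ℂ t g hker
  have hcomm (x y : t) : ⁅((x : h) : g), ((y : h) : g)⁆ = 0 := by
    have := congrArg (fun z : t ↦ ((z : h) : g)) (trivial_lie_zero t t x y)
    exact this
  -- An element of h that centralizes t normalizes it, and t is its own normalizer.
  have hself (z : h) (hz : ∀ x : t, ⁅((x : h) : g), (z : g)⁆ = 0) : z ∈ t := by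
    have : z ∈ t.normalizer := by
      rw [LieSubalgebra.mem_normalizer_iff]
      intro x hx
      have : ⁅z, x⁆ = 0 := Subtype.ext (by
        have h1 := hz ⟨x, hx⟩
        rw [← lie_skew, neg_eq_zero] at h1
        exact h1)
      rw [this]
      exact zero_mem t
    rwa [LieSubalgebra.IsCartanSubalgebra.self_normalizing] at this
  -- The semisimple part y of x commutes with whatever x commutes with, so y lies in t. The
  -- nilpotent part x - y then commutes with t, is orthogonal to it, and vanishes.
  have hss (x : t) : (LieAlgebra.ad ℂ g ((x : h) : g)).IsSemisimple := by
    obtain ⟨y, hy, h1, h2, h3⟩ := exists_fixed_semisimple_part hinv (hmem (x : h))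
    have hyt : (⟨y, mem_grade_zero.mp hy⟩ : h) ∈ t := hself _ fun z ↦ by
      rw [← lie_skew, h3 _ (hcomm x z), neg_zero]
    have hxy : x = ⟨⟨y, mem_grade_zero.mp hy⟩, hyt⟩ := by
      rw [← sub_eq_zero]
      refine nondeg _ fun z ↦ ?_
      refine killingForm_eq_zero_of_isNilpotent (x := ((x : h) : g) - y) h2 ?_
      rw [sub_lie, hcomm x z, h3 _ (hcomm x z), sub_zero]
    rw [hxy]
    exact h1
  let T : Submodule ℂ g := t.toSubmodule.map (h.subtype : h →ₗ[ℂ] g)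
  have hT (x : t) : ((x : h) : g) ∈ T := ⟨(x : h), x.2, rfl⟩
  have hT' (x : g) (hx : x ∈ T) : ∃ y : t, ((y : h) : g) = x := by
    obtain ⟨y, hy, rfl⟩ := hx
    exact ⟨⟨y, hy⟩, rfl⟩
  -- A weight vector v is the sum of (v + θv)/2 and (v - θv)/2, which have the same weight because θ
  -- fixes t. So the homogeneous weight vectors span g.
  let S : Set g := {v | (∃ k, v ∈ grade θ k) ∧ ∃ χ : t → ℂ, ∀ x : t, ⁅((x : h) : g), v⁆ = χ x • v}
  have hS : ⊤ ≤ Submodule.span ℂ S := by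
    rw [← LieSubmodule.top_toSubmodule (R := ℂ) (L := t) (M := g),
      ← LieModule.iSup_genWeightSpace_eq_top ℂ t g, LieSubmodule.iSup_toSubmodule]
    refine iSup_le fun χ v hv ↦ ?_
    have hv' (x : t) : ⁅((x : h) : g), v⁆ = χ x • v := by
      have h1 : v ∈ (LieAlgebra.ad ℂ g ((x : h) : g)).maxGenEigenspace (χ x) :=
        LieModule.genWeightSpace_le_genWeightSpaceOf g x χ hv
      rw [(hss x).isFinitelySemisimple.maxGenEigenspace_eq_eigenspace,
        Module.End.mem_eigenspace_iff] at h1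
      simpa using h1
    have hθv (x : t) : ⁅((x : h) : g), θ v⁆ = χ x • θ v := by
      have hx : θ ((x : h) : g) = ((x : h) : g) := (x : h).2
      rw [← hx, ← LieHom.map_lie, hv', map_smul]
    have : v = (1 / 2 : ℂ) • (v + θ v) + (1 / 2 : ℂ) • (v - θ v) := by module
    rw [this]
    refine add_mem (Submodule.smul_mem _ _ (Submodule.subset_span ⟨⟨0, ?_⟩, χ, fun x ↦ ?_⟩))
      (Submodule.smul_mem _ _ (Submodule.subset_span ⟨⟨1, ?_⟩, χ, fun x ↦ ?_⟩))
    · rw [mem_grade, map_add, hinv]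
      module
    · rw [lie_add, hv', hθv, smul_add]
    · rw [mem_grade, map_sub, hinv]
      module
    · rw [lie_sub, hv', hθv, smul_sub]
  let b := Module.Basis.ofSpan hS
  have hb (i) : b i ∈ S := Module.Basis.ofSpan_subset hS ⟨i, rfl⟩
  choose hb1 hb2 using hb
  choose deg hdeg using hb1
  choose χ hχ using hb2
  have key (i) : ∃ s ∈ T, ∀ x ∈ T, ⁅x, b i⁆ = killingForm ℂ g s x • b i := by
    let f : t →ₗ[ℂ] ℂ := b.coord i ∘ₗ
      (LieModule.toEnd ℂ g g : g →ₗ[ℂ] g →ₗ[ℂ] g).flip (b i) ∘ₗ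
      (h.subtype : h →ₗ[ℂ] g) ∘ₗ (t.subtype : t →ₗ[ℂ] h)
    have hf (x : t) : f x = χ i x := by
      change b.coord i ⁅((x : h) : g), b i⁆ = _
      rw [hχ, map_smul, Module.Basis.coord_apply, Module.Basis.repr_self]
      simp
    have hinj : Function.Injective (LieModule.traceForm ℂ t g) := LinearMap.ker_eq_bot.mp hker
    obtain ⟨s, hs⟩ := (LinearMap.injective_iff_surjective_of_finrank_eq_finrank
      (f := LieModule.traceForm ℂ t g) (Subspace.dual_finrank_eq).symm).mp hinj f
    refine ⟨s, hT s, fun x hx ↦ ?_⟩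
    obtain ⟨x, rfl⟩ := hT' x hx
    rw [hχ, ← hf, ← hs]
    rfl
  choose wt hwt hwt' using key
  have : Fintype ((linearIndepOn_empty ℂ id).extend (Set.empty_subset S)) :=
    FiniteDimensional.fintypeBasisIndex b
  refine ⟨_, this, ⟨⟨⟨b, deg, hdeg⟩, T, ?_, ?_, ?_, wt, hwt, fun x hx i ↦ hwt' i x hx⟩⟩⟩
  · intro x hx
    obtain ⟨x, rfl⟩ := hT' x hx
    exact hmem _
  · intro x hx y hy
    obtain ⟨x, rfl⟩ := hT' x hx
    obtain ⟨y, rfl⟩ := hT' y hy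
    exact hcomm x y
  · intro z hz hz'
    exact hT ⟨⟨z, mem_grade_zero.mp hz⟩, hself _ fun x ↦ hz' _ (hT x)⟩

end Torus

/-! ### Traces over subspaces and along weight strings. -/

section RelativeTrace

variable {M : Type v} [AddCommGroup M] [Module ℂ M] [FiniteDimensional ℂ M]

/-- A linear projection onto a subspace. -/
def someProj (S : Submodule ℂ M) : M →ₗ[ℂ] M :=
  S.subtype ∘ₗ (S.subtype.exists_leftInverse_of_injective S.ker_subtype).choose

theorem isProj_someProj (S : Submodule ℂ M) : LinearMap.IsProj S (someProj S) where
  map_mem _ := Subtype.property _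
  map_id x hx := congrArg Subtype.val (LinearMap.congr_fun
    (S.subtype.exists_leftInverse_of_injective S.ker_subtype).choose_spec ⟨x, hx⟩)

/-- The trace of an endomorphism composed with a projection onto a subspace. -/
def relTrace (S : Submodule ℂ M) : Module.End ℂ M →ₗ[ℂ] ℂ :=
  LinearMap.trace ℂ M ∘ₗ LinearMap.lcomp ℂ M (someProj S)

theorem relTrace_apply (S : Submodule ℂ M) (f : Module.End ℂ M) :
    relTrace S f = LinearMap.trace ℂ M (f ∘ₗ someProj S) := rfl

theorem relTrace_congr {S : Submodule ℂ M} {f f' : Module.End ℂ M} (h : ∀ v ∈ S, f v = f' v) :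
    relTrace S f = relTrace S f' := by
  rw [relTrace_apply, relTrace_apply]
  congr 1
  ext v
  exact h _ ((isProj_someProj S).map_mem v)

theorem relTrace_eq_mul {S : Submodule ℂ M} {f : Module.End ℂ M} {c : ℂ}
    (h : ∀ v ∈ S, f v = c • v) : relTrace S f = c * Module.finrank ℂ S := by
  rw [relTrace_congr (f' := c • LinearMap.id) h, map_smul, relTrace_apply, LinearMap.id_comp,
    (isProj_someProj S).trace, smul_eq_mul]

theorem relTrace_comp_comm {S S' : Submodule ℂ M} {e f : Module.End ℂ M}
    (he : ∀ v ∈ S, e v ∈ S') (hf : ∀ v ∈ S', f v ∈ S) :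
    relTrace S (f ∘ₗ e) = relTrace S' (e ∘ₗ f) := by
  have h1 : (f ∘ₗ e) ∘ₗ someProj S = (f ∘ₗ someProj S') ∘ₗ (e ∘ₗ someProj S) := by
    ext v
    simp [(isProj_someProj S').map_id _ (he _ ((isProj_someProj S).map_mem v))]
  have h2 : (e ∘ₗ f) ∘ₗ someProj S' = (e ∘ₗ someProj S) ∘ₗ (f ∘ₗ someProj S') := by
    ext v
    simp [(isProj_someProj S).map_id _ (hf _ ((isProj_someProj S').map_mem v))]
  rw [relTrace_apply, relTrace_apply, h1, h2, LinearMap.trace_comp_comm']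

end RelativeTrace

section String

/-- Here τ j models the trace of f e on the j-th space of a string. For a ≥ 0 the increments make τ
decrease to zero above 0; for a < 0 they make it increase from zero below 0. In the first case the
value at -1 is τ 0 plus a nonnegative term. -/
theorem nonneg_of_string {τ : ℤ → ℝ} {d : ℤ → ℕ} {a b : ℝ} (hb : 0 < b)
    (hτ : ∀ j, τ j - τ (j + 1) = (a + (j + 1) * b) * d (j + 1)) {N : ℕ}
    (hN : ∀ j : ℤ, N ≤ |j| → τ j = 0) : 0 ≤ τ 0 ∧ 0 ≤ τ (-1) := by
  obtain ha | ha := le_or_gt 0 a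
  · have down (k : ℕ) : ∀ j : ℤ, 0 ≤ j → N ≤ j + k → 0 ≤ τ j := by
      induction k with
      | zero =>
        intro j hj h
        rw [hN j (by simpa [abs_of_nonneg hj] using h)]
      | succ k ih =>
        intro j hj h
        have h1 := ih (j + 1) (by lia) (by push_cast at h; lia)
        have h2 : 0 ≤ (a + (j + 1) * b) * d (j + 1) := by
          have : (0 : ℝ) ≤ j := by exact_mod_cast hj
          positivity
        linarith [hτ j]
    have h0 := down N 0 le_rfl (by simp)
    refine ⟨h0, ?_⟩
    have := hτ (-1)
    have h2 : 0 ≤ a * d 0 := by positivity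
    norm_num at this
    linarith
  · have up (k : ℕ) : ∀ j : ℤ, j ≤ 0 → N ≤ -j + k → 0 ≤ τ j := by
      induction k with
      | zero =>
        intro j hj h
        rw [hN j (by simpa [abs_of_nonpos hj] using h)]
      | succ k ih =>
        intro j hj h
        have h1 := ih (j - 1) (by lia) (by push_cast at h; lia)
        have h2 : (a + j * b) * d j ≤ 0 := by
          have : (j : ℝ) ≤ 0 := by exact_mod_cast hj
          exact mul_nonpos_of_nonpos_of_nonneg (by nlinarith) (by positivity)
        have h3 := hτ (j - 1)
        push_cast at h3
        rw [sub_add_cancel, sub_add_cancel] at h3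
        linarith
    exact ⟨up N 0 le_rfl (by simp), up N (-1) (by lia) (by lia)⟩

variable {M : Type v} [AddCommGroup M] [Module ℂ M] [FiniteDimensional ℂ M]
  {e f : Module.End ℂ M} {V : ℤ → Submodule ℂ M} {a b : ℂ}

/-- The trace of f e on V_j equals that of e f on V_{j+1}, so the difference is the trace of the
scalar [e, f] on V_{j+1}. -/
theorem relTrace_string (he : ∀ j, ∀ v ∈ V j, e v ∈ V (j + 1))
    (hf : ∀ j, ∀ v ∈ V (j + 1), f v ∈ V j)
    (hef : ∀ j : ℤ, ∀ v ∈ V j, e (f v) - f (e v) = (a + j * b) • v) (j : ℤ) :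
    relTrace (V j) (f ∘ₗ e) - relTrace (V (j + 1)) (f ∘ₗ e)
      = (a + (j + 1) * b) * Module.finrank ℂ (V (j + 1)) := by
  rw [relTrace_comp_comm (he j) (hf j), ← map_sub]
  refine relTrace_eq_mul fun v hv ↦ ?_
  have := hef (j + 1) v hv
  push_cast at this
  exact this

theorem relTrace_bot (f : Module.End ℂ M) : relTrace ⊥ f = 0 := by
  rw [relTrace_congr (f' := 0) (by simp), map_zero]

theorem sum_string_eq_zero (he : ∀ j, ∀ v ∈ V j, e v ∈ V (j + 1))
    (hf : ∀ j, ∀ v ∈ V (j + 1), f v ∈ V j)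
    (hef : ∀ j : ℤ, ∀ v ∈ V j, e (f v) - f (e v) = (a + j * b) • v) {N : ℕ}
    (hN : ∀ j : ℤ, N ≤ |j| → V j = ⊥) :
    ∑ k ∈ Finset.range (2 * N), (a + ((k : ℂ) - N + 1) * b)
      * Module.finrank ℂ (V ((k : ℤ) - N + 1)) = 0 := by
  have h (k : ℕ) : (a + ((k : ℂ) - N + 1) * b) * Module.finrank ℂ (V ((k : ℤ) - N + 1))
      = relTrace (V ((k : ℤ) - N)) (f ∘ₗ e) - relTrace (V (((k + 1 : ℕ) : ℤ) - N)) (f ∘ₗ e) := by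
    rw [show (((k + 1 : ℕ) : ℤ) - N) = (k : ℤ) - N + 1 by push_cast; ring,
      relTrace_string he hf hef]
    push_cast
    rfl
  simp_rw [h]
  rw [Finset.sum_range_sub', hN _ (by simp), hN _ (by push_cast; rw [abs_of_nonneg] <;> lia),
    relTrace_bot, sub_zero]

/-- This positivity replaces a positive definite hermitian form for which e and f are adjoint. -/
theorem re_relTrace_nonneg (he : ∀ j, ∀ v ∈ V j, e v ∈ V (j + 1))
    (hf : ∀ j, ∀ v ∈ V (j + 1), f v ∈ V j)
    (hef : ∀ j : ℤ, ∀ v ∈ V j, e (f v) - f (e v) = (a + j * b) • v) {N : ℕ}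
    (hN : ∀ j : ℤ, N ≤ |j| → V j = ⊥) (hb : 0 < b.re) :
    0 ≤ (relTrace (V 0) (f ∘ₗ e)).re ∧ 0 ≤ (relTrace (V 0) (e ∘ₗ f)).re := by
  have h1 : relTrace (V 0) (e ∘ₗ f) = relTrace (V (-1)) (f ∘ₗ e) := by
    rw [relTrace_comp_comm (he (-1)) (hf (-1)), neg_add_cancel]
  rw [h1]
  refine nonneg_of_string (τ := fun j ↦ (relTrace (V j) (f ∘ₗ e)).re)
    (d := fun j ↦ Module.finrank ℂ (V j)) (a := a.re) hb (fun j ↦ ?_) (N := N) (fun j hj ↦ ?_)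
  · have := congrArg Complex.re (relTrace_string he hf hef j)
    simpa [Complex.mul_re] using this
  · rw [hN j hj, relTrace_bot, Complex.zero_re]

end String

/-! ### Weights and the reality of their inner products. -/

namespace WeightBasis

variable {g : Type u} [LieRing g] [LieAlgebra ℂ g] {θ : g →ₗ⁅ℂ⁆ g} {I : Type v} [Fintype I]
  [DecidableEq I] [FiniteDimensional ℂ g] [LieAlgebra.IsKilling ℂ g] (W : WeightBasis θ I)

section Module

variable (M : Type w) [AddCommGroup M] [Module ℂ M] [LieRingModule g M] [LieModule ℂ g M]

/-- The space of vectors of weight `s` for the torus. -/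
def weightSpace (s : g) : Submodule ℂ M where
  carrier := {v | ∀ x ∈ W.torus, ⁅x, v⁆ = killingForm ℂ g s x • v}
  add_mem' ha hb x hx := by rw [lie_add, ha x hx, hb x hx, smul_add]
  zero_mem' x _ := by simp
  smul_mem' c v hv x hx := by rw [lie_smul, hv x hx, smul_comm]

variable {M}

theorem lie_mem_weightSpace {s s' y : g} {v : M} (hy : y ∈ W.weightSpace g s)
    (hv : v ∈ W.weightSpace M s') : ⁅y, v⁆ ∈ W.weightSpace M (s' + s) := by
  intro x hx
  rw [leibniz_lie, hy x hx, hv x hx, smul_lie, lie_smul, ← add_smul, map_add, LinearMap.add_apply,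
    add_comm]

theorem basis_mem (i : I) : W.basis i ∈ W.weightSpace g (W.wt i) :=
  fun x hx ↦ W.lie_basis x hx i

/-- A nonzero subspace that is stable under the torus contains a simultaneous eigenvector. -/
theorem exists_weightVector [FiniteDimensional ℂ M] {V : Submodule ℂ M} (hV : V ≠ ⊥)
    (hstab : ∀ x ∈ W.torus, ∀ v ∈ V, ⁅x, v⁆ ∈ V) :
    ∃ v ∈ V, v ≠ 0 ∧ ∀ x ∈ W.torus, ∃ c : ℂ, ⁅x, v⁆ = c • v := by
  let L : LieSubalgebra ℂ g :=
    { W.torus with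
      lie_mem' := by
        intro x y hx hy
        rw [W.lie_torus x hx y hy]
        exact W.torus.zero_mem }
  let N : LieSubmodule ℂ L M :=
    { V with lie_mem := fun {x v} hv ↦ hstab x x.2 v hv }
  have : IsLieAbelian L := ⟨fun x y ↦ Subtype.ext (W.lie_torus x x.2 y y.2)⟩
  have : Nontrivial N := (Submodule.nontrivial_iff_ne_bot (p := V)).mpr hV
  obtain ⟨χ, hχ⟩ := LieModule.exists_nontrivial_weightSpace_of_isSolvable ℂ L N
  obtain ⟨v, hv⟩ := exists_ne (0 : LieModule.weightSpace N χ)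
  refine ⟨((v : N) : M), (v : N).2, fun h ↦ hv (Subtype.ext (Subtype.ext h)),
    fun x hx ↦ ⟨χ ⟨x, hx⟩, ?_⟩⟩
  have := (LieModule.mem_weightSpace (χ : L → ℂ) (v : N)).mp v.2 ⟨x, hx⟩
  exact congrArg Subtype.val this

end Module

theorem killingForm_wt_torus {x y : g} (hx : x ∈ W.torus) (hy : y ∈ W.torus) :
    killingForm ℂ g x y = ∑ i, killingForm ℂ g (W.wt i) x * killingForm ℂ g (W.wt i) y := by
  rw [killingForm_apply_apply, W.trace_eq_sum]
  refine Finset.sum_congr rfl fun i _ ↦ ?_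
  rw [LinearMap.comp_apply, LieAlgebra.ad_apply, LieAlgebra.ad_apply, W.lie_basis y hy, lie_smul,
    W.lie_basis x hx, map_smul, map_smul, W.killingForm_dual_basis]
  simp [mul_comm]

theorem eq_zero_of_killingForm_wt {x : g} (hx : x ∈ W.torus)
    (h : ∀ i, killingForm ℂ g (W.wt i) x = 0) : x = 0 := by
  refine ad_injective fun z ↦ ?_
  rw [zero_lie, ← W.basis.sum_repr z, lie_sum]
  refine Finset.sum_eq_zero fun i _ ↦ ?_
  rw [lie_smul, W.lie_basis x hx, h i, zero_smul, smul_zero]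

theorem eq_of_killingForm_torus {s s' : g} (hs : s ∈ W.torus) (hs' : s' ∈ W.torus)
    (h : ∀ x ∈ W.torus, killingForm ℂ g s x = killingForm ℂ g s' x) : s = s' := by
  rw [← sub_eq_zero]
  refine W.eq_zero_of_killingForm_wt (sub_mem hs hs') fun i ↦ ?_
  rw [LieModule.traceForm_comm, map_sub, LinearMap.sub_apply, h _ (W.wt_mem i), sub_self]

theorem dual_mem_weightSpace (i : I) : W.dual i ∈ W.weightSpace g (-W.wt i) := by
  intro x hx
  refine W.ext_dual fun j ↦ ?_
  rw [← LieModule.traceForm_apply_lie_apply, ← lie_skew, W.lie_basis x hx, map_neg, map_neg,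
    LinearMap.neg_apply, LinearMap.neg_apply, map_smul, map_smul, LinearMap.smul_apply,
    W.killingForm_basis_dual]
  split_ifs with h
  · simp [h]
  · simp

theorem repr_lie {x : g} (hx : x ∈ W.torus) (z : g) (i : I) :
    W.basis.repr ⁅x, z⁆ i = killingForm ℂ g (W.wt i) x * W.basis.repr z i := by
  rw [← W.killingForm_dual, ← W.killingForm_dual, ← LieModule.traceForm_apply_lie_apply,
    ← lie_skew, W.dual_mem_weightSpace i x hx]
  simp

/-- The weight of a homogeneous weight vector is the weight of a member of the basis. -/
theorem wt_eq_of_repr_ne_zero {s z : g} (hs : s ∈ W.torus) (hz : z ∈ W.weightSpace g s) {i : I}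
    (hi : W.basis.repr z i ≠ 0) : W.wt i = s := by
  refine W.eq_of_killingForm_torus (W.wt_mem i) hs fun x hx ↦ ?_
  have h := W.repr_lie hx z i
  rw [hz x hx, map_smul, Finsupp.smul_apply, smul_eq_mul] at h
  exact (mul_right_cancel₀ hi h).symm

theorem even_of_repr_ne_zero (hinv : ∀ x, θ (θ x) = x) {k : ℕ} {z : g} (hz : z ∈ grade θ k) {i : I}
    (hi : W.basis.repr z i ≠ 0) : Even (W.deg i + k) := by
  by_contra h
  rw [← W.killingForm_dual, killingForm_eq_zero_of_mem_grade hinv h (W.dual_mem hinv i) hz] at hi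
  exact hi rfl

theorem exists_repr_ne_zero {z : g} (hz : z ≠ 0) : ∃ i, W.basis.repr z i ≠ 0 := by
  by_contra! h
  exact hz (W.basis.ext_elem fun i ↦ by rw [h i, map_zero, Finsupp.zero_apply])

/-- The bracket has weight zero and lies in h because e and f have equal parity, hence lies in the
torus, where invariance of the Killing form identifies it. -/
theorem lie_eq_killingForm_smul {k : ℕ} {s e f : g} (hs : s ∈ W.torus)
    (he : e ∈ W.weightSpace g s) (hf : f ∈ W.weightSpace g (-s)) (hek : e ∈ grade θ k)
    (hfk : f ∈ grade θ k) : ⁅e, f⁆ = killingForm ℂ g e f • s := by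
  have h0 : ⁅e, f⁆ ∈ W.torus := by
    refine W.mem_torus _ ?_ fun x hx ↦ ?_
    · rw [grade_congr (θ := θ) (i := 0) (j := k + k) (by simp)]
      exact lie_mem_grade hek hfk
    · rw [W.lie_mem_weightSpace he hf x hx, neg_add_cancel]
      simp
  refine W.eq_of_killingForm_torus h0 (Submodule.smul_mem _ _ hs) fun x hx ↦ ?_
  rw [LieModule.traceForm_apply_lie_apply, ← lie_skew, map_neg, hf x hx]
  simp [mul_comm]

theorem lie_basis_dual (hinv : ∀ x, θ (θ x) = x) (i : I) : ⁅W.basis i, W.dual i⁆ = W.wt i := by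
  rw [W.lie_eq_killingForm_smul (W.wt_mem i) (W.basis_mem i) (W.dual_mem_weightSpace i)
    (W.mem i) (W.dual_mem hinv i), W.killingForm_basis_dual, if_pos rfl, one_smul]

theorem killingForm_basis_torus {i : I} (hi : W.wt i ≠ 0) {x : g} (hx : x ∈ W.torus) :
    killingForm ℂ g (W.basis i) x = 0 := by
  obtain ⟨j, hj⟩ : ∃ j, killingForm ℂ g (W.wt j) (W.wt i) ≠ 0 := by
    by_contra! h
    exact hi (W.eq_zero_of_killingForm_wt (W.wt_mem i) h)
  have h := LieModule.traceForm_apply_lie_apply ℂ g g (W.basis i) (W.wt j) x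
  rw [W.lie_torus _ (W.wt_mem j) x hx, map_zero, ← lie_skew, W.lie_basis _ (W.wt_mem j), map_neg,
    LinearMap.neg_apply, map_smul, LinearMap.smul_apply, neg_eq_zero, smul_eq_zero,
    LieModule.traceForm_comm] at h
  exact h.resolve_left hj

theorem killingForm_dual_torus {i : I} (hi : W.wt i ≠ 0) {x : g} (hx : x ∈ W.torus) :
    killingForm ℂ g (W.dual i) x = 0 := by
  obtain ⟨j, hj⟩ : ∃ j, killingForm ℂ g (W.wt j) (W.wt i) ≠ 0 := by
    by_contra! h
    exact hi (W.eq_zero_of_killingForm_wt (W.wt_mem i) h)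
  have h := LieModule.traceForm_apply_lie_apply ℂ g g (W.dual i) (W.wt j) x
  rw [W.lie_torus _ (W.wt_mem j) x hx, map_zero, ← lie_skew,
    W.dual_mem_weightSpace i _ (W.wt_mem j), map_neg,
    LinearMap.neg_apply, map_smul, LinearMap.smul_apply, neg_eq_zero, smul_eq_zero, map_neg,
    LinearMap.neg_apply, neg_eq_zero, LieModule.traceForm_comm] at h
  exact h.resolve_left hj

theorem basis_mem_torus {i : I} (hdeg : Even (W.deg i)) (hi : W.wt i = 0) :
    W.basis i ∈ W.torus := by
  refine W.mem_torus _ ?_ fun x hx ↦ by rw [W.lie_basis x hx, hi]; simp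
  rw [grade_congr (θ := θ) (i := 0) (j := W.deg i) (by simpa using hdeg)]
  exact W.mem i

theorem dual_mem_torus (hinv : ∀ x, θ (θ x) = x) {i : I} (hdeg : Even (W.deg i))
    (hi : W.wt i = 0) : W.dual i ∈ W.torus := by
  refine W.mem_torus _ ?_ fun x hx ↦ by rw [W.dual_mem_weightSpace i x hx, hi]; simp
  rw [grade_congr (θ := θ) (i := 0) (j := W.deg i) (by simpa using hdeg)]
  exact W.dual_mem hinv i

theorem exists_bound_of_string (μ : g) (hμ : μ ∈ W.torus) {s : g} (hs : s ∈ W.torus)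
    (hs0 : s ≠ 0) :
    ∃ N : ℕ, ∀ j : ℤ, N ≤ |j| → W.weightSpace g (μ + (j : ℂ) • s) = ⊥ := by
  have hfin : {j : ℤ | W.weightSpace g (μ + (j : ℂ) • s) ≠ ⊥}.Finite := by
    refine Set.Finite.of_finite_image
      (f := fun j : ℤ ↦ μ + (j : ℂ) • s) ((Set.finite_range W.wt).subset ?_) ?_
    · rintro _ ⟨j, hj, rfl⟩
      obtain ⟨v, hv, hv0⟩ := (Submodule.ne_bot_iff _).mp hj
      obtain ⟨i, hi⟩ := W.exists_repr_ne_zero hv0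
      exact ⟨i, W.wt_eq_of_repr_ne_zero (add_mem hμ (Submodule.smul_mem _ _ hs)) hv hi⟩
    · intro j _ k _ hjk
      have h : ((j : ℂ) - k) • s = 0 := by
        rw [sub_smul, sub_eq_zero]
        exact add_left_cancel hjk
      have := (smul_eq_zero.mp h).resolve_right hs0
      exact_mod_cast sub_eq_zero.mp this
  obtain ⟨N, hN⟩ := (hfin.image Int.natAbs).bddAbove
  refine ⟨N + 1, fun j hj ↦ ?_⟩
  by_contra h
  have := hN ⟨j, h, rfl⟩
  rw [Int.abs_eq_natAbs] at hj
  lia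

section Reality

variable (hinv : ∀ x, θ (θ x) = x)
include hinv

theorem lie_basis_lie_dual {M : Type w} [AddCommGroup M] [Module ℂ M] [LieRingModule g M]
    [LieModule ℂ g M] (i : I) {s : g} {v : M} (hv : v ∈ W.weightSpace M s) :
    ⁅W.basis i, ⁅W.dual i, v⁆⁆ - ⁅W.dual i, ⁅W.basis i, v⁆⁆ = killingForm ℂ g s (W.wt i) • v := by
  rw [← lie_lie, W.lie_basis_dual hinv, hv _ (W.wt_mem i)]

/-- Summing the trace of [e, f] over the whole string through wt j in the direction wt i gives zero.
This is a linear equation with integer coefficients between the two inner products. -/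
theorem exists_real_ratio (i j : I) (hi : W.wt i ≠ 0) :
    ∃ q : ℝ, killingForm ℂ g (W.wt j) (W.wt i) = q * killingForm ℂ g (W.wt i) (W.wt i) := by
  obtain ⟨N, hN⟩ := W.exists_bound_of_string (W.wt j) (W.wt_mem j) (W.wt_mem i) hi
  set V : ℤ → Submodule ℂ g := fun k ↦ W.weightSpace g (W.wt j + (k : ℂ) • W.wt i) with hV
  have hsum := sum_string_eq_zero (e := LieAlgebra.ad ℂ g (W.basis i))
    (f := LieAlgebra.ad ℂ g (W.dual i)) (V := V) (a := killingForm ℂ g (W.wt j) (W.wt i))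
    (b := killingForm ℂ g (W.wt i) (W.wt i)) (N := N)
    (fun k v hv ↦ by
      have h := W.lie_mem_weightSpace (W.basis_mem i) hv
      rw [add_assoc] at h
      simpa [hV, add_smul] using h)
    (fun k v hv ↦ by
      have h := W.lie_mem_weightSpace (W.dual_mem_weightSpace i) hv
      rw [add_assoc] at h
      simpa [hV, add_smul] using h)
    (fun k v hv ↦ by
      have h := W.lie_basis_lie_dual hinv i hv
      simp only [LieAlgebra.ad_apply]
      rw [h]
      simp) hN
  have hN0 : 1 ≤ N := by
    by_contra h
    have h1 := hN 0 (by simp; lia)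
    have h2 : W.basis j ∈ W.weightSpace g (W.wt j + ((0 : ℤ) : ℂ) • W.wt i) := by
      simpa using W.basis_mem j
    rw [h1, Submodule.mem_bot] at h2
    exact W.basis.ne_zero j h2
  set d : ℕ → ℕ := fun k ↦ Module.finrank ℂ (V ((k : ℤ) - N + 1))
  have hd : 0 < d (N - 1) := by
    have : V (((N - 1 : ℕ) : ℤ) - N + 1) ≠ ⊥ := by
      rw [Submodule.ne_bot_iff]
      refine ⟨W.basis j, ?_, W.basis.ne_zero j⟩
      rw [show ((N - 1 : ℕ) : ℤ) - N + 1 = 0 by lia]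
      simpa [hV] using W.basis_mem j
    rwa [Nat.pos_iff_ne_zero, Ne, Submodule.finrank_eq_zero]
  have hpos : (0 : ℝ) < ∑ k ∈ Finset.range (2 * N), (d k : ℝ) :=
    Finset.sum_pos' (fun _ _ ↦ by positivity)
      ⟨N - 1, Finset.mem_range.mpr (by lia), by exact_mod_cast hd⟩
  refine ⟨-(∑ k ∈ Finset.range (2 * N), ((k : ℝ) - N + 1) * d k)
    / ∑ k ∈ Finset.range (2 * N), (d k : ℝ), ?_⟩
  have hne : ∑ k ∈ Finset.range (2 * N), (d k : ℂ) ≠ 0 := by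
    have := hpos.ne'
    exact_mod_cast this
  push_cast
  rw [div_mul_eq_mul_div, eq_div_iff hne]
  have h1 : ∑ k ∈ Finset.range (2 * N), (killingForm ℂ g (W.wt j) (W.wt i)
      + ((k : ℂ) - N + 1) * killingForm ℂ g (W.wt i) (W.wt i)) * (d k : ℂ) = 0 := hsum
  simp_rw [add_mul _ _ ((d _ : ℕ) : ℂ), Finset.sum_add_distrib] at h1
  rw [← Finset.mul_sum] at h1
  rw [neg_mul, Finset.sum_mul, eq_neg_iff_add_eq_zero, ← h1]
  congr 1
  exact Finset.sum_congr rfl fun k _ ↦ by ring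

/-- Write (wt j, wt i) = q_j (wt i, wt i) with q_j real. The trace formula for the Killing form on
the torus gives (wt i, wt i) = 1/∑ q_j². -/
theorem exists_real_norm (i : I) (hi : W.wt i ≠ 0) :
    ∃ r : ℝ, 0 < r ∧ killingForm ℂ g (W.wt i) (W.wt i) = r := by
  choose q hq using fun j ↦ W.exists_real_ratio hinv i j hi
  have h1 := W.killingForm_wt_torus (W.wt_mem i) (W.wt_mem i)
  have hne : killingForm ℂ g (W.wt i) (W.wt i) ≠ 0 := by
    intro h
    refine hi (W.eq_zero_of_killingForm_wt (W.wt_mem i) fun j ↦ ?_)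
    rw [hq j, h, mul_zero]
  have h2 : 1 = ((∑ j, q j ^ 2 : ℝ) : ℂ) * killingForm ℂ g (W.wt i) (W.wt i) := by
    refine mul_right_cancel₀ hne ?_
    rw [one_mul]
    nth_rewrite 1 [h1]
    push_cast
    rw [Finset.sum_mul, Finset.sum_mul]
    refine Finset.sum_congr rfl fun j _ ↦ ?_
    rw [hq j]
    ring
  have h3 : ∑ j, q j ^ 2 ≠ 0 := by
    intro h
    rw [h] at h2
    simp at h2
  refine ⟨(∑ j, q j ^ 2)⁻¹, ?_, ?_⟩
  · have : 0 ≤ ∑ j, q j ^ 2 := Finset.sum_nonneg fun _ _ ↦ sq_nonneg _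
    positivity
  · rw [Complex.ofReal_inv]
    exact eq_inv_of_mul_eq_one_right h2.symm

/-- The real inner product of weights. -/
theorem killingForm_wt_wt (i j : I) :
    killingForm ℂ g (W.wt i) (W.wt j) = ((killingForm ℂ g (W.wt i) (W.wt j)).re : ℂ) := by
  by_cases hj : W.wt j = 0
  · simp [hj]
  · obtain ⟨q, hq⟩ := W.exists_real_ratio hinv j i hj
    obtain ⟨r, -, hr⟩ := W.exists_real_norm hinv j hj
    rw [hq, hr, ← Complex.ofReal_mul, Complex.ofReal_re]

theorem re_killingForm_wt_pos (i : I) (hi : W.wt i ≠ 0) :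
    0 < (killingForm ℂ g (W.wt i) (W.wt i)).re := by
  obtain ⟨r, hr, h⟩ := W.exists_real_norm hinv i hi
  rwa [h, Complex.ofReal_re]

theorem re_killingForm_wt_eq_sum (i : I) :
    (killingForm ℂ g (W.wt i) (W.wt i)).re
      = ∑ j, (killingForm ℂ g (W.wt j) (W.wt i)).re ^ 2 := by
  have h := congrArg Complex.re (W.killingForm_wt_torus (W.wt_mem i) (W.wt_mem i))
  rw [h, Complex.re_sum]
  refine Finset.sum_congr rfl fun j _ ↦ ?_
  rw [W.killingForm_wt_wt hinv j i]
  norm_cast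
  ring

/-- The trace formula sends each weight to the real vector of its inner products with all weights
and preserves inner products, so 2ab ≤ a² + b² applies coordinatewise. -/
theorem two_mul_re_killingForm_wt_le (i j : I) :
    2 * (killingForm ℂ g (W.wt i) (W.wt j)).re
      ≤ (killingForm ℂ g (W.wt i) (W.wt i)).re + (killingForm ℂ g (W.wt j) (W.wt j)).re := by
  have h : (killingForm ℂ g (W.wt i) (W.wt j)).re
      = ∑ k, (killingForm ℂ g (W.wt k) (W.wt i)).re * (killingForm ℂ g (W.wt k) (W.wt j)).re := by
    have h := congrArg Complex.re (W.killingForm_wt_torus (W.wt_mem i) (W.wt_mem j))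
    rw [h, Complex.re_sum]
    refine Finset.sum_congr rfl fun k _ ↦ ?_
    rw [W.killingForm_wt_wt hinv k i, W.killingForm_wt_wt hinv k j]
    norm_cast
  rw [h, W.re_killingForm_wt_eq_sum hinv i, W.re_killingForm_wt_eq_sum hinv j, Finset.mul_sum,
    ← Finset.sum_add_distrib]
  exact Finset.sum_le_sum fun k _ ↦ by
    linarith [two_mul_le_add_sq (killingForm ℂ g (W.wt k) (W.wt i)).re
      (killingForm ℂ g (W.wt k) (W.wt j)).re]

end Reality

end WeightBasis

/-! ### Bounds for the Casimir eigenvalues of h. -/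

namespace HomogeneousBasis

variable {g : Type u} [LieRing g] [LieAlgebra ℂ g] {θ : g →ₗ⁅ℂ⁆ g} {I : Type v} [Fintype I]
  [DecidableEq I] [FiniteDimensional ℂ g] [LieAlgebra.IsKilling ℂ g] (B : HomogeneousBasis θ I)
  (hinv : ∀ x, θ (θ x) = x) {M : Type w} [AddCommGroup M] [Module ℂ M] [LieRingModule g M]
  [LieModule ℂ g M]
include hinv

theorem sum_lie_lie_swap (v : M) :
    ∑ i, ⁅B.d 0 i, ⁅B.e 0 i, v⁆⁆ = ∑ i, ⁅B.e 0 i, ⁅B.d 0 i, v⁆⁆ :=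
  B.sum_swap hinv (LinearMap.mk₂ ℂ (fun a b : g ↦ ⁅a, ⁅b, v⁆⁆) (by simp) (by simp) (by simp)
    (by simp)) 0

/-- The Casimir element of the fixed points commutes with the fixed points. -/
theorem sum_lie_lie_lie {x : g} (hx : x ∈ grade θ 0) (v : M) :
    ∑ i, ⁅B.e 0 i, ⁅B.d 0 i, ⁅x, v⁆⁆⁆ = ⁅x, ∑ i, ⁅B.e 0 i, ⁅B.d 0 i, v⁆⁆⁆ := by
  have h := B.sum_lie_shift hinv (LinearMap.mk₂ ℂ (fun a b : g ↦ ⁅a, ⁅b, v⁆⁆) (by simp) (by simp)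
    (by simp) (by simp)) 0 0 hx
  simp only [LinearMap.mk₂_apply, zero_add] at h
  have h1 (i : I) : ⁅x, ⁅B.e 0 i, ⁅B.d 0 i, v⁆⁆⁆ = ⁅⁅x, B.e 0 i⁆, ⁅B.d 0 i, v⁆⁆
      - ⁅B.e 0 i, ⁅⁅B.d 0 i, x⁆, v⁆⁆ + ⁅B.e 0 i, ⁅B.d 0 i, ⁅x, v⁆⁆⁆ := by
    rw [leibniz_lie x, leibniz_lie x, lie_add, ← lie_skew x (B.d 0 i), neg_lie, lie_neg]
    abel
  rw [lie_sum]
  simp_rw [h1]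
  rw [Finset.sum_add_distrib, Finset.sum_sub_distrib, h, sub_self, zero_add]

theorem partialCasimir_lie {x : g} (hx : x ∈ grade θ 0) (z : g) :
    B.partialCasimir 0 ⁅x, z⁆ = ⁅x, B.partialCasimir 0 z⁆ := by
  rw [partialCasimir_apply, partialCasimir_apply, B.sum_lie_lie_lie hinv hx]

end HomogeneousBasis

namespace WeightBasis

variable {g : Type u} [LieRing g] [LieAlgebra ℂ g] {θ : g →ₗ⁅ℂ⁆ g} {I : Type v} [Fintype I]
  [DecidableEq I] [FiniteDimensional ℂ g] [LieAlgebra.IsKilling ℂ g] (W : WeightBasis θ I)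

/-- A lower bound for the eigenvalues of the Casimir operator of the fixed points on modules in
which `s` is a weight. -/
def casimirBound (s : g) : ℝ :=
  (killingForm ℂ g s s).re
    + 1 / 2 * ∑ i, if Even (W.deg i) then |(killingForm ℂ g (W.wt i) s).re| else 0

variable (hinv : ∀ x, θ (θ x) = x)
include hinv

theorem sum_killingForm_e_mul_d {s : g} (hs : s ∈ W.torus) :
    ∑ i, killingForm ℂ g s (W.e 0 i) * killingForm ℂ g s (W.d 0 i) = killingForm ℂ g s s := by
  conv_rhs => enter [2]; rw [← W.sum_d_smul_e hinv (W.torus_le hs)]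
  rw [map_sum]
  refine Finset.sum_congr rfl fun i _ ↦ ?_
  rw [map_smul, smul_eq_mul, LieModule.traceForm_comm ℂ g g (W.d 0 i), mul_comm]

/-- Take the trace of the Casimir over the weight space S. The torus contributes (s, s). For a
nonzero weight, tr(ef) and tr(fe) are nonnegative, so their sum is at least the absolute value of
their difference, |(wt i, s)| dim S. -/
theorem casimirBound_le {V : Submodule ℂ g} (hV : ∀ x ∈ grade θ 0, ∀ v ∈ V, ⁅x, v⁆ ∈ V) {c : ℂ}
    (hc : ∀ v ∈ V, W.partialCasimir 0 v = c • v) {s : g} (hs : s ∈ W.torus)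
    (hne : V ⊓ W.weightSpace g s ≠ ⊥) : W.casimirBound s ≤ c.re := by
  set S := V ⊓ W.weightSpace g s with hS
  set D : ℝ := ((Module.finrank ℂ S : ℕ) : ℝ) with hD
  have hDpos : 0 < D := by
    rw [hD]
    exact_mod_cast Nat.pos_of_ne_zero fun h ↦ hne (Submodule.finrank_eq_zero.mp h)
  let E (i : I) : Module.End ℂ g := LieAlgebra.ad ℂ g (W.e 0 i)
  let F (i : I) : Module.End ℂ g := LieAlgebra.ad ℂ g (W.d 0 i)
  have htotal : ∑ i, (relTrace S (E i ∘ₗ F i) + relTrace S (F i ∘ₗ E i))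
      = 2 * c * Module.finrank ℂ S := by
    rw [Finset.sum_add_distrib, ← map_sum, ← map_sum, ← map_add]
    refine relTrace_eq_mul fun v hv ↦ ?_
    have h1 : (∑ i, E i ∘ₗ F i) v = c • v := by
      rw [← hc v hv.1, W.partialCasimir_apply, LinearMap.sum_apply]
      rfl
    have h2 : (∑ i, F i ∘ₗ E i) v = c • v := by
      rw [← hc v hv.1, W.partialCasimir_apply, ← W.sum_lie_lie_swap hinv, LinearMap.sum_apply]
      rfl
    rw [LinearMap.add_apply, h1, h2, ← add_smul, two_mul]
  have hterm (i : I) : (2 * (killingForm ℂ g s (W.e 0 i) * killingForm ℂ g s (W.d 0 i))).re * D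
      + (if Even (W.deg i) then |(killingForm ℂ g (W.wt i) s).re| else 0) * D
      ≤ (relTrace S (E i ∘ₗ F i) + relTrace S (F i ∘ₗ E i)).re := by
    by_cases hdeg : Even (W.deg i)
    swap
    · have he : W.e 0 i = 0 := by simp [HomogeneousBasis.e, hdeg]
      have hE : E i = 0 := by simp [E, he]
      rw [if_neg hdeg, hE, he]
      simp
    have he : W.e 0 i = W.basis i := by simp [HomogeneousBasis.e, hdeg]
    have hd : W.d 0 i = W.dual i := by simp [HomogeneousBasis.d, hdeg]
    have he0 : W.basis i ∈ grade θ 0 := he ▸ W.e_mem 0 i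
    have hd0 : W.dual i ∈ grade θ 0 := hd ▸ W.d_mem hinv 0 i
    simp only [E, F, he, hd, if_pos hdeg]
    by_cases hi : W.wt i = 0
    · have hb := W.basis_mem_torus hdeg hi
      have hd := W.dual_mem_torus hinv hdeg hi
      rw [relTrace_eq_mul (c := killingForm ℂ g s (W.basis i) * killingForm ℂ g s (W.dual i))
          (fun v hv ↦ by
            simp only [LinearMap.comp_apply, LieAlgebra.ad_apply]
            rw [hv.2 _ hd, lie_smul, hv.2 _ hb, smul_smul, mul_comm]),
        relTrace_eq_mul (c := killingForm ℂ g s (W.basis i) * killingForm ℂ g s (W.dual i))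
          (fun v hv ↦ by
            simp only [LinearMap.comp_apply, LieAlgebra.ad_apply]
            rw [hv.2 _ hb, lie_smul, hv.2 _ hd, smul_smul]), ← two_mul, ← mul_assoc, ← mul_assoc, ←
              mul_assoc, hi, hD,
        ← Complex.ofReal_natCast, Complex.re_mul_ofReal]
      simp
    · obtain ⟨N, hN⟩ := W.exists_bound_of_string s hs (W.wt_mem i) hi
      set V' : ℤ → Submodule ℂ g := fun k ↦ V ⊓ W.weightSpace g (s + (k : ℂ) • W.wt i) with hV'
      have hV0 : V' 0 = S := by simp [hV', hS]
      obtain ⟨h1, h2⟩ := re_relTrace_nonneg (e := LieAlgebra.ad ℂ g (W.basis i))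
        (f := LieAlgebra.ad ℂ g (W.dual i)) (V := V') (a := killingForm ℂ g s (W.wt i))
        (b := killingForm ℂ g (W.wt i) (W.wt i)) (N := N)
        (fun k v hv ↦ by
          refine ⟨hV _ he0 _ hv.1, ?_⟩
          have h := W.lie_mem_weightSpace (W.basis_mem i) hv.2
          rw [add_assoc] at h
          simpa [add_smul] using h)
        (fun k v hv ↦ by
          refine ⟨hV _ hd0 _ hv.1, ?_⟩
          have h := W.lie_mem_weightSpace (W.dual_mem_weightSpace i) hv.2
          rw [add_assoc] at h
          simpa [add_smul] using h)
        (fun k v hv ↦ by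
          have h := W.lie_basis_lie_dual hinv i hv.2
          simp only [LieAlgebra.ad_apply]
          rw [h]
          simp) (fun j hj ↦ by simp [hV', hN j hj]) (W.re_killingForm_wt_pos hinv i hi)
      rw [hV0] at h1 h2
      have h3 : relTrace S (LieAlgebra.ad ℂ g (W.basis i) ∘ₗ LieAlgebra.ad ℂ g (W.dual i))
          - relTrace S (LieAlgebra.ad ℂ g (W.dual i) ∘ₗ LieAlgebra.ad ℂ g (W.basis i))
          = killingForm ℂ g s (W.wt i) * Module.finrank ℂ S := by
        rw [← map_sub]
        exact relTrace_eq_mul fun v hv ↦ W.lie_basis_lie_dual hinv i hv.2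
      have h4 := congrArg Complex.re h3
      rw [Complex.sub_re, ← Complex.ofReal_natCast, Complex.re_mul_ofReal, ← hD,
        LieModule.traceForm_comm] at h4
      rw [LieModule.traceForm_comm ℂ g g s (W.basis i), W.killingForm_basis_torus hi hs, zero_mul,
        mul_zero, Complex.zero_re, zero_mul, zero_add, Complex.add_re, ← abs_of_pos hDpos,
        ← abs_mul, ← h4]
      rw [abs_le]
      constructor <;> linarith
  have hsum := Finset.sum_le_sum fun i (_ : i ∈ Finset.univ) ↦ hterm i
  rw [← Complex.re_sum, htotal, ← Complex.ofReal_natCast, Complex.re_mul_ofReal, ← hD,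
    Finset.sum_add_distrib,
    ← Finset.sum_mul, ← Finset.sum_mul, ← Complex.re_sum, ← Finset.mul_sum,
    W.sum_killingForm_e_mul_d hinv hs, ← add_mul] at hsum
  have h := le_of_mul_le_mul_right hsum hDpos
  simp only [Complex.mul_re, Complex.re_ofNat, Complex.im_ofNat, zero_mul, sub_zero] at h
  rw [casimirBound]
  linarith

/-- For a vector killed by the dominant half of the root vectors, one of e f v and f e v vanishes
for each root, and the estimate of `casimirBound_le` becomes an equality. -/
theorem eq_casimirBound {M : Type w} [AddCommGroup M] [Module ℂ M] [LieRingModule g M]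
    [LieModule ℂ g M] {s : g} (hs : s ∈ W.torus)
    (hreal : ∀ i, killingForm ℂ g (W.wt i) s = ((killingForm ℂ g (W.wt i) s).re : ℂ)) {v : M}
    (hv : v ∈ W.weightSpace M s) (hv0 : v ≠ 0)
    (hpos : ∀ i, Even (W.deg i) → W.wt i ≠ 0 → 0 ≤ (killingForm ℂ g (W.wt i) s).re →
      ⁅W.basis i, v⁆ = 0)
    (hneg : ∀ i, Even (W.deg i) → W.wt i ≠ 0 → (killingForm ℂ g (W.wt i) s).re < 0 →
      ⁅W.dual i, v⁆ = 0)
    {c : ℂ} (hc : ∑ i, ⁅W.e 0 i, ⁅W.d 0 i, v⁆⁆ = c • v) : c.re = W.casimirBound s := by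
  have hterm (i : I) : ⁅W.e 0 i, ⁅W.d 0 i, v⁆⁆ + ⁅W.d 0 i, ⁅W.e 0 i, v⁆⁆
      = (2 * (killingForm ℂ g s (W.e 0 i) * killingForm ℂ g s (W.d 0 i))
        + ((if Even (W.deg i) then |(killingForm ℂ g (W.wt i) s).re| else 0 : ℝ) : ℂ)) • v := by
    by_cases hdeg : Even (W.deg i)
    swap
    · have he : W.e 0 i = 0 := by simp [HomogeneousBasis.e, hdeg]
      rw [if_neg hdeg, he]
      simp
    have he : W.e 0 i = W.basis i := by simp [HomogeneousBasis.e, hdeg]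
    have hd : W.d 0 i = W.dual i := by simp [HomogeneousBasis.d, hdeg]
    rw [if_pos hdeg, he, hd]
    by_cases hi : W.wt i = 0
    · have hb := W.basis_mem_torus hdeg hi
      have hd := W.dual_mem_torus hinv hdeg hi
      rw [hv _ hd, hv _ hb, lie_smul, lie_smul, hv _ hd, hv _ hb, hi, smul_smul, smul_smul,
        ← add_smul]
      congr 1
      simp
      ring
    · have h := W.lie_basis_lie_dual hinv i hv
      rw [LieModule.traceForm_comm, hreal] at h
      rw [LieModule.traceForm_comm ℂ g g s (W.basis i), W.killingForm_basis_torus hi hs, zero_mul,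
        mul_zero, zero_add]
      obtain h0 | h0 := le_or_gt 0 (killingForm ℂ g (W.wt i) s).re
      · rw [hpos i hdeg hi h0, lie_zero, sub_zero] at h
        rw [hpos i hdeg hi h0, lie_zero, add_zero, h, abs_of_nonneg h0]
      · rw [hneg i hdeg hi h0, lie_zero, zero_sub] at h
        rw [hneg i hdeg hi h0, lie_zero, zero_add, abs_of_neg h0, Complex.ofReal_neg, neg_smul, ← h,
          neg_neg]
  have hsum := Finset.sum_congr rfl fun i (_ : i ∈ Finset.univ) ↦ hterm i
  rw [Finset.sum_add_distrib, W.sum_lie_lie_swap hinv, hc, ← add_smul, ← Finset.sum_smul,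
    Finset.sum_add_distrib, ← Finset.mul_sum, W.sum_killingForm_e_mul_d hinv hs,
    ← Complex.ofReal_sum] at hsum
  have h := congrArg Complex.re (smul_left_injective ℂ hv0 hsum)
  simp only [Complex.add_re, Complex.mul_re, Complex.re_ofNat, Complex.im_ofNat, zero_mul, sub_zero,
    Complex.ofReal_re] at h
  rw [casimirBound]
  linarith

theorem casimirBound_odd {j : I} (hj : ¬ Even (W.deg j)) : W.casimirBound (W.wt j) ≤ 1 / 2 := by
  have h := W.casimirBound_le hinv (V := grade θ 1) (c := (1 / 2 : ℂ))
    (fun x hx v hv ↦ by simpa using lie_mem_grade hx hv)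
    (fun v hv ↦ W.partialCasimir_of_mem_one hinv 0 hv) (W.wt_mem j)
    (by
      rw [Submodule.ne_bot_iff]
      refine ⟨W.basis j, ⟨?_, W.basis_mem j⟩, W.basis.ne_zero j⟩
      rw [grade_congr (θ := θ) (i := 1) (j := W.deg j) (by grind)]
      exact W.mem j)
  norm_num at h
  norm_num
  exact h

/-- If the Casimir operator of the fixed points has an eigenvector of weight `s` in the fixed
points, then `s` is an eigenvector too. -/
theorem partialCasimir_weight {s e : g} {c : ℂ} (hs : s ∈ W.torus) (he0 : e ∈ grade θ 0)
    (he : e ∈ W.weightSpace g s) (hne : e ≠ 0) (hc : W.partialCasimir 0 e = c • e) :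
    W.partialCasimir 0 s = c • s := by
  obtain ⟨i, hi⟩ := W.exists_repr_ne_zero hne
  have hwt := W.wt_eq_of_repr_ne_zero hs he hi
  have hdeg : Even (W.deg i) := by simpa using W.even_of_repr_ne_zero hinv he0 hi
  have hf0 : W.dual i ∈ grade θ 0 := by
    rw [grade_congr (θ := θ) (i := 0) (j := W.deg i) (by simpa using hdeg)]
    exact W.dual_mem hinv i
  have hf : W.dual i ∈ W.weightSpace g (-s) := hwt ▸ W.dual_mem_weightSpace i
  have hk : killingForm ℂ g e (W.dual i) ≠ 0 := by
    rwa [LieModule.traceForm_comm, W.killingForm_dual]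
  have h1 := W.lie_eq_killingForm_smul hs he hf he0 hf0
  have h2 := W.partialCasimir_lie hinv hf0 e
  rw [hc, lie_smul, ← lie_skew, map_neg, h1, map_smul, smul_neg, neg_inj, smul_comm] at h2
  exact smul_right_injective g hk h2

theorem mul_killingForm_weight {s : g} {c : ℂ} (hs : s ∈ W.torus)
    (hc : W.partialCasimir 0 s = c • s) :
    c * killingForm ℂ g s s
      = ∑ i, if Even (W.deg i) then killingForm ℂ g (W.wt i) s ^ 2 else 0 := by
  rw [← smul_eq_mul, ← LinearMap.smul_apply, ← map_smul, ← hc, W.killingForm_partialCasimir]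
  refine Finset.sum_congr rfl fun i _ ↦ ?_
  by_cases hdeg : Even (W.deg i)
  · rw [if_pos hdeg, show W.e 0 i = W.basis i by simp [HomogeneousBasis.e, hdeg],
      show W.d 0 i = W.dual i by simp [HomogeneousBasis.d, hdeg], W.lie_basis s hs, lie_smul,
      W.lie_basis s hs, map_smul, map_smul, W.killingForm_dual_basis]
    simp [pow_two]
  · rw [if_neg hdeg, show W.e 0 i = 0 by simp [HomogeneousBasis.e, hdeg]]
    simp

/-- Choose a Casimir eigenvector in h of weight s = wt j, with eigenvalue c. Bracketing with an
opposite root vector shows that s is an eigenvector too, so c (s, s) is the sum of (wt i, s)² over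
the even i only. The sum over all i is (s, s), whence c ≤ 1. -/
theorem casimirBound_even {j : I} (hj : Even (W.deg j)) : W.casimirBound (W.wt j) ≤ 1 := by
  by_cases hwt : W.wt j = 0
  · simp [casimirBound, hwt]
  have hj0 : W.basis j ∈ grade θ 0 := by
    rw [grade_congr (θ := θ) (i := 0) (j := W.deg j) (by simpa using hj)]
    exact W.mem j
  have hstab : ∀ v ∈ grade θ 0 ⊓ W.weightSpace g (W.wt j),
      W.partialCasimir 0 v ∈ grade θ 0 ⊓ W.weightSpace g (W.wt j) := by
    rintro v ⟨h1, h2⟩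
    refine ⟨W.partialCasimir_mem hinv h1, fun x hx ↦ ?_⟩
    rw [← W.partialCasimir_lie hinv (W.torus_le hx), h2 x hx, map_smul]
  have : Nontrivial ↥(grade θ 0 ⊓ W.weightSpace g (W.wt j)) :=
    ⟨⟨W.basis j, hj0, W.basis_mem j⟩, 0, fun h ↦ W.basis.ne_zero j (congrArg Subtype.val h)⟩
  obtain ⟨c, hc⟩ := Module.End.exists_eigenvalue ((W.partialCasimir 0).restrict hstab)
  obtain ⟨e, he⟩ := hc.exists_hasEigenvector
  have hce : W.partialCasimir 0 (e : g) = c • (e : g) := congrArg Subtype.val he.apply_eq_smul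
  have hne : (e : g) ≠ 0 := fun h ↦ he.2 (Subtype.ext h)
  let V : Submodule ℂ g := grade θ 0 ⊓ Module.End.eigenspace (W.partialCasimir 0) c
  have hbound := W.casimirBound_le hinv (V := V) (c := c)
    (fun x hx v hv ↦ ⟨by simpa using lie_mem_grade hx hv.1, by
      rw [SetLike.mem_coe, Module.End.mem_eigenspace_iff, W.partialCasimir_lie hinv hx,
        Module.End.mem_eigenspace_iff.mp hv.2, lie_smul]⟩)
    (fun v hv ↦ Module.End.mem_eigenspace_iff.mp hv.2) (W.wt_mem j)
    (by
      rw [Submodule.ne_bot_iff]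
      exact ⟨e, ⟨⟨e.2.1, Module.End.mem_eigenspace_iff.mpr hce⟩, e.2.2⟩, hne⟩)
  refine hbound.trans ?_
  have h1 := W.mul_killingForm_weight hinv (W.wt_mem j)
    (W.partialCasimir_weight hinv (W.wt_mem j) e.2.1 e.2.2 hne hce)
  have h2 := congrArg Complex.re h1
  rw [W.killingForm_wt_wt hinv j j, Complex.re_mul_ofReal, Complex.re_sum] at h2
  have h3 : ∑ i, (if Even (W.deg i) then killingForm ℂ g (W.wt i) (W.wt j) ^ 2 else 0).re
      ≤ (killingForm ℂ g (W.wt j) (W.wt j)).re := by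
    rw [W.re_killingForm_wt_eq_sum hinv j]
    refine Finset.sum_le_sum fun i _ ↦ ?_
    split_ifs
    · rw [W.killingForm_wt_wt hinv i j, ← Complex.ofReal_pow, Complex.ofReal_re, Complex.ofReal_re]
    · simpa using sq_nonneg _
  rw [← h2] at h3
  exact le_of_mul_le_mul_right (by linarith) (W.re_killingForm_wt_pos hinv j hwt)

end WeightBasis

/-! ### Norms of weights in rank at least two. -/

namespace WeightBasis

variable {g : Type u} [LieRing g] [LieAlgebra ℂ g] {θ : g →ₗ⁅ℂ⁆ g} {I : Type v} [Fintype I]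
  [DecidableEq I] [FiniteDimensional ℂ g] [LieAlgebra.IsKilling ℂ g] (W : WeightBasis θ I)

theorem repr_eq_zero_of_mem_torus {x : g} (hx : x ∈ W.torus) {i : I} (hi : W.wt i ≠ 0) :
    W.basis.repr x i = 0 := by
  rw [← W.killingForm_dual, W.killingForm_dual_torus hi hx]

theorem repr_pow_lie {x : g} (hx : x ∈ W.torus) (n : ℕ) (z : g) (i : I) :
    W.basis.repr ((LieAlgebra.ad ℂ g x ^ n) z) i
      = killingForm ℂ g (W.wt i) x ^ n * W.basis.repr z i := by
  induction n with
  | zero => simp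
  | succ n ih =>
    rw [pow_succ', Module.End.mul_apply, LieAlgebra.ad_apply, W.repr_lie hx, ih]
    ring

/-- Brackets of weight vectors whose coordinates are forced to a single position. -/
theorem lie_basis_basis_eq_smul {k j : I}
    (h : ∀ l, W.wt l = W.wt j + W.wt k → l = j) :
    ⁅W.basis k, W.basis j⁆ = W.basis.repr ⁅W.basis k, W.basis j⁆ j • W.basis j := by
  have hw := W.lie_mem_weightSpace (W.basis_mem k) (W.basis_mem j)
  conv_lhs => rw [← W.basis.sum_repr ⁅W.basis k, W.basis j⁆]
  refine Finset.sum_eq_single j (fun l _ hl ↦ ?_) (by simp)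
  rw [not_ne_iff.mp (mt (fun hne ↦ h l
    (W.wt_eq_of_repr_ne_zero (add_mem (W.wt_mem j) (W.wt_mem k)) hw hne)) hl), zero_smul]

variable (hinv : ∀ x, θ (θ x) = x)
include hinv

theorem exists_neg_wt (j : I) : ∃ i, W.wt i = -W.wt j ∧ Even (W.deg i + W.deg j) := by
  obtain ⟨i, hi⟩ := W.exists_repr_ne_zero (W.dual.ne_zero j)
  exact ⟨i, W.wt_eq_of_repr_ne_zero (neg_mem (W.wt_mem j)) (W.dual_mem_weightSpace j) hi,
    W.even_of_repr_ne_zero hinv (W.dual_mem hinv j) hi⟩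

/-- In rank at least two, all weights have norm less than one half. -/
theorem re_killingForm_wt_lt [LieAlgebra.IsSimple ℂ g] (hrank : 2 ≤ LieAlgebra.rank ℂ g) (j : I) :
    (killingForm ℂ g (W.wt j) (W.wt j)).re < 1 / 2 := by
  by_cases hj : W.wt j = 0
  · simp [hj]
  have hpos := W.re_killingForm_wt_pos hinv j hj
  obtain ⟨i, hi, hdeg⟩ := W.exists_neg_wt hinv j
  have hij : i ≠ j := by
    rintro rfl
    have h : (2 : ℂ) • W.wt i = 0 := by rw [two_smul, eq_neg_iff_add_eq_zero.mp hi]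
    exact hj (by simpa using h)
  set s := W.wt j with hs
  set r := (killingForm ℂ g s s).re with hr
  have hrr : killingForm ℂ g s s = r := W.killingForm_wt_wt hinv j j
  have hmem : s ∈ W.torus := W.wt_mem j
  have hsum : r = ∑ k, (killingForm ℂ g (W.wt k) s).re ^ 2 := W.re_killingForm_wt_eq_sum hinv j
  rw [← Finset.add_sum_erase _ _ (Finset.mem_univ j), ← Finset.add_sum_erase _ _
    (Finset.mem_erase.mpr ⟨hij, Finset.mem_univ i⟩), hi, ← hs, map_neg, LinearMap.neg_apply,
    Complex.neg_re, ← hr] at hsum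
  have hrest : 0 ≤ ∑ k ∈ (Finset.univ.erase j).erase i, (killingForm ℂ g (W.wt k) s).re ^ 2 :=
    Finset.sum_nonneg fun _ _ ↦ sq_nonneg _
  by_contra! hlt
  -- The indices j and i, of weights s and -s, contribute 2r² to the sum r of squares. So r ≤ 1/2,
  -- and in the case of equality all other weights are orthogonal to s.
  have hr2 : r = 1 / 2 := by nlinarith
  have hzero (k : I) (hkj : k ≠ j) (hki : k ≠ i) : killingForm ℂ g (W.wt k) s = 0 := by
    have h0 : ∑ k ∈ (Finset.univ.erase j).erase i, (killingForm ℂ g (W.wt k) s).re ^ 2 = 0 := by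
      rw [hr2] at hsum
      linarith
    have h := (Finset.sum_eq_zero_iff_of_nonneg fun _ _ ↦ sq_nonneg _).mp h0 k
      (by simp [hkj, hki])
    rw [W.killingForm_wt_wt hinv k j, ← hs, pow_eq_zero_iff two_ne_zero |>.mp h,
      Complex.ofReal_zero]
  have hKi : killingForm ℂ g (W.wt i) s = -r := by rw [hi, map_neg, LinearMap.neg_apply, hrr]
  have hr0 : (r : ℂ) ≠ 0 := by exact_mod_cast hpos.ne'
  have hcj (k : I) (hkj : k ≠ j) (hki : k ≠ i) (l : I) (hl : W.wt l = W.wt j + W.wt k) : l = j := by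
    have h : killingForm ℂ g (W.wt l) s = r := by
      rw [hl, map_add, LinearMap.add_apply, hzero k hkj hki, add_zero, ← hs, hrr]
    by_contra hlj
    by_cases hli : l = i
    · rw [hli, hKi] at h
      exact hr0 (neg_eq_self.mp h)
    · rw [hzero l hlj hli] at h
      exact hr0 h.symm
  have hci (k : I) (hkj : k ≠ j) (hki : k ≠ i) (l : I) (hl : W.wt l = W.wt i + W.wt k) : l = i := by
    have h : killingForm ℂ g (W.wt l) s = -r := by
      rw [hl, map_add, LinearMap.add_apply, hzero k hkj hki, add_zero, hKi]
    by_contra hli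
    by_cases hlj : l = j
    · rw [hlj, ← hs, hrr] at h
      exact hr0 (self_eq_neg.mp h)
    · rw [hzero l hlj hli] at h
      exact hr0 (neg_eq_zero.mp h.symm)
  -- In the extremal case this copy of sl_2 is an ideal, hence all of g.
  set S : Submodule ℂ g := Submodule.span ℂ {W.basis j, W.basis i, s} with hS
  have hjS : W.basis j ∈ S := Submodule.subset_span (by simp)
  have hiS : W.basis i ∈ S := Submodule.subset_span (by simp)
  have hsS : s ∈ S := Submodule.subset_span (by simp)
  have hbi : W.basis i ∈ grade θ (W.deg j) := grade_congr (θ := θ) hdeg ▸ W.mem i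
  have hji : ⁅W.basis j, W.basis i⁆ ∈ S := by
    have h := W.lie_eq_killingForm_smul hmem (W.basis_mem j) (hi ▸ W.basis_mem i) (W.mem j) hbi
    rw [h]
    exact S.smul_mem _ hsS
  have hstab : ∀ k, ∀ z ∈ S, ⁅W.basis k, z⁆ ∈ S := by
    intro k
    suffices S ≤ S.comap (LieAlgebra.ad ℂ g (W.basis k)) from fun z hz ↦ this hz
    rw [hS, Submodule.span_le, ← hS]
    rintro z (rfl | rfl | rfl)
    · change ⁅W.basis k, W.basis j⁆ ∈ S
      by_cases hkj : k = j
      · rw [hkj, lie_self]; exact S.zero_mem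
      by_cases hki : k = i
      · rw [hki, ← lie_skew]; exact S.neg_mem hji
      rw [W.lie_basis_basis_eq_smul (hcj k hkj hki)]
      exact S.smul_mem _ hjS
    · change ⁅W.basis k, W.basis i⁆ ∈ S
      by_cases hkj : k = j
      · rw [hkj]; exact hji
      by_cases hki : k = i
      · rw [hki, lie_self]; exact S.zero_mem
      rw [W.lie_basis_basis_eq_smul (hci k hkj hki)]
      exact S.smul_mem _ hiS
    · change ⁅W.basis k, s⁆ ∈ S
      rw [← lie_skew, W.lie_basis s hmem]
      refine S.neg_mem ?_
      by_cases hkj : k = j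
      · rw [hkj]; exact S.smul_mem _ hjS
      by_cases hki : k = i
      · rw [hki]; exact S.smul_mem _ hiS
      rw [hzero k hkj hki, zero_smul]
      exact S.zero_mem
  let J : LieIdeal ℂ g :=
    { S with
      lie_mem := by
        intro x z hz
        change ⁅x, z⁆ ∈ S
        rw [← W.basis.sum_repr x, sum_lie]
        refine S.sum_mem fun k _ ↦ ?_
        rw [smul_lie]
        exact S.smul_mem _ (hstab k z hz) }
  have hJ : J = ⊤ := by
    refine (LieAlgebra.IsSimple.eq_bot_or_eq_top J).resolve_left fun hbot ↦ ?_
    have : W.basis j ∈ J := hjS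
    rw [hbot, LieSubmodule.mem_bot] at this
    exact W.basis.ne_zero j this
  -- The generalized null space of ad s is then the line through s, and its dimension bounds the
  -- rank.
  have hengel : (LieSubalgebra.engel ℂ s).toSubmodule ≤ Submodule.span ℂ {s} := by
    intro z hz
    obtain ⟨n, hn⟩ := (LieSubalgebra.mem_engel_iff ℂ s z).mp hz
    have hcoord (k : I) (hk : killingForm ℂ g (W.wt k) s ≠ 0) : W.basis.repr z k = 0 := by
      have h := W.repr_pow_lie hmem n z k
      rw [hn, map_zero, Finsupp.zero_apply] at h
      exact (mul_eq_zero.mp h.symm).resolve_left (pow_ne_zero n hk)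
    have hzS : z ∈ S := (hJ ▸ LieSubmodule.mem_top z : z ∈ J)
    obtain ⟨a, b, c, rfl⟩ := Submodule.mem_span_triple.mp hzS
    have h1 := hcoord j (by rw [← hs, hrr]; exact hr0)
    have h2 := hcoord i (by rw [hKi]; exact neg_ne_zero.mpr hr0)
    have hi0 : W.wt i ≠ 0 := by rw [hi]; exact neg_ne_zero.mpr hj
    simp [W.repr_eq_zero_of_mem_torus hmem hj, hij] at h1
    simp [W.repr_eq_zero_of_mem_torus hmem hi0, hij.symm] at h2
    rw [h1, h2, zero_smul, zero_smul, zero_add, zero_add]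
    exact Submodule.smul_mem _ _ (Submodule.mem_span_singleton_self s)
  have h1 := LieAlgebra.rank_le_finrank_engel ℂ s
  have h2 := Submodule.finrank_mono hengel
  have h3 := finrank_span_singleton (K := ℂ) hj
  have h4 : Module.finrank ℂ (LieSubalgebra.engel ℂ s)
    = Module.finrank ℂ (LieSubalgebra.engel ℂ s).toSubmodule := rfl
  lia

end WeightBasis

/-! ### Excluding Casimir eigenvalues on tensor products and on h. -/

namespace WeightBasis

variable {g : Type u} [LieRing g] [LieAlgebra ℂ g] {θ : g →ₗ⁅ℂ⁆ g} {I : Type v} [Fintype I]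
  [DecidableEq I] [FiniteDimensional ℂ g] [LieAlgebra.IsKilling ℂ g] (W : WeightBasis θ I)

/-- The basis of the tensor square given by the tensor products of weight vectors. -/
def tensorBasis : Module.Basis (I × I) ℂ (g ⊗[ℂ] g) := W.basis.tensorProduct W.basis

theorem tensorBasis_repr_tmul (y z : g) (i j : I) :
    W.tensorBasis.repr (y ⊗ₜ z) (i, j) = W.basis.repr y i * W.basis.repr z j := by
  simp [tensorBasis, Module.Basis.tensorProduct_repr_tmul_apply, mul_comm]

theorem tensorBasis_repr_lie {x : g} (hx : x ∈ W.torus) (w : g ⊗[ℂ] g) (i j : I) :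
    W.tensorBasis.repr ⁅x, w⁆ (i, j)
      = killingForm ℂ g (W.wt i + W.wt j) x * W.tensorBasis.repr w (i, j) := by
  induction w using TensorProduct.induction_on with
  | zero => simp
  | tmul y z =>
    rw [TensorProduct.LieModule.lie_tmul_right, map_add, Finsupp.add_apply, tensorBasis_repr_tmul,
      tensorBasis_repr_tmul, tensorBasis_repr_tmul, W.repr_lie hx, W.repr_lie hx, map_add,
      LinearMap.add_apply]
    ring
  | add a b ha hb =>
    rw [lie_add, map_add W.tensorBasis.repr, map_add W.tensorBasis.repr, Finsupp.add_apply,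
      Finsupp.add_apply, ha, hb, mul_add]

theorem wt_add_wt_eq_of_repr_ne_zero {s : g} {w : g ⊗[ℂ] g} (hs : s ∈ W.torus)
    (hw : w ∈ W.weightSpace (g ⊗[ℂ] g) s) {i j : I} (hij : W.tensorBasis.repr w (i, j) ≠ 0) :
    W.wt i + W.wt j = s := by
  refine W.eq_of_killingForm_torus (add_mem (W.wt_mem i) (W.wt_mem j)) hs fun x hx ↦ ?_
  have h := W.tensorBasis_repr_lie hx w i j
  rw [hw x hx, map_smul, Finsupp.smul_apply, smul_eq_mul] at h
  exact (mul_right_cancel₀ hij h).symm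

theorem mem_weightSpace_of_repr_ne_zero {w : g ⊗[ℂ] g}
    (hw : ∀ x ∈ W.torus, ∃ c : ℂ, ⁅x, w⁆ = c • w) {i j : I}
    (hij : W.tensorBasis.repr w (i, j) ≠ 0) :
    w ∈ W.weightSpace (g ⊗[ℂ] g) (W.wt i + W.wt j) := by
  intro x hx
  obtain ⟨c, hc⟩ := hw x hx
  have h := W.tensorBasis_repr_lie hx w i j
  rw [hc, map_smul, Finsupp.smul_apply, smul_eq_mul] at h
  rw [hc, mul_right_cancel₀ hij h]

theorem exists_tensorBasis_repr_ne_zero {w : g ⊗[ℂ] g} (hw : w ≠ 0) :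
    ∃ i j, W.tensorBasis.repr w (i, j) ≠ 0 := by
  by_contra! h
  exact hw (W.tensorBasis.ext_elem fun ⟨i, j⟩ ↦ by rw [h i j, map_zero, Finsupp.zero_apply])

theorem lie_mem_gradeTensor {k l : ℕ} {x : g} (hx : x ∈ grade θ 0) {w : g ⊗[ℂ] g}
    (hw : w ∈ gradeTensor θ k l) : ⁅x, w⁆ ∈ gradeTensor θ k l := by
  suffices gradeTensor θ k l ≤ (gradeTensor θ k l).comap
    (LieModule.toEnd ℂ g (g ⊗[ℂ] g) x) from this hw
  refine gradeTensor_le fun y hy z hz ↦ ?_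
  rw [Submodule.mem_comap, LieModule.toEnd_apply_apply, TensorProduct.LieModule.lie_tmul_right]
  exact add_mem (tmul_mem_gradeTensor (by simpa using lie_mem_grade hx hy) hz)
    (tmul_mem_gradeTensor hy (by simpa using lie_mem_grade hx hz))

theorem casimirBound_add_le (s t : g) :
    W.casimirBound (s + t)
      ≤ W.casimirBound s + W.casimirBound t + 2 * (killingForm ℂ g s t).re := by
  have h1 : (∑ i, if Even (W.deg i) then |(killingForm ℂ g (W.wt i) (s + t)).re| else 0)
      ≤ (∑ i, if Even (W.deg i) then |(killingForm ℂ g (W.wt i) s).re| else 0)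
        + ∑ i, if Even (W.deg i) then |(killingForm ℂ g (W.wt i) t).re| else 0 := by
    rw [← Finset.sum_add_distrib]
    refine Finset.sum_le_sum fun i _ ↦ ?_
    split_ifs
    · rw [map_add, Complex.add_re]
      exact abs_add_le _ _
    · simp
  have h2 : (killingForm ℂ g (s + t) (s + t)).re = (killingForm ℂ g s s).re
      + (killingForm ℂ g t t).re + 2 * (killingForm ℂ g s t).re := by
    simp only [map_add, LinearMap.add_apply, Complex.add_re]
    rw [LieModule.traceForm_comm ℂ g g t s]
    ring
  unfold casimirBound
  linarith

variable (hinv : ∀ x, θ (θ x) = x)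
include hinv

theorem even_of_tensorBasis_repr_ne_zero {k l : ℕ} {w : g ⊗[ℂ] g} (hw : w ∈ gradeTensor θ k l)
    {i j : I} (hij : W.tensorBasis.repr w (i, j) ≠ 0) :
    Even (W.deg i + k) ∧ Even (W.deg j + l) := by
  by_contra hodd
  suffices gradeTensor θ k l ≤ LinearMap.ker (W.tensorBasis.coord (i, j)) from hij (this hw)
  refine gradeTensor_le fun y hy z hz ↦ ?_
  rw [LinearMap.mem_ker, Module.Basis.coord_apply, tensorBasis_repr_tmul, mul_eq_zero]
  by_contra! hne
  exact hodd ⟨W.even_of_repr_ne_zero hinv hy hne.1, W.even_of_repr_ne_zero hinv hz hne.2⟩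

/-- If the Casimir operator of the fixed points has the eigenvalue `c` on a product of two
homogeneous components, then `c` is attained by the bound at a sum of two weights. -/
theorem exists_eq_casimirBound {k l : ℕ} {c : ℂ} {w : g ⊗[ℂ] g} (hw : w ∈ gradeTensor θ k l)
    (hc : W.tensorCasimir w = c • w) (hw0 : w ≠ 0) :
    ∃ i j, Even (W.deg i + k) ∧ Even (W.deg j + l) ∧
      c.re = W.casimirBound (W.wt i + W.wt j) := by
  classical
  let U : Submodule ℂ (g ⊗[ℂ] g) := gradeTensor θ k l ⊓ Module.End.eigenspace W.tensorCasimir c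
  have hU : ∀ x ∈ grade θ 0, ∀ v ∈ U, ⁅x, v⁆ ∈ U := by
    rintro x hx v ⟨h1, h2⟩
    refine ⟨lie_mem_gradeTensor hx h1, ?_⟩
    rw [SetLike.mem_coe, Module.End.mem_eigenspace_iff] at h2 ⊢
    rw [W.tensorCasimir_apply, W.sum_lie_lie_lie hinv hx, ← W.tensorCasimir_apply, h2, lie_smul]
  let P : Finset (I × I) := Finset.univ.filter fun p ↦
    ∃ v ∈ U, v ≠ 0 ∧ v ∈ W.weightSpace (g ⊗[ℂ] g) (W.wt p.1 + W.wt p.2)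
      ∧ Even (W.deg p.1 + k) ∧ Even (W.deg p.2 + l)
  have hP : P.Nonempty := by
    obtain ⟨v, hvU, hv0, hv⟩ := W.exists_weightVector (V := U)
      ((Submodule.ne_bot_iff _).mpr ⟨w, ⟨hw, Module.End.mem_eigenspace_iff.mpr hc⟩, hw0⟩)
      fun x hx v hv ↦ hU x (W.torus_le hx) v hv
    obtain ⟨i, j, hij⟩ := W.exists_tensorBasis_repr_ne_zero hv0
    refine ⟨(i, j), Finset.mem_filter.mpr ⟨Finset.mem_univ _, v, hvU, hv0,
      W.mem_weightSpace_of_repr_ne_zero hv hij, ?_⟩⟩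
    exact W.even_of_tensorBasis_repr_ne_zero hinv hvU.1 hij
  -- A weight of maximal norm in the eigenspace serves as highest weight: adding a nonzero weight
  -- that makes a nonnegative inner product with Λ would increase the norm.
  obtain ⟨⟨i, j⟩, hij, hmax⟩ := P.exists_max_image
    (fun p ↦ (killingForm ℂ g (W.wt p.1 + W.wt p.2) (W.wt p.1 + W.wt p.2)).re) hP
  obtain ⟨-, v, hvU, hv0, hv, hi, hj⟩ := Finset.mem_filter.mp hij
  dsimp only at hv hi hj hmax
  set Λ := W.wt i + W.wt j with hΛ
  have hΛmem : Λ ∈ W.torus := add_mem (W.wt_mem i) (W.wt_mem j)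
  have hzero {x s : g} (hx : x ∈ grade θ 0) (hs : s ∈ W.torus) (hxs : x ∈ W.weightSpace g s)
      (hlt : 0 < 2 * (killingForm ℂ g s Λ).re + (killingForm ℂ g s s).re) : ⁅x, v⁆ = 0 := by
    by_contra hne
    have h1 := W.lie_mem_weightSpace hxs hv
    obtain ⟨i', j', hij'⟩ := W.exists_tensorBasis_repr_ne_zero hne
    have h2 := W.wt_add_wt_eq_of_repr_ne_zero (add_mem hΛmem hs) h1 hij'
    have h3 := hmax (i', j') (Finset.mem_filter.mpr ⟨Finset.mem_univ _, _, hU x hx v hvU, hne,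
      by rw [h2]; exact h1, W.even_of_tensorBasis_repr_ne_zero hinv (hU x hx v hvU).1 hij'⟩)
    dsimp only at h3
    rw [h2] at h3
    simp only [map_add, LinearMap.add_apply, Complex.add_re] at h3
    rw [LieModule.traceForm_comm ℂ g g Λ s] at h3
    linarith
  have heven {m : I} (hm : Even (W.deg m)) : grade θ (W.deg m) = grade θ 0 :=
    grade_congr (by simpa using hm)
  refine ⟨i, j, hi, hj, W.eq_casimirBound hinv hΛmem (fun m ↦ ?_) hv hv0
    (fun m hm hm0 h ↦ hzero (heven hm ▸ W.mem m) (W.wt_mem m) (W.basis_mem m) ?_)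
    (fun m hm hm0 h ↦ hzero (heven hm ▸ W.dual_mem hinv m) (neg_mem (W.wt_mem m))
      (W.dual_mem_weightSpace m) ?_) ?_⟩
  · rw [hΛ, map_add, W.killingForm_wt_wt hinv m i, W.killingForm_wt_wt hinv m j]
    simp
  · linarith [W.re_killingForm_wt_pos hinv m hm0]
  · simp only [map_neg, LinearMap.neg_apply, neg_neg, Complex.neg_re]
    linarith [W.re_killingForm_wt_pos hinv m hm0]
  · rw [← W.tensorCasimir_apply]
    exact Module.End.mem_eigenspace_iff.mp hvU.2

/-- The eigenvalue is less than 1/2 + 1/2 + 1 if g_{n+1} = m, and less than 1/2 + 1 + 1 if g_{n+1} =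
h. In the second case n is odd, so n ≥ 3 and (n+2)/2 ≥ 5/2. -/
theorem eq_zero_of_tensorCasimir [LieAlgebra.IsSimple ℂ g] (hrank : 2 ≤ LieAlgebra.rank ℂ g)
    {n : ℕ} (hn : 2 ≤ n) {w : g ⊗[ℂ] g} (hw : w ∈ gradeTensor θ 1 (n + 1))
    (hc : W.tensorCasimir w = ((n + 2 : ℕ) / 2 : ℂ) • w) : w = 0 := by
  by_contra hw0
  obtain ⟨i, j, hi, hj, h⟩ := W.exists_eq_casimirBound hinv hw hc hw0
  have h1 := W.casimirBound_add_le (W.wt i) (W.wt j)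
  have h2 := W.two_mul_re_killingForm_wt_le hinv i j
  have h3 := W.re_killingForm_wt_lt hinv hrank i
  have h4 := W.re_killingForm_wt_lt hinv hrank j
  have h5 := W.casimirBound_odd hinv (j := i) (by grind)
  have h6 : ((n + 2 : ℕ) / 2 : ℂ).re = (n + 2) / 2 := by
    rw [show ((n + 2 : ℕ) / 2 : ℂ) = (((n + 2) / 2 : ℝ) : ℂ) by push_cast; ring, Complex.ofReal_re]
  rw [h6] at h
  have hn' : (2 : ℝ) ≤ n := by exact_mod_cast hn
  by_cases hj' : Even (W.deg j)
  · have h7 := W.casimirBound_even hinv hj'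
    have hn3 : 3 ≤ n := by
      by_contra
      obtain rfl : n = 2 := by lia
      grind
    have hn3' : (3 : ℝ) ≤ n := by exact_mod_cast hn3
    linarith
  · have h7 := W.casimirBound_odd hinv hj'
    linarith

/-- For s = wt i, the sum of (wt j, s)² over even j already equals (s, s), the sum over all j. So
the weights of m vanish on s, and s centralizes m, hence [m, m] = h, hence g. -/
theorem eq_zero_of_partialCasimir_weight [LieAlgebra.IsSimple ℂ g] (hid : ∃ x, θ x ≠ x) {i : I}
    (hc : W.partialCasimir 0 (W.wt i) = W.wt i) : W.wt i = 0 := by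
  have h1 := W.mul_killingForm_weight hinv (W.wt_mem i) (c := 1) (by rw [hc, one_smul])
  have h2 := W.killingForm_wt_torus (W.wt_mem i) (W.wt_mem i)
  rw [one_mul, h2] at h1
  have h3 : ∑ j, (if Even (W.deg j) then 0 else (killingForm ℂ g (W.wt j) (W.wt i)).re ^ 2) = 0 :=
      by
    have h := congrArg Complex.re (sub_eq_zero.mpr h1)
    rw [← Finset.sum_sub_distrib, Complex.re_sum, Complex.zero_re] at h
    refine Eq.trans (Finset.sum_congr rfl fun j _ ↦ ?_) h
    rw [W.killingForm_wt_wt hinv j i]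
    split_ifs
    · rw [pow_two, sub_self, Complex.zero_re]
    · rw [sub_zero, ← Complex.ofReal_mul, Complex.ofReal_re, Complex.ofReal_re, pow_two]
  have h4 (j : I) (hj : ¬ Even (W.deg j)) : killingForm ℂ g (W.wt j) (W.wt i) = 0 := by
    have h := (Finset.sum_eq_zero_iff_of_nonneg fun j _ ↦ by
      split_ifs <;> positivity).mp h3 j (Finset.mem_univ j)
    rw [if_neg hj, pow_eq_zero_iff two_ne_zero] at h
    rw [W.killingForm_wt_wt hinv j i, h, Complex.ofReal_zero]
  have h5 : ∀ y ∈ grade θ 1, ⁅W.wt i, y⁆ = 0 := by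
    intro y hy
    rw [← W.basis.sum_repr y, lie_sum]
    refine Finset.sum_eq_zero fun j _ ↦ ?_
    by_cases hj : W.basis.repr y j = 0
    · rw [hj, zero_smul, lie_zero]
    · have := W.even_of_repr_ne_zero hinv hy hj
      rw [lie_smul, W.lie_basis _ (W.wt_mem i), h4 j (by grind), zero_smul, smul_zero]
  have h6 : ∀ x ∈ grade θ 0, ⁅W.wt i, x⁆ = 0 := by
    suffices grade θ 0 ≤ LinearMap.ker (LieAlgebra.ad ℂ g (W.wt i) : g →ₗ[ℂ] g) from
      fun x hx ↦ this hx
    refine (grade_zero_le_bracketSpan hinv hid).trans (bracketSpan_le fun y hy z hz ↦ ?_)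
    rw [LinearMap.mem_ker, LieAlgebra.ad_apply, leibniz_lie, h5 y hy, h5 z hz]
    simp
  refine ad_injective fun z ↦ ?_
  obtain ⟨a, ha, b, hb, rfl⟩ := exists_grade_decomposition hinv z
  rw [lie_add, h6 a ha, h5 b hb, zero_lie, add_zero]

/-- In the eigenspace V of eigenvalue 1 in h, weight vectors have weight zero by the previous lemma,
so V meets the torus. The proof shows that such an element e is central in h; then C_0 e = 0,
against C_0 e = e. -/
theorem eq_zero_of_partialCasimir [LieAlgebra.IsSimple ℂ g] (hid : ∃ x, θ x ≠ x) {x : g}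
    (hx : x ∈ grade θ 0) (hc : W.partialCasimir 0 x = x) : x = 0 := by
  by_contra hx0
  let V : Submodule ℂ g := grade θ 0 ⊓ Module.End.eigenspace (W.partialCasimir 0) 1
  have hV : ∀ a ∈ grade θ 0, ∀ v ∈ V, ⁅a, v⁆ ∈ V := by
    rintro a ha v ⟨h1, h2⟩
    refine ⟨by simpa using lie_mem_grade ha h1, ?_⟩
    rw [SetLike.mem_coe, Module.End.mem_eigenspace_iff] at h2 ⊢
    rw [W.partialCasimir_lie hinv ha, h2, lie_smul]
  have hnone : ∀ i, ∀ v ∈ V, v ∈ W.weightSpace g (W.wt i) → W.wt i ≠ 0 → v = 0 := by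
    intro i v hvV hv hi
    by_contra hv0
    have h := W.partialCasimir_weight hinv (W.wt_mem i) hvV.1 hv hv0
      (Module.End.mem_eigenspace_iff.mp hvV.2)
    rw [one_smul] at h
    exact hi (W.eq_zero_of_partialCasimir_weight hinv hid h)
  obtain ⟨e, heV, he0, he⟩ := W.exists_weightVector (V := V)
    ((Submodule.ne_bot_iff _).mpr ⟨x, ⟨hx, Module.End.mem_eigenspace_iff.mpr (by rwa [one_smul])⟩,
      hx0⟩) fun a ha v hv ↦ hV a (W.torus_le ha) v hv
  obtain ⟨i, hi⟩ := W.exists_repr_ne_zero he0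
  have hei : e ∈ W.weightSpace g (W.wt i) := by
    intro a ha
    obtain ⟨c, hc⟩ := he a ha
    have h := W.repr_lie ha e i
    rw [hc, map_smul, Finsupp.smul_apply, smul_eq_mul] at h
    rw [hc, mul_right_cancel₀ hi h]
  have hi0 : W.wt i = 0 := by
    by_contra hne
    exact he0 (hnone i e heV hei hne)
  have het : e ∈ W.torus := W.mem_torus e heV.1 fun a ha ↦ by
    rw [hei a ha, hi0, map_zero, LinearMap.zero_apply, zero_smul]
  -- A nonzero bracket of e with a root vector would put that root vector, of nonzero weight, into
  -- V.
  have hcent : ∀ j, Even (W.deg j) → ⁅e, W.basis j⁆ = 0 := by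
    intro j hj
    have hj0 : W.basis j ∈ grade θ 0 := by
      rw [grade_congr (θ := θ) (i := 0) (j := W.deg j) (by simpa using hj)]
      exact W.mem j
    rw [W.lie_basis e het]
    by_cases hK : killingForm ℂ g (W.wt j) e = 0
    · rw [hK, zero_smul]
    exfalso
    have h1 := hV _ hj0 e heV
    rw [← lie_skew, W.lie_basis e het, ← neg_smul] at h1
    have h2 := (V.smul_mem_iff (neg_ne_zero.mpr hK)).mp h1
    refine W.basis.ne_zero j (hnone j _ h2 (W.basis_mem j) fun h ↦ hK ?_)
    rw [h, map_zero, LinearMap.zero_apply]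
  have hzero : W.partialCasimir 0 e = 0 := by
    rw [W.partialCasimir_apply, ← W.sum_lie_lie_swap hinv]
    refine Finset.sum_eq_zero fun j _ ↦ ?_
    unfold HomogeneousBasis.e
    split_ifs with h
    · rw [← lie_skew (W.basis j), hcent j (by simpa using h), neg_zero, lie_zero]
    · rw [zero_lie, lie_zero]
  have h := Module.End.mem_eigenspace_iff.mp heV.2
  rw [hzero, one_smul] at h
  exact he0 h.symm

end WeightBasis

/-- This carries results proved in a weight basis over to the given basis of X_α and Y_p. -/
theorem HomogeneousBasis.partialCasimir_eq {g : Type u} [LieRing g] [LieAlgebra ℂ g]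
    {θ : g →ₗ⁅ℂ⁆ g} [FiniteDimensional ℂ g] [LieAlgebra.IsKilling ℂ g]
    {I : Type v} [Fintype I] [DecidableEq I] (B : HomogeneousBasis θ I)
    {J : Type w} [Fintype J] [DecidableEq J] (B' : HomogeneousBasis θ J)
    (hinv : ∀ x, θ (θ x) = x) (k : ℕ) (z : g) :
    B.partialCasimir k z = B'.partialCasimir k z := by
  rw [partialCasimir_apply, partialCasimir_apply]
  conv_lhs => enter [2, i]; rw [← B'.sum_d_smul_e hinv (B.e_mem k i)]
  conv_rhs => enter [2, j]; rw [← B.sum_e_smul_d hinv (B'.d_mem hinv k j)]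
  simp only [sum_lie, smul_lie, lie_sum, lie_smul]
  rw [Finset.sum_comm]
  refine Finset.sum_congr rfl fun i _ ↦ Finset.sum_congr rfl fun j _ ↦ ?_
  rw [LieModule.traceForm_comm]

/-! ### Structure constants in terms of partial Casimir operators. -/

namespace SymmetricSpaceBasis

variable {g : Type u} [LieRing g] [LieAlgebra ℂ g] {θ : g →ₗ⁅ℂ⁆ g} {ι : Type v} {κ : Type w}
  (b : SymmetricSpaceBasis θ ι κ)

/-- A symmetric space basis is homogeneous: the `X_α` have degree zero, the `Y_p` degree one. -/
def homogeneousBasis : HomogeneousBasis θ (ι ⊕ κ) where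
  basis := b.basis
  deg := Sum.elim (fun _ ↦ 0) fun _ ↦ 1
  mem := by
    rintro (α | p)
    · simp [mem_grade, b.map_X α]
    · simp [mem_grade, b.map_Y p]

theorem X_mem (α : ι) : b.X α ∈ grade θ 0 := b.homogeneousBasis.mem (Sum.inl α)

theorem Y_mem (p : κ) : (b.Y p : g) ∈ grade θ 1 := b.homogeneousBasis.mem (Sum.inr p)

variable [Fintype ι] [Fintype κ] [DecidableEq ι] [DecidableEq κ] [FiniteDimensional ℂ g]
  [LieAlgebra.IsKilling ℂ g]

/-- The elements of `h` dual to the `X_α`. -/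
def dualX (α : ι) : g := b.homogeneousBasis.dual (Sum.inl α)

/-- The elements of `m` dual to the `Y_p`. -/
def dualY (p : κ) : g := b.homogeneousBasis.dual (Sum.inr p)

theorem sum_e_d_zero {A : Type*} [AddCommMonoid A] (F : g → g → A) (hF : F 0 0 = 0) :
    ∑ i, F (b.homogeneousBasis.e 0 i) (b.homogeneousBasis.d 0 i) = ∑ α, F (b.X α) (b.dualX α) := by
  rw [Fintype.sum_sum_type]
  simp [HomogeneousBasis.e, HomogeneousBasis.d, homogeneousBasis, hF, X, dualX]

theorem sum_e_d_one {A : Type*} [AddCommMonoid A] (F : g → g → A) (hF : F 0 0 = 0) :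
    ∑ i, F (b.homogeneousBasis.e 1 i) (b.homogeneousBasis.d 1 i) = ∑ p, F (b.Y p) (b.dualY p) := by
  rw [Fintype.sum_sum_type]
  simp [HomogeneousBasis.e, HomogeneousBasis.d, homogeneousBasis, hF, Y, dualY]

theorem repr_inl (z : g) (α : ι) :
    b.basis.repr z (Sum.inl α) = killingForm ℂ g (b.dualX α) z :=
  (b.homogeneousBasis.killingForm_dual _ z).symm

theorem repr_inr (z : g) (p : κ) :
    b.basis.repr z (Sum.inr p) = killingForm ℂ g (b.dualY p) z :=
  (b.homogeneousBasis.killingForm_dual _ z).symm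

theorem killingForm_X_dualX (α β : ι) :
    killingForm ℂ g (b.X α) (b.dualX β) = if α = β then 1 else 0 :=
  (b.homogeneousBasis.killingForm_basis_dual (Sum.inl α) (Sum.inl β)).trans
    (if_congr Sum.inl_injective.eq_iff rfl rfl)

theorem killingForm_Y_dualY (p q : κ) :
    killingForm ℂ g (b.Y p) (b.dualY q) = if p = q then 1 else 0 :=
  (b.homogeneousBasis.killingForm_basis_dual (Sum.inr p) (Sum.inr q)).trans
    (if_congr Sum.inr_injective.eq_iff rfl rfl)

variable (hinv : ∀ x, θ (θ x) = x)
include hinv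

theorem dualX_mem (α : ι) : b.dualX α ∈ grade θ 0 := b.homogeneousBasis.dual_mem hinv (Sum.inl α)

theorem dualY_mem (p : κ) : b.dualY p ∈ grade θ 1 := b.homogeneousBasis.dual_mem hinv (Sum.inr p)

theorem sum_repr_X {z : g} (hz : z ∈ grade θ 0) :
    ∑ α, b.basis.repr z (Sum.inl α) • b.X α = z := by
  conv_rhs => rw [← b.homogeneousBasis.sum_d_smul_e hinv hz]
  rw [b.sum_e_d_zero (fun e d ↦ killingForm ℂ g d z • e) (by simp)]
  simp_rw [b.repr_inl]

theorem sum_repr_Y {z : g} (hz : z ∈ grade θ 1) :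
    ∑ p, b.basis.repr z (Sum.inr p) • (b.Y p : g) = z := by
  conv_rhs => rw [← b.homogeneousBasis.sum_d_smul_e hinv hz]
  rw [b.sum_e_d_one (fun e d ↦ killingForm ℂ g d z • e) (by simp)]
  simp_rw [b.repr_inr]

theorem grade_zero_le {S : Submodule ℂ g} (h : ∀ α, b.X α ∈ S) : grade θ 0 ≤ S := by
  intro z hz
  rw [← b.sum_repr_X hinv hz]
  exact S.sum_mem fun α _ ↦ S.smul_mem _ (h α)

theorem grade_one_le {S : Submodule ℂ g} (h : ∀ p, (b.Y p : g) ∈ S) : grade θ 1 ≤ S := by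
  intro z hz
  rw [← b.sum_repr_Y hinv hz]
  exact S.sum_mem fun p _ ↦ S.smul_mem _ (h p)

theorem kappaH_inv : b.kappaH⁻¹ = Matrix.of fun α β ↦ killingForm ℂ g (b.dualX α) (b.dualX β) := by
  refine Matrix.inv_eq_right_inv ?_
  ext α γ
  rw [Matrix.mul_apply, Matrix.one_apply, ← b.killingForm_X_dualX α γ]
  conv_rhs => rw [← b.sum_repr_X hinv (b.dualX_mem hinv γ)]
  simp [kappaH, repr_inl, mul_comm]

theorem kappaM_inv : b.kappaM⁻¹ = Matrix.of fun p q ↦ killingForm ℂ g (b.dualY p) (b.dualY q) := by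
  refine Matrix.inv_eq_right_inv ?_
  ext p r
  rw [Matrix.mul_apply, Matrix.one_apply, ← b.killingForm_Y_dualY p r]
  conv_rhs => rw [← b.sum_repr_Y hinv (b.dualY_mem hinv r)]
  simp [kappaM, repr_inr, mul_comm]

theorem sum_kappaH_inv_smul_X (α : ι) : ∑ β, b.kappaH⁻¹ α β • b.X β = b.dualX α := by
  conv_rhs => rw [← b.sum_repr_X hinv (b.dualX_mem hinv α)]
  refine Finset.sum_congr rfl fun β _ ↦ ?_
  rw [b.kappaH_inv hinv, Matrix.of_apply, repr_inl, LieModule.traceForm_comm]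

theorem sum_kappaM_inv_smul_Y (p : κ) : ∑ q, b.kappaM⁻¹ p q • (b.Y q : g) = b.dualY p := by
  conv_rhs => rw [← b.sum_repr_Y hinv (b.dualY_mem hinv p)]
  refine Finset.sum_congr rfl fun q _ ↦ ?_
  rw [b.kappaM_inv hinv, Matrix.of_apply, repr_inr, LieModule.traceForm_comm]

omit hinv in
theorem eta_inv : b.eta⁻¹ = Matrix.of fun i j ↦
    killingForm ℂ g (b.homogeneousBasis.dual i) (b.homogeneousBasis.dual j) := by
  refine Matrix.inv_eq_right_inv ?_
  ext i k
  rw [Matrix.mul_apply, Matrix.one_apply, ← b.homogeneousBasis.killingForm_basis_dual i k]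
  conv_rhs => rw [← b.homogeneousBasis.sum_dual_smul_basis (b.homogeneousBasis.dual k)]
  simp only [map_sum, map_smul, smul_eq_mul, eta, Matrix.of_apply, mul_comm]
  rfl

omit hinv in
theorem casimir_eq_id : b.casimir = LinearMap.id := by
  ext z
  rw [LinearMap.id_apply]
  conv_rhs => rw [← b.homogeneousBasis.partialCasimir_zero_add_one z]
  rw [HomogeneousBasis.partialCasimir_apply, HomogeneousBasis.partialCasimir_apply,
    ← Finset.sum_add_distrib]
  have h (i : ι ⊕ κ) : ⁅b.homogeneousBasis.e 0 i, ⁅b.homogeneousBasis.d 0 i, z⁆⁆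
      + ⁅b.homogeneousBasis.e 1 i, ⁅b.homogeneousBasis.d 1 i, z⁆⁆
      = ⁅b.basis i, ⁅b.homogeneousBasis.dual i, z⁆⁆ := by
    cases i <;> simp [HomogeneousBasis.e, HomogeneousBasis.d, homogeneousBasis]
  simp_rw [h]
  simp only [casimir, LinearMap.sum_apply, LinearMap.smul_apply, LinearMap.comp_apply,
    LieAlgebra.ad_apply]
  refine Finset.sum_congr rfl fun i _ ↦ ?_
  conv_rhs => rw [← b.homogeneousBasis.sum_dual_smul_basis (b.homogeneousBasis.dual i)]
  rw [sum_lie, lie_sum]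
  refine Finset.sum_congr rfl fun j _ ↦ ?_
  rw [smul_lie, lie_smul, b.eta_inv, Matrix.of_apply, LieModule.traceForm_comm]
  rfl

-- The Casimir element is normalized by the Killing form, so it acts on g as the identity.
omit hinv in
theorem cG_eq_one [Nontrivial g] : b.cG = 1 := by
  rw [cG, casimir_eq_id, LinearMap.trace_id, div_self]
  exact_mod_cast Module.finrank_pos.ne'

theorem lie_X_dualX (α μ : ι) : ∑ ν, b.fUp α μ ν • b.X ν = ⁅b.X α, b.dualX μ⁆ := by
  have h : ⁅b.X α, b.dualX μ⁆ ∈ grade θ 0 := by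
    simpa using lie_mem_grade (b.X_mem α) (b.dualX_mem hinv μ)
  rw [← b.sum_repr_X hinv h]
  refine Finset.sum_congr rfl fun ν _ ↦ ?_
  rw [← b.sum_kappaH_inv_smul_X hinv, lie_sum, map_sum, Finsupp.finsetSum_apply]
  simp only [lie_smul, map_smul, Finsupp.smul_apply, smul_eq_mul]
  rfl

theorem lie_X_dualY (α : ι) (p : κ) : ∑ q, b.wUp α p q • (b.Y q : g) = ⁅b.X α, b.dualY p⁆ := by
  have h : ⁅b.X α, b.dualY p⁆ ∈ grade θ 1 := by
    simpa using lie_mem_grade (b.X_mem α) (b.dualY_mem hinv p)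
  rw [← b.sum_repr_Y hinv h]
  refine Finset.sum_congr rfl fun q _ ↦ ?_
  rw [← b.sum_kappaM_inv_smul_Y hinv, lie_sum, map_sum, Finsupp.finsetSum_apply]
  simp only [lie_smul, map_smul, Finsupp.smul_apply, smul_eq_mul]
  rfl

theorem c_eq_repr (α : ι) :
    b.c α = b.basis.repr (b.homogeneousBasis.partialCasimir 0 (b.X α)) (Sum.inl α) := by
  rw [HomogeneousBasis.partialCasimir_apply, b.sum_e_d_zero (fun e d ↦ ⁅e, ⁅d, b.X α⁆⁆) (by simp),
    map_sum, Finsupp.finsetSum_apply, c]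
  refine Finset.sum_congr rfl fun μ _ ↦ ?_
  have h : ⁅b.X μ, ⁅b.dualX μ, b.X α⁆⁆ = ⁅⁅b.X α, b.dualX μ⁆, b.X μ⁆ := by
    rw [← lie_skew (b.dualX μ), lie_neg, lie_skew]
  rw [h, ← b.lie_X_dualX hinv, sum_lie, map_sum, Finsupp.finsetSum_apply]
  simp only [smul_lie, map_smul, Finsupp.smul_apply, smul_eq_mul]
  rfl

/-- Schur's lemma: on a simple ideal an eigenspace of the Casimir of h is an ideal, hence
everything. On the centre the Casimir is zero. -/
theorem exists_partialCasimir_X (α : ι) :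
    ∃ c : ℂ, b.homogeneousBasis.partialCasimir 0 (b.X α) = c • b.X α := by
  obtain ⟨J, hJ, x, hxJ, hx⟩ := b.adapted α
  set B := b.homogeneousBasis
  let e (i : ι ⊕ κ) : fixedPoints θ := ⟨B.e 0 i, mem_grade_zero.mp (B.e_mem 0 i)⟩
  let d (i : ι ⊕ κ) : fixedPoints θ := ⟨B.d 0 i, mem_grade_zero.mp (B.d_mem hinv 0 i)⟩
  have hX : b.X α = x := hx.symm
  have hcas (y : fixedPoints θ) : B.partialCasimir 0 (y : g)
      = ((∑ i, ⁅e i, ⁅d i, y⁆⁆ : fixedPoints θ) : g) := by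
    rw [B.partialCasimir_apply]
    simp only [e, d, AddSubmonoidClass.coe_finsetSum, LieSubalgebra.coe_bracket]
  rw [hX]
  obtain hJ | rfl := hJ
  · let C : Module.End ℂ J := ∑ i, LieModule.toEnd ℂ (fixedPoints θ) J (e i) ∘ₗ
      LieModule.toEnd ℂ (fixedPoints θ) J (d i)
    have hC (y : J) : (((C y : J) : fixedPoints θ) : g) = B.partialCasimir 0 ((y : fixedPoints θ) :
        g) := by
      rw [hcas]
      simp only [C, LinearMap.sum_apply, LinearMap.comp_apply, LieModule.toEnd_apply_apply,
        AddSubmonoidClass.coe_finsetSum, LieSubmodule.coe_bracket]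
    have : Nontrivial J := by
      by_contra h
      rw [not_nontrivial_iff_subsingleton] at h
      exact hJ.non_abelian ⟨fun _ _ ↦ Subsingleton.elim _ _⟩
    obtain ⟨c, hc⟩ := Module.End.exists_eigenvalue C
    obtain ⟨v, hv⟩ := hc.exists_hasEigenvector
    let E : LieIdeal ℂ J :=
      { Module.End.eigenspace C c with
        lie_mem := by
          intro a y hy
          change ⁅a, y⁆ ∈ Module.End.eigenspace C c
          have hy' : C y = c • y := Module.End.mem_eigenspace_iff.mp hy
          rw [Module.End.mem_eigenspace_iff]
          refine Subtype.ext (Subtype.ext ?_)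
          rw [hC]
          have h := congrArg (fun z : J ↦ ((z : fixedPoints θ) : g)) hy'
          rw [hC] at h
          have ha : ((a : fixedPoints θ) : g) ∈ grade θ 0 := mem_grade_zero.mpr a.1.2
          change B.partialCasimir 0 ⁅((a : fixedPoints θ) : g), ((y : fixedPoints θ) : g)⁆
            = c • ⁅((a : fixedPoints θ) : g), ((y : fixedPoints θ) : g)⁆
          rw [B.partialCasimir_lie hinv ha, h, ← lie_smul]
          rfl }
    have hE : E = ⊤ := by
      refine (hJ.eq_bot_or_eq_top E).resolve_left fun hbot ↦ ?_
      have h : v ∈ E := hv.1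
      rw [hbot, LieSubmodule.mem_bot] at h
      exact hv.2 h
    have hxE : (⟨x, hxJ⟩ : J) ∈ E := hE ▸ LieSubmodule.mem_top _
    have h : C ⟨x, hxJ⟩ = c • ⟨x, hxJ⟩ := Module.End.mem_eigenspace_iff.mp hxE
    refine ⟨c, ?_⟩
    rw [← hC ⟨x, hxJ⟩, h]
    rfl
  · refine ⟨0, ?_⟩
    rw [hcas, zero_smul]
    have h (i : ι ⊕ κ) : ⁅d i, x⁆ = 0 := (LieModule.mem_maxTrivSubmodule ..).mp hxJ (d i)
    simp [h]

theorem partialCasimir_zero_X (α : ι) :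
    b.homogeneousBasis.partialCasimir 0 (b.X α) = b.c α • b.X α := by
  obtain ⟨c, hc⟩ := b.exists_partialCasimir_X hinv α
  have h : b.c α = c := by
    rw [b.c_eq_repr hinv, hc, map_smul, Finsupp.smul_apply, X, Module.Basis.repr_self]
    simp
  rw [h, hc]

theorem partialCasimir_one_X [Nontrivial g] (α : ι) :
    b.homogeneousBasis.partialCasimir 1 (b.X α) = b.cBar α • b.X α := by
  have h := b.homogeneousBasis.partialCasimir_zero_add_one (b.X α)
  rw [b.partialCasimir_zero_X hinv, ← eq_sub_iff_add_eq'] at h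
  rw [h, cBar, cG_eq_one, sub_smul, one_smul]

/-- The left side is -C_1 X_α, written with [X_α, Y^p] in place of its coefficients, where Y^p is
dual to Y_p. This is the origin of c̄_(α) in (LH2). -/
theorem sum_wUp_smul_lie [Nontrivial g] (α : ι) :
    ∑ r, ∑ s, b.wUp α r s • ⁅(b.Y r : g), (b.Y s : g)⁆ = -(b.cBar α • b.X α) := by
  rw [← b.partialCasimir_one_X hinv, HomogeneousBasis.partialCasimir_apply,
    b.sum_e_d_one (fun e d ↦ ⁅e, ⁅d, b.X α⁆⁆) (by simp), ← Finset.sum_neg_distrib]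
  refine Finset.sum_congr rfl fun r _ ↦ ?_
  rw [← lie_neg, lie_skew, ← b.lie_X_dualY hinv, lie_sum]
  simp_rw [lie_smul]

/-- The left side is C_1 Y_s. The value 1/2 accounts for the factor 2/c_g in (LH3). -/
theorem sum_kappaM_inv_smul_lie_lie (s : κ) :
    ∑ t, ∑ u, b.kappaM⁻¹ t u • ⁅⁅(b.Y s : g), (b.Y t : g)⁆, (b.Y u : g)⁆
      = (1 / 2 : ℂ) • (b.Y s : g) := by
  rw [← b.homogeneousBasis.partialCasimir_of_mem_one hinv 1 (b.Y_mem s),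
    HomogeneousBasis.partialCasimir_apply]
  have h := b.homogeneousBasis.sum_swap hinv
    (LinearMap.mk₂ ℂ (fun x y : g ↦ ⁅x, ⁅y, (b.Y s : g)⁆⁆) (by simp) (by simp) (by simp)
      (by simp)) 1
  simp only [LinearMap.mk₂_apply] at h
  rw [← h, b.sum_e_d_one (fun e d ↦ ⁅d, ⁅e, (b.Y s : g)⁆⁆) (by simp)]
  refine Finset.sum_congr rfl fun t _ ↦ ?_
  have h1 : ⁅b.dualY t, ⁅(b.Y t : g), (b.Y s : g)⁆⁆ = ⁅⁅(b.Y s : g), (b.Y t : g)⁆, b.dualY t⁆ := by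
    rw [← lie_skew (b.Y t : g), lie_neg, lie_skew]
  rw [h1, ← b.sum_kappaM_inv_smul_Y hinv, lie_sum]
  simp_rw [lie_smul]

/-- If it vanished, X_α would be an eigenvector of the Casimir of h with eigenvalue 1. -/
theorem cBar_ne_zero [LieAlgebra.IsSimple ℂ g] (hid : ∃ x, θ x ≠ x) (α : ι) : b.cBar α ≠ 0 := by
  classical
  have : Nontrivial g := by
    obtain ⟨x, hx⟩ := hid
    exact ⟨_, _, hx⟩
  intro h
  obtain ⟨I, _, ⟨W⟩⟩ := exists_weightBasis hinv
  refine b.basis.ne_zero (Sum.inl α) (W.eq_zero_of_partialCasimir hinv hid (b.X_mem α) ?_)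
  change W.partialCasimir 0 (b.X α) = b.X α
  rw [W.partialCasimir_eq b.homogeneousBasis hinv, b.partialCasimir_zero_X hinv,
    show b.c α = 1 by rw [cBar, cG_eq_one, sub_eq_zero] at h; exact h.symm, one_smul]

/-- The relation of level two holds in `g`. -/
theorem lie_add_sum_wUp_smul_lie [LieAlgebra.IsSimple ℂ g] (hid : ∃ x, θ x ≠ x) (p q : κ) :
    ⁅(b.Y p : g), (b.Y q : g)⁆ + ∑ α, ∑ r, ∑ s, (1 / b.cBar α * b.w p q α * b.wUp α r s) •
      ⁅(b.Y r : g), (b.Y s : g)⁆ = 0 := by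
  have : Nontrivial g := by
    obtain ⟨x, hx⟩ := hid
    exact ⟨_, _, hx⟩
  have hmem : ⁅(b.Y p : g), (b.Y q : g)⁆ ∈ grade θ 0 := by
    rw [← grade_add_two 0]
    exact lie_mem_grade (i := 1) (j := 1) (b.Y_mem p) (b.Y_mem q)
  have h (α : ι) : ∑ r, ∑ s, (1 / b.cBar α * b.w p q α * b.wUp α r s) •
      ⁅(b.Y r : g), (b.Y s : g)⁆ = -(b.w p q α • b.X α) := by
    simp_rw [mul_smul _ (b.wUp α _ _), ← Finset.smul_sum]
    rw [b.sum_wUp_smul_lie hinv, smul_neg, smul_smul]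
    congr 2
    field_simp [b.cBar_ne_zero hinv hid α]
  simp_rw [h]
  rw [Finset.sum_neg_distrib, ← sub_eq_add_neg, sub_eq_zero]
  exact (b.sum_repr_X hinv hmem).symm

/-- The relation of level three holds in `g`. -/
theorem lie_lie_add_sum_smul_lie_lie [LieAlgebra.IsSimple ℂ g] [Nontrivial g] (p q r : κ) :
    ⁅⁅(b.Y p : g), (b.Y q : g)⁆, (b.Y r : g)⁆ + (2 / b.cG) • ∑ α, ∑ s, ∑ t, ∑ u,
      (b.kappaM⁻¹ t u * b.w p q α * b.gYX r α s) •
        ⁅⁅(b.Y s : g), (b.Y t : g)⁆, (b.Y u : g)⁆ = 0 := by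
  have hmem : ⁅(b.Y p : g), (b.Y q : g)⁆ ∈ grade θ 0 := by
    rw [← grade_add_two 0]
    exact lie_mem_grade (i := 1) (j := 1) (b.Y_mem p) (b.Y_mem q)
  have h (α : ι) (s : κ) : ∑ t, ∑ u, (b.kappaM⁻¹ t u * b.w p q α * b.gYX r α s) •
        ⁅⁅(b.Y s : g), (b.Y t : g)⁆, (b.Y u : g)⁆
      = b.w p q α • b.gYX r α s • (1 / 2 : ℂ) • (b.Y s : g) := by
    rw [← b.sum_kappaM_inv_smul_lie_lie hinv]
    simp only [Finset.smul_sum, smul_smul]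
    refine Finset.sum_congr rfl fun t _ ↦ Finset.sum_congr rfl fun u _ ↦ ?_
    congr 1
    ring
  have h2 (α : ι) : ∑ s, b.gYX r α s • (b.Y s : g) = ⁅(b.Y r : g), b.X α⁆ :=
    b.sum_repr_Y hinv (by simpa using lie_mem_grade (b.Y_mem r) (b.X_mem α))
  simp_rw [h, smul_comm _ (1 / 2 : ℂ), ← Finset.smul_sum, h2, ← lie_smul, ← lie_sum]
  rw [cG_eq_one, smul_smul, show ∑ α, b.w p q α • b.X α = _ from b.sum_repr_X hinv hmem]
  rw [← lie_skew (b.Y r : g), show (2 / 1 * (1 / 2) : ℂ) = 1 by norm_num, one_smul, add_neg_cancel]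

end SymmetricSpaceBasis

/-! ### The relations as factorizations through the bracket. -/

theorem bilinear_eq_of_le_span {M A : Type*} [AddCommGroup M] [Module ℂ M] [AddCommGroup A]
    [Module ℂ A] {V V' : Submodule ℂ M} {S S' : Set M} (hV : V ≤ Submodule.span ℂ S)
    (hV' : V' ≤ Submodule.span ℂ S') (F G : M →ₗ[ℂ] M →ₗ[ℂ] A)
    (h : ∀ x ∈ S, ∀ y ∈ S', F x y = G x y) : ∀ x ∈ V, ∀ y ∈ V', F x y = G x y := by
  intro x hx y hy
  refine LinearMap.eqOn_span (f := F.flip y) (g := G.flip y) (fun x hx ↦ ?_) (hV hx)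
  exact LinearMap.eqOn_span (f := F x) (g := G x) (h x hx) (hV' hy)

theorem lift_eq_of_eq_lie {g : Type u} [LieRing g] [LieAlgebra ℂ g] {θ : g →ₗ⁅ℂ⁆ g} {A : Type w}
    [AddCommGroup A] [Module ℂ A] {i j : ℕ} (F : g →ₗ[ℂ] g →ₗ[ℂ] A) (T : g →ₗ[ℂ] A)
    (h : ∀ x ∈ grade θ i, ∀ y ∈ grade θ j, F x y = T ⁅x, y⁆) {w : g ⊗[ℂ] g}
    (hw : w ∈ gradeTensor θ i j) : TensorProduct.lift F w = T (bracket g w) := by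
  suffices gradeTensor θ i j ≤ LinearMap.eqLocus (TensorProduct.lift F) (T ∘ₗ bracket g) from
    this hw
  refine gradeTensor_le fun x hx y hy ↦ ?_
  rw [LinearMap.mem_eqLocus, TensorProduct.lift.tmul, LinearMap.comp_apply, bracket_tmul, h x hx y
    hy]

namespace SymmetricSpaceBasis

variable {g : Type u} [LieRing g] [LieAlgebra ℂ g] {θ : g →ₗ⁅ℂ⁆ g} {ι : Type v} {κ : Type w}
  (b : SymmetricSpaceBasis θ ι κ) [Fintype ι] [Fintype κ] [DecidableEq ι] [DecidableEq κ]
  [FiniteDimensional ℂ g] [LieAlgebra.IsKilling ℂ g] (hinv : ∀ x, θ (θ x) = x)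
include hinv

theorem grade_zero_le_span : grade θ 0 ≤ Submodule.span ℂ (Set.range b.X) :=
  b.grade_zero_le hinv fun α ↦ Submodule.subset_span ⟨α, rfl⟩

theorem grade_one_le_span : grade θ 1 ≤ Submodule.span ℂ (Set.range fun p ↦ (b.Y p : g)) :=
  b.grade_one_le hinv fun p ↦ Submodule.subset_span ⟨p, rfl⟩

theorem map_eq_sum_X {A : Type*} [AddCommGroup A] [Module ℂ A] (F : g →ₗ[ℂ] A) {z : g}
    (hz : z ∈ grade θ 0) : F z = ∑ α, b.basis.repr z (Sum.inl α) • F (b.X α) := by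
  conv_lhs => rw [← b.sum_repr_X hinv hz]
  simp

theorem map_eq_sum_Y {A : Type*} [AddCommGroup A] [Module ℂ A] (F : g →ₗ[ℂ] A) {z : g}
    (hz : z ∈ grade θ 1) : F z = ∑ p, b.basis.repr z (Sum.inr p) • F (b.Y p) := by
  conv_lhs => rw [← b.sum_repr_Y hinv hz]
  simp

section Relations

variable {A : Type*} [LieRing A] [LieAlgebra ℂ A] (φ : g →ₗ[ℂ] A)

/-- The relation of level two determines the brackets of elements of degree one. -/
theorem exists_lie_eq_of_level_two (hYY : ∀ p q, ⁅φ (b.Y p), φ (b.Y q)⁆ + ∑ α, ∑ r, ∑ s,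
      (1 / b.cBar α * b.w p q α * b.wUp α r s) • ⁅φ (b.Y r), φ (b.Y s)⁆ = 0) :
    ∃ T : g →ₗ[ℂ] A, ∀ x ∈ grade θ 1, ∀ y ∈ grade θ 1, ⁅φ x, φ y⁆ = T ⁅x, y⁆ := by
  -- In (LH2) the indices p, q enter the sum only through the coordinates w_{pq}^α of [Y_p, Y_q];
  -- the remaining factors give the value of -T at X_α.
  let T : g →ₗ[ℂ] A := -∑ α, (b.basis.coord (Sum.inl α)).smulRight
    (∑ r, ∑ s, (1 / b.cBar α * b.wUp α r s) • ⁅φ (b.Y r), φ (b.Y s)⁆)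
  refine ⟨T, bilinear_eq_of_le_span (b.grade_one_le_span hinv) (b.grade_one_le_span hinv)
    (lieCross φ φ) ((lieCross LinearMap.id LinearMap.id).compr₂ T) ?_⟩
  rintro _ ⟨p, rfl⟩ _ ⟨q, rfl⟩
  simp only [lieCross_apply, LinearMap.compr₂_apply, LinearMap.id_apply, T, LinearMap.neg_apply,
    LinearMap.sum_apply, LinearMap.smulRight_apply, Module.Basis.coord_apply]
  rw [eq_neg_iff_add_eq_zero, ← hYY p q]
  simp only [Finset.smul_sum, smul_smul]
  congr 1
  refine Finset.sum_congr rfl fun α _ ↦ Finset.sum_congr rfl fun r _ ↦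
    Finset.sum_congr rfl fun s _ ↦ ?_
  rw [w]
  congr 1
  ring

/-- The relation of level three determines the brackets of elements of degree one and two. -/
theorem exists_lie_eq_of_level_three [LieAlgebra.IsSimple ℂ g] (hid : ∃ x, θ x ≠ x)
    (hYYY : ∀ p q r, ⁅⁅φ (b.Y p), φ (b.Y q)⁆, φ (b.Y r)⁆ + (2 / b.cG) • ∑ α, ∑ s, ∑ t, ∑ u,
      (b.kappaM⁻¹ t u * b.w p q α * b.gYX r α s) • ⁅⁅φ (b.Y s), φ (b.Y t)⁆, φ (b.Y u)⁆ = 0)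
    {χ : g →ₗ[ℂ] A} (hχ : ∀ x ∈ grade θ 1, ∀ y ∈ grade θ 1, ⁅φ x, φ y⁆ = χ ⁅x, y⁆) :
    ∃ T : g →ₗ[ℂ] A, ∀ x ∈ grade θ 1, ∀ y ∈ grade θ 0, ⁅φ x, χ y⁆ = T ⁅x, y⁆ := by
  -- In (LH3) the indices p, q, r enter the sum only through the coordinates of [Y_r, [Y_p, Y_q]].
  let T : g →ₗ[ℂ] A := (2 / b.cG) • ∑ s, (b.basis.coord (Sum.inr s)).smulRight
    (∑ t, ∑ u, b.kappaM⁻¹ t u • ⁅⁅φ (b.Y s), φ (b.Y t)⁆, φ (b.Y u)⁆)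
  have hspan : grade θ 0 ≤ Submodule.span ℂ
      (Set.range fun i : κ × κ ↦ ⁅(b.Y i.1 : g), (b.Y i.2 : g)⁆) := by
    refine (grade_zero_le_bracketSpan hinv hid).trans ?_
    refine (Submodule.map₂_le_map₂ (b.grade_one_le_span hinv) (b.grade_one_le_span hinv)).trans ?_
    rw [Submodule.map₂_span_span]
    refine Submodule.span_mono ?_
    rintro _ ⟨_, ⟨p, rfl⟩, _, ⟨q, rfl⟩, rfl⟩
    exact ⟨(p, q), rfl⟩
  refine ⟨T, bilinear_eq_of_le_span (b.grade_one_le_span hinv) hspan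
    (lieCross φ χ) ((lieCross LinearMap.id LinearMap.id).compr₂ T) ?_⟩
  rintro _ ⟨r, rfl⟩ _ ⟨⟨p, q⟩, rfl⟩
  have hmem : ⁅(b.Y p : g), (b.Y q : g)⁆ ∈ grade θ 0 := by
    rw [← grade_add_two 0]
    exact lie_mem_grade (i := 1) (j := 1) (b.Y_mem p) (b.Y_mem q)
  have hrepr (s : κ) : b.basis.repr ⁅(b.Y r : g), ⁅(b.Y p : g), (b.Y q : g)⁆⁆ (Sum.inr s)
      = ∑ α, b.w p q α * b.gYX r α s := by
    conv_lhs => rw [← b.sum_repr_X hinv hmem]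
    rw [lie_sum, map_sum, Finsupp.finsetSum_apply]
    simp only [lie_smul, map_smul, Finsupp.smul_apply, smul_eq_mul]
    rfl
  simp only [lieCross_apply, LinearMap.compr₂_apply, LinearMap.id_apply, T, LinearMap.smul_apply,
    LinearMap.sum_apply, LinearMap.smulRight_apply, Module.Basis.coord_apply]
  rw [← hχ _ (b.Y_mem p) _ (b.Y_mem q), ← lie_skew, neg_eq_iff_add_eq_zero, ← hYYY p q r]
  simp only [hrepr, Finset.sum_smul]
  rw [Finset.sum_comm]
  congr 2
  refine Finset.sum_congr rfl fun α _ ↦ Finset.sum_congr rfl fun s _ ↦ ?_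
  simp only [Finset.smul_sum, smul_smul]
  refine Finset.sum_congr rfl fun t _ ↦ Finset.sum_congr rfl fun u _ ↦ ?_
  congr 1
  ring

end Relations

/-- Linear maps on `h` and `m` that satisfy the defining relations extend to a graded family of
maps that is compatible with brackets. -/
theorem exists_graded_extension [LieAlgebra.IsSimple ℂ g] (hrank : 2 ≤ LieAlgebra.rank ℂ g)
    (hid : ∃ x, θ x ≠ x) {A : Type*} [LieRing A] [LieAlgebra ℂ A] (ψ₀ ψ₁ : g →ₗ[ℂ] A)
    (hXX : ∀ α β, ⁅ψ₀ (b.X α), ψ₀ (b.X β)⁆ = ψ₀ ⁅b.X α, b.X β⁆)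
    (hXY : ∀ α p, ⁅ψ₀ (b.X α), ψ₁ (b.Y p)⁆ = ψ₁ ⁅b.X α, (b.Y p : g)⁆)
    (hYY : ∀ p q, ⁅ψ₁ (b.Y p), ψ₁ (b.Y q)⁆ + ∑ α, ∑ r, ∑ s,
      (1 / b.cBar α * b.w p q α * b.wUp α r s) • ⁅ψ₁ (b.Y r), ψ₁ (b.Y s)⁆ = 0)
    (hYYY : ∀ p q r, ⁅⁅ψ₁ (b.Y p), ψ₁ (b.Y q)⁆, ψ₁ (b.Y r)⁆ + (2 / b.cG) • ∑ α, ∑ s, ∑ t, ∑ u,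
      (b.kappaM⁻¹ t u * b.w p q α * b.gYX r α s) •
        ⁅⁅ψ₁ (b.Y s), ψ₁ (b.Y t)⁆, ψ₁ (b.Y u)⁆ = 0) :
    ∃ ψ : ℕ → g →ₗ[ℂ] A, ψ 0 = ψ₀ ∧ ψ 1 = ψ₁ ∧ ∀ i j, ∀ x ∈ grade θ i, ∀ y ∈ grade θ j,
      ⁅ψ i x, ψ j y⁆ = ψ (i + j) ⁅x, y⁆ := by
  classical
  obtain ⟨I, _, ⟨W⟩⟩ := exists_weightBasis hinv
  have hgen := b.homogeneousBasis.grade_succ_le_bracketSpan hinv hid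
  choose σ hσ using fun n ↦ exists_bracket_section n (hgen n)
  refine ⟨extendGraded σ ψ₀ ψ₁, rfl, rfl, fun i j x hx y hy ↦
    lie_extendGraded σ hσ hgen ψ₀ ψ₁ ?_ ?_ (fun n hψ w hw hbr ↦ ?_) i j hx hy⟩
  · refine bilinear_eq_of_le_span (b.grade_zero_le_span hinv) (b.grade_zero_le_span hinv)
      (lieCross ψ₀ ψ₀) ((lieCross LinearMap.id LinearMap.id).compr₂ ψ₀) ?_
    rintro _ ⟨α, rfl⟩ _ ⟨β, rfl⟩
    exact hXX α β
  · refine bilinear_eq_of_le_span (b.grade_zero_le_span hinv) (b.grade_one_le_span hinv)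
      (lieCross ψ₀ ψ₁) ((lieCross LinearMap.id LinearMap.id).compr₂ ψ₁) ?_
    rintro _ ⟨α, rfl⟩ _ ⟨p, rfl⟩
    exact hXY α p
  -- Total degree two is (LH2), total degree three is (LH3), and from degree four on the Laplacian
  -- argument applies.
  obtain _ | _ | n := n
  · obtain ⟨T, hT⟩ := b.exists_lie_eq_of_level_two hinv ψ₁ hYY
    exact (lift_eq_of_eq_lie (lieCross ψ₁ ψ₁) T hT hw).trans (by rw [hbr, map_zero])
  · obtain ⟨T, hT⟩ := b.exists_lie_eq_of_level_three hinv ψ₁ hid hYYY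
      (χ := extendGraded σ ψ₀ ψ₁ 2) (hψ 1 1 (by lia))
    rw [← grade_add_two 0] at hT
    exact (lift_eq_of_eq_lie (lieCross ψ₁ (extendGraded σ ψ₀ ψ₁ 2)) T hT hw).trans
      (by rw [hbr, map_zero])
  · exact W.lift_lieCross_eq_zero hinv (extendGraded σ ψ₀ ψ₁) (n + 2) hψ
      (fun w hw hc ↦ W.eq_zero_of_tensorCasimir hinv hrank (by lia) hw hc) hw hbr

end SymmetricSpaceBasis

/-! ### Homogeneous elements of the half-loop algebra. -/

section HalfLoop

variable {g : Type u} [LieRing g] [LieAlgebra ℂ g] {θ : g →ₗ⁅ℂ⁆ g}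

/-- `x ↦ x^{(k)}`, as a linear map. -/
def levelHom (k : ℕ) : g →ₗ[ℂ] HalfLoop g := TensorProduct.mk ℂ ℂ[X] g (Polynomial.X ^ k)

theorem levelHom_apply (k : ℕ) (x : g) : levelHom k x = level k x := rfl

theorem level_lie (i j : ℕ) (x y : g) : ⁅level i x, level j y⁆ = level (i + j) ⁅x, y⁆ := by
  rw [level, level, LieAlgebra.ExtendScalars.bracket_tmul, ← pow_add, level]

theorem level_mem_twisted {k : ℕ} {x : g} (hx : x ∈ grade θ k) : level k x ∈ Twisted θ := by
  change extend θ (level k x) = level k x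
  have h : (-1 : ℂ) ^ k * (-1) ^ k = 1 := by rw [← mul_pow]; simp
  rw [extend_level, mem_grade.mp hx, ← levelHom_apply, map_smul, smul_smul, h, one_smul,
    levelHom_apply]

theorem span_level : Submodule.span ℂ {z : HalfLoop g | ∃ k x, z = level k x} = ⊤ := by
  rw [eq_top_iff]
  rintro z -
  induction z using TensorProduct.induction_on with
  | zero => exact zero_mem _
  | add a b ha hb => exact add_mem ha hb
  | tmul p x =>
    induction p using Polynomial.induction_on' with
    | add p q hp hq => rw [TensorProduct.add_tmul]; exact add_mem hp hq
    | monomial n c =>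
      rw [← Polynomial.C_mul_X_pow_eq_monomial, ← Polynomial.smul_eq_C_mul, ←
        TensorProduct.smul_tmul']
      exact Submodule.smul_mem _ _ (Submodule.subset_span ⟨n, x, rfl⟩)

/-- Averaging: a fixed z satisfies 2z = z + θ(z), and z + θ(z) is a combination of homogeneous fixed
elements. -/
theorem twisted_le_span (hinv : ∀ x, θ (θ x) = x) {z : HalfLoop g} (hz : z ∈ Twisted θ) :
    z ∈ Submodule.span ℂ {z : HalfLoop g | ∃ k, ∃ x ∈ grade θ k, z = level k x} := by
  set S := Submodule.span ℂ {z : HalfLoop g | ∃ k, ∃ x ∈ grade θ k, z = level k x}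
  have h : (⊤ : Submodule ℂ (HalfLoop g)) ≤ S.comap (LinearMap.id + (extend θ : _ →ₗ[ℂ] _)) := by
    rw [← span_level, Submodule.span_le]
    rintro _ ⟨k, x, rfl⟩
    change level k x + extend θ (level k x) ∈ S
    rw [extend_level, ← levelHom_apply, ← levelHom_apply, ← map_smul, ← map_add]
    refine Submodule.subset_span ⟨k, _, ?_, rfl⟩
    have h : (-1 : ℂ) ^ k * (-1) ^ k = 1 := by rw [← mul_pow]; simp
    rw [mem_grade, map_add, map_smul, hinv, smul_add, smul_smul, h, one_smul, add_comm]
  have h1 : z + extend θ z ∈ S := h (Submodule.mem_top (x := z))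
  rw [show extend θ z = z from hz, ← two_smul ℂ] at h1
  exact (S.smul_mem_iff two_ne_zero).mp h1

/-- The linear map on the half-loop algebra with the components `ψ k`. -/
def ofLevels {A : Type*} [AddCommGroup A] [Module ℂ A] (ψ : ℕ → g →ₗ[ℂ] A) : HalfLoop g →ₗ[ℂ] A :=
  TensorProduct.lift ((Polynomial.basisMonomials ℂ).constr ℂ ψ)

theorem ofLevels_level {A : Type*} [AddCommGroup A] [Module ℂ A] (ψ : ℕ → g →ₗ[ℂ] A) (k : ℕ)
    (x : g) : ofLevels ψ (level k x) = ψ k x := by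
  have h : (Polynomial.X ^ k : ℂ[X]) = Polynomial.basisMonomials ℂ k := by
    rw [Polynomial.coe_basisMonomials]
    exact (Polynomial.monomial_one_right_eq_X_pow k).symm
  rw [ofLevels, level, TensorProduct.lift.tmul, h, Module.Basis.constr_basis]

/-- A graded family of maps that is compatible with brackets is a homomorphism from the twisted
half-loop algebra. -/
def twistedHom (hinv : ∀ x, θ (θ x) = x) {A : Type*} [LieRing A] [LieAlgebra ℂ A]
    (ψ : ℕ → g →ₗ[ℂ] A) (h : ∀ i j, ∀ x ∈ grade θ i, ∀ y ∈ grade θ j,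
      ⁅ψ i x, ψ j y⁆ = ψ (i + j) ⁅x, y⁆) : Twisted θ →ₗ⁅ℂ⁆ A :=
  { ofLevels ψ ∘ₗ (Twisted θ).toSubmodule.subtype with
    map_lie' := by
      intro x y
      change ofLevels ψ ⁅(x : HalfLoop g), (y : HalfLoop g)⁆ = ⁅ofLevels ψ x, ofLevels ψ y⁆
      refine (bilinear_eq_of_le_span (le_refl _) (le_refl _)
        ((LieModule.toEnd ℂ (HalfLoop g) (HalfLoop g) : _ →ₗ[ℂ] _ →ₗ[ℂ] _).compr₂ (ofLevels ψ))
        ((LieModule.toEnd ℂ A A : A →ₗ[ℂ] A →ₗ[ℂ] A).compl₁₂ (ofLevels ψ) (ofLevels ψ)) ?_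
        _ (twisted_le_span hinv x.2) _ (twisted_le_span hinv y.2))
      rintro _ ⟨i, a, ha, rfl⟩ _ ⟨j, b, hb, rfl⟩
      change ofLevels ψ ⁅level i a, level j b⁆ = ⁅ofLevels ψ (level i a), ofLevels ψ (level j b)⁆
      rw [level_lie, ofLevels_level, ofLevels_level, ofLevels_level, h i j a ha b hb] }

theorem twistedHom_apply (hinv : ∀ x, θ (θ x) = x) {A : Type*} [LieRing A] [LieAlgebra ℂ A]
    (ψ : ℕ → g →ₗ[ℂ] A) (h : ∀ i j, ∀ x ∈ grade θ i, ∀ y ∈ grade θ j,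
      ⁅ψ i x, ψ j y⁆ = ψ (i + j) ⁅x, y⁆) {k : ℕ} {x : g} (hx : x ∈ grade θ k) :
    twistedHom hinv ψ h ⟨level k x, level_mem_twisted hx⟩ = ψ k x :=
  ofLevels_level ψ k x

end HalfLoop

/-! ### The presented algebra and its map to the twisted half-loop algebra. -/

section Quotient

/-- The universal property of the quotient of a Lie algebra by an ideal. -/
def quotientLift {L : Type*} {L' : Type*} [LieRing L] [LieAlgebra ℂ L] [LieRing L'] [LieAlgebra ℂ
    L']
    (J : LieIdeal ℂ L) (f : L →ₗ⁅ℂ⁆ L') (h : J ≤ f.ker) : (L ⧸ J) →ₗ⁅ℂ⁆ L' :=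
  { J.toSubmodule.liftQ (f : L →ₗ[ℂ] L') h with
    map_lie' := by
      rintro ⟨x⟩ ⟨y⟩
      exact f.map_lie x y }

end Quotient

section Presentation

variable {g : Type u} [LieRing g] [LieAlgebra ℂ g] {θ : g →ₗ⁅ℂ⁆ g} {ι : Type v} {κ : Type w}
  (b : SymmetricSpaceBasis θ ι κ) [Fintype ι] [Fintype κ] [DecidableEq ι] [DecidableEq κ]

/-- The projection of the free Lie algebra onto the presented Lie algebra. -/
def presentedMk : Relation.Free θ ι →ₗ⁅ℂ⁆ Presented b :=
  { (LieSubmodule.Quotient.mk' (relationIdeal b) : Relation.Free θ ι →ₗ[ℂ] Presented b) with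
    map_lie' := rfl }

theorem presentedMk_eq_zero {z : Relation.Free θ ι} (hz : z ∈ Relation.all b) :
    presentedMk b z = 0 :=
  LieSubmodule.Quotient.mk_eq_zero'.mpr (LieSubmodule.subset_lieSpan hz)

theorem presentedMk_X (α : ι) : presentedMk b (Relation.X θ α) = genX b α := rfl

theorem presentedMk_B (y : antiFixed θ) : presentedMk b (Relation.B ι y) = genB b y := rfl

theorem genX_lie_genX (α β : ι) : ⁅genX b α, genX b β⁆ = ∑ γ, b.f α β γ • genX b γ := by
  have h := presentedMk_eq_zero b (z := Relation.relXX b α β)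
    (Or.inl (Or.inl (Or.inl (Or.inl ⟨α, β, rfl⟩))))
  simp only [Relation.relXX, map_sub, LieHom.map_lie, map_sum, map_smul, presentedMk_X] at h
  exact sub_eq_zero.mp h

theorem genX_lie_genB (α : ι) (p : κ) :
    ⁅genX b α, genB b (b.Y p)⁆ = ∑ q, b.gXY α p q • genB b (b.Y q) := by
  have h := presentedMk_eq_zero b (z := Relation.relXB b α p)
    (Or.inl (Or.inl (Or.inl (Or.inr ⟨α, p, rfl⟩))))
  simp only [Relation.relXB, map_sub, LieHom.map_lie, map_sum, map_smul, presentedMk_X,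
    presentedMk_B] at h
  exact sub_eq_zero.mp h

theorem genB_linear (s t : ℂ) (y y' : antiFixed θ) :
    genB b (s • y + t • y') = s • genB b y + t • genB b y' := by
  have h := presentedMk_eq_zero b (z := Relation.relLin ι s t y y')
    (Or.inl (Or.inl (Or.inr ⟨s, t, y, y', rfl⟩)))
  simp only [Relation.relLin, map_sub, map_add, map_smul, presentedMk_B] at h
  exact sub_eq_zero.mp h

theorem genB_level_two (p q : κ) : ⁅genB b (b.Y p), genB b (b.Y q)⁆ + ∑ α, ∑ r, ∑ s,
    (1 / b.cBar α * b.w p q α * b.wUp α r s) • ⁅genB b (b.Y r), genB b (b.Y s)⁆ = 0 := by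
  have h := presentedMk_eq_zero b (z := Relation.relLevelTwo b p q)
    (Or.inl (Or.inr ⟨p, q, rfl⟩))
  simpa only [Relation.relLevelTwo, map_add, LieHom.map_lie, map_sum, map_smul,
    presentedMk_B] using h

theorem genB_level_three (p q r : κ) :
    ⁅⁅genB b (b.Y p), genB b (b.Y q)⁆, genB b (b.Y r)⁆ + (2 / b.cG) • ∑ α, ∑ s, ∑ t, ∑ u,
      (b.kappaM⁻¹ t u * b.w p q α * b.gYX r α s) •
        ⁅⁅genB b (b.Y s), genB b (b.Y t)⁆, genB b (b.Y u)⁆ = 0 := by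
  have h := presentedMk_eq_zero b (z := Relation.relLevelThree b p q r) (Or.inr ⟨p, q, r, rfl⟩)
  simpa only [Relation.relLevelThree, map_add, LieHom.map_lie, map_sum, map_smul,
    presentedMk_B] using h

/-- `genB`, as a linear map. -/
def genBHom : antiFixed θ →ₗ[ℂ] Presented b where
  toFun := genB b
  map_add' y y' := by simpa using genB_linear b 1 1 y y'
  map_smul' s y := by simpa using genB_linear b s 0 y 0

/-- A linear map to the presented Lie algebra that restricts to `X_α ↦ X_α` on `h`. -/
def genZero : g →ₗ[ℂ] Presented b := b.basis.constr ℂ (Sum.elim (genX b) 0)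

theorem genZero_X (α : ι) : genZero b (b.X α) = genX b α := by
  rw [genZero, SymmetricSpaceBasis.X, Module.Basis.constr_basis, Sum.elim_inl]

/-- A linear map to the presented Lie algebra that restricts to `y ↦ B(y)` on `m`. -/
def genOne : g →ₗ[ℂ] Presented b := b.basis.constr ℂ (Sum.elim 0 fun p ↦ genB b (b.Y p))

theorem genOne_Y (p : κ) : genOne b (b.Y p) = genB b (b.Y p) := by
  rw [genOne, SymmetricSpaceBasis.Y, Module.Basis.constr_basis, Sum.elim_inr]
  rfl

/-- The map `X_α ↦ X_α^{(0)}`, `B(y) ↦ y^{(1)}` on the free Lie algebra. -/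
def freeToTwisted : Relation.Free θ ι →ₗ⁅ℂ⁆ Twisted θ :=
  FreeLieAlgebra.lift ℂ fun
    | Generator.X α => ⟨level 0 (b.X α), level_mem_twisted (b.X_mem α)⟩
    | Generator.B y => ⟨level 1 (y : g), level_mem_twisted (mem_grade_one.mpr y.2)⟩

theorem freeToTwisted_X (α : ι) :
    freeToTwisted b (Relation.X θ α) = ⟨level 0 (b.X α), level_mem_twisted (b.X_mem α)⟩ :=
  FreeLieAlgebra.lift_of_apply ..

theorem freeToTwisted_B (y : antiFixed θ) : freeToTwisted b (Relation.B ι y)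
    = ⟨level 1 (y : g), level_mem_twisted (mem_grade_one.mpr y.2)⟩ :=
  FreeLieAlgebra.lift_of_apply ..

variable [FiniteDimensional ℂ g] [LieAlgebra.IsSimple ℂ g] (hinv : ∀ x, θ (θ x) = x)
  (hid : ∃ x, θ x ≠ x)
include hinv hid

theorem relationIdeal_le_ker : relationIdeal b ≤ (freeToTwisted b).ker := by
  have : Nontrivial g := by
    obtain ⟨x, hx⟩ := hid
    exact ⟨_, _, hx⟩
  refine LieSubmodule.lieSpan_le.mpr fun z hz ↦ ?_
  rw [SetLike.mem_coe, LieHom.mem_ker]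
  refine Subtype.ext ?_
  let F : Relation.Free θ ι →ₗ⁅ℂ⁆ HalfLoop g := (Twisted θ).incl.comp (freeToTwisted b)
  change F z = 0
  have hX (α : ι) : F (Relation.X θ α) = levelHom 0 (b.X α) :=
    congrArg Subtype.val (freeToTwisted_X b α)
  have hB (y : antiFixed θ) : F (Relation.B ι y) = levelHom 1 (y : g) :=
    congrArg Subtype.val (freeToTwisted_B b y)
  have hlie (i j : ℕ) (x y : g) : ⁅levelHom i x, levelHom j y⁆ = levelHom (i + j) ⁅x, y⁆ :=
    level_lie i j x y
  obtain (((⟨α, β, rfl⟩ | ⟨α, p, rfl⟩) | ⟨s, t, y, y', rfl⟩) | ⟨p, q, rfl⟩) | ⟨p, q, r, rfl⟩ := hz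
  · simp only [Relation.relXX, map_sub, LieHom.map_lie, map_sum, map_smul, hX, hlie, zero_add]
    simp only [← map_smul, ← map_sum]
    rw [show ∑ γ, b.f α β γ • b.X γ = _ from
      b.sum_repr_X hinv (by simpa using lie_mem_grade (b.X_mem α) (b.X_mem β)), sub_self]
  · simp only [Relation.relXB, map_sub, LieHom.map_lie, map_sum, map_smul, hX, hB, hlie, zero_add]
    simp only [← map_smul, ← map_sum]
    rw [show ∑ q, b.gXY α p q • (b.Y q : g) = _ from
      b.sum_repr_Y hinv (by simpa using lie_mem_grade (b.X_mem α) (b.Y_mem p)), sub_self]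
  · simp only [Relation.relLin, map_sub, map_add, map_smul, hB, Submodule.coe_add,
      Submodule.coe_smul, sub_self]
  · simp only [Relation.relLevelTwo, map_add, LieHom.map_lie, map_sum, map_smul, hB, hlie]
    simp only [← map_smul, ← map_sum, ← map_add]
    rw [b.lie_add_sum_wUp_smul_lie hinv hid, map_zero]
  · simp only [Relation.relLevelThree, map_add, LieHom.map_lie, map_sum, map_smul, hB, hlie]
    simp only [← map_smul, ← map_sum, ← map_add]
    rw [b.lie_lie_add_sum_smul_lie_lie hinv, map_zero]

/-- The homomorphism from the presented Lie algebra to the twisted half-loop algebra. -/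
def presentedToTwisted : Presented b →ₗ⁅ℂ⁆ Twisted θ :=
  quotientLift (relationIdeal b) (freeToTwisted b) (relationIdeal_le_ker b hinv hid)

theorem presentedToTwisted_genX (α : ι) :
    (presentedToTwisted b hinv hid (genX b α) : HalfLoop g) = level 0 (b.X α) :=
  congrArg Subtype.val (freeToTwisted_X b α)

theorem presentedToTwisted_genB (y : antiFixed θ) :
    (presentedToTwisted b hinv hid (genB b y) : HalfLoop g) = level 1 (y : g) :=
  congrArg Subtype.val (freeToTwisted_B b y)

omit [LieAlgebra.IsSimple ℂ g] hid in
theorem genOne_apply [LieAlgebra.IsKilling ℂ g] (y : antiFixed θ) : genOne b (y : g) = genB b y :=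
    by
  have h : y = ∑ p, b.basis.repr (y : g) (Sum.inr p) • b.Y p := by
    refine Subtype.ext ?_
    rw [AddSubmonoidClass.coe_finsetSum]
    exact (b.sum_repr_Y hinv (mem_grade_one.mpr y.2)).symm
  rw [b.map_eq_sum_Y hinv (genOne b) (mem_grade_one.mpr y.2)]
  conv_rhs => rw [h]
  change _ = genBHom b _
  rw [map_sum]
  refine Finset.sum_congr rfl fun p _ ↦ ?_
  rw [genOne_Y, map_smul]
  rfl

/-- By induction along g_{k+1} = [m, g_k]: both sides are compatible with brackets and agree in
degrees zero and one. -/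
theorem presentedToTwisted_level {ψ : ℕ → g →ₗ[ℂ] Presented b} (h0 : ψ 0 = genZero b)
    (h1 : ψ 1 = genOne b) (h : ∀ i j, ∀ x ∈ grade θ i, ∀ y ∈ grade θ j,
      ⁅ψ i x, ψ j y⁆ = ψ (i + j) ⁅x, y⁆) (k : ℕ) {x : g} (hx : x ∈ grade θ k) :
    (presentedToTwisted b hinv hid (ψ k x) : HalfLoop g) = level k x := by
  let F : Presented b →ₗ[ℂ] HalfLoop g :=
    (Twisted θ).toSubmodule.subtype ∘ₗ (presentedToTwisted b hinv hid : Presented b →ₗ[ℂ] Twisted θ)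
  have hone : ∀ y ∈ grade θ 1, F (ψ 1 y) = level 1 y := by
    intro y hy
    have hy' := genOne_apply b hinv ⟨y, mem_grade_one.mp hy⟩
    rw [h1, hy']
    exact presentedToTwisted_genB b hinv hid _
  suffices ∀ k, grade θ k ≤ LinearMap.eqLocus (F ∘ₗ ψ k) (levelHom k) from this k hx
  intro k
  induction k with
  | zero =>
    refine b.grade_zero_le hinv fun α ↦ ?_
    rw [LinearMap.mem_eqLocus, LinearMap.comp_apply, h0, genZero_X]
    exact presentedToTwisted_genX b hinv hid α
  | succ k ih =>
    refine (b.homogeneousBasis.grade_succ_le_bracketSpan hinv hid k).trans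
      (bracketSpan_le fun y hy z hz ↦ ?_)
    have hz' : F (ψ k z) = level k z := ih hz
    rw [LinearMap.mem_eqLocus, LinearMap.comp_apply, add_comm k, ← h 1 k y hy z hz, levelHom_apply,
      ← level_lie, ← hone y hy, ← hz']
    exact congrArg Subtype.val ((presentedToTwisted b hinv hid).map_lie (ψ 1 y) (ψ k z))

end Presentation

end TwistedHalfLoop

end

/-! ### The isomorphism. -/

open TwistedHalfLoop in
theorem proposition3p2 {g : Type*} [LieRing g] [LieAlgebra ℂ g] [FiniteDimensional ℂ g]
    [LieAlgebra.IsSimple ℂ g] (hrank : 2 ≤ LieAlgebra.rank ℂ g)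
    (θ : g →ₗ⁅ℂ⁆ g) (hinv : ∀ x, θ (θ x) = x) (hid : ∃ x, θ x ≠ x)
    {ι κ : Type*} [Fintype ι] [Fintype κ] [DecidableEq ι] [DecidableEq κ]
    (b : SymmetricSpaceBasis θ ι κ) :
    ∃ e : Presented b ≃ₗ⁅ℂ⁆ Twisted θ,
      (∀ α, (e (genX b α) : HalfLoop g) = level 0 (b.X α)) ∧
      (∀ p, (e (genB b (b.Y p)) : HalfLoop g) = level 1 (b.Y p : g)) := by
  obtain ⟨ψ, h0, h1, hψ⟩ := b.exists_graded_extension hinv hrank hid (genZero b) (genOne b)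
    (fun α β ↦ by
      simp only [genZero_X, genX_lie_genX]
      rw [b.map_eq_sum_X hinv (genZero b) (by simpa using lie_mem_grade (b.X_mem α) (b.X_mem β))]
      simp only [genZero_X]
      rfl)
    (fun α p ↦ by
      simp only [genZero_X, genOne_Y, genX_lie_genB]
      rw [b.map_eq_sum_Y hinv (genOne b) (by simpa using lie_mem_grade (b.X_mem α) (b.Y_mem p))]
      simp only [genOne_Y]
      rfl)
    (fun p q ↦ by simpa only [genOne_Y] using genB_level_two b p q)
    (fun p q r ↦ by simpa only [genOne_Y] using genB_level_three b p q r)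
  let φ := presentedToTwisted b hinv hid
  let Ψ := twistedHom hinv ψ hψ
  -- It suffices to compare on the homogeneous elements x^{(k)} with x in g_k, which span the
  -- twisted algebra.
  have hφΨ (z : Twisted θ) : φ (Ψ z) = z := by
    refine Subtype.ext ?_
    let F : HalfLoop g →ₗ[ℂ] HalfLoop g :=
      (Twisted θ).toSubmodule.subtype ∘ₗ (φ : Presented b →ₗ[ℂ] Twisted θ) ∘ₗ ofLevels ψ
    suffices Submodule.span ℂ {z : HalfLoop g | ∃ k, ∃ x ∈ grade θ k, z = level k x}
      ≤ LinearMap.eqLocus F LinearMap.id from this (twisted_le_span hinv z.2)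
    rw [Submodule.span_le]
    rintro _ ⟨k, x, hx, rfl⟩
    change (φ (ofLevels ψ (level k x)) : HalfLoop g) = level k x
    rw [ofLevels_level]
    exact presentedToTwisted_level b hinv hid h0 h1 hψ k hx
  -- Homomorphisms out of the free Lie algebra are determined by the generators, including B(y) for
  -- every y in m and not only for the Y_p.
  have hΨφ : (Ψ.comp φ).comp (presentedMk b) = presentedMk b := by
    refine FreeLieAlgebra.hom_ext ?_
    rintro (α | y)
    · change Ψ (freeToTwisted b (Relation.X θ α)) = genX b α
      rw [freeToTwisted_X, twistedHom_apply hinv ψ hψ (b.X_mem α), h0, genZero_X]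
    · change Ψ (freeToTwisted b (Relation.B ι y)) = genB b y
      rw [freeToTwisted_B, twistedHom_apply hinv ψ hψ (mem_grade_one.mpr y.2), h1,
        genOne_apply b hinv]
  refine ⟨{ φ with
    invFun := Ψ
    left_inv := ?_
    right_inv := hφΨ }, presentedToTwisted_genX b hinv hid,
    fun p ↦ presentedToTwisted_genB b hinv hid (b.Y p)⟩
  rintro ⟨z⟩
  exact LieHom.congr_fun hΨφ z
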